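/- Let $\varphi:\mathbb R\to\mathbb R$ be a probability density with $\varphi(x)>0$, $\varphi(x)=\varphi(-x)$, $\sup_x\varphi(x)<\infty$, such that, with $\Phi(x)=\int_{-\infty}^x\varphi(y)\,dy$, for every $\delta>0$ there is $c_\delta>0$ with $\varphi(x)\ge c_\delta\Phi(x)^{1+\delta}$ for all $x\le 0$. For $q>1$, $W^{1,q}_{\mathrm{mix}}(\mathbb R^s,\varphi)$ is the space of functions $f:\mathbb R^s\to\mathbb R$ whose weak mixed derivatives $\partial^v f=\prod_{j\in v}\frac{\partial}{\partial x_j}f$ exist and satisfy $\int_{\mathbb R^s}|\partial^v f(x)|^q\prod_{j=1}^s\varphi(x_j)\,dx<\infty$ for all $v\subseteq\{1,\dots,s\}$, with norm $$\|f\|_{W^{1,q}_{\mathrm{mix}}(\mathbb R^s,\varphi)}=\Big(\sum_{v\subseteq\{1,\dots,s\}}\int_{\mathbb R^s}|\partial^v f(x)|^q\prod_{j=1}^s\varphi(x_j)\,dx\Big)^{1/q}.$$ Let $P_v f$ denote the function obtained from $f$ by integrating out the coordinates $x_j$, $j\in v$, against $\prod_{j\in v}\varphi(x_j)\,dx_j$.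 The ANOVA terms of $f$ are defined recursively by $f_v=P_{\{1,\dots,s\}\setminus v}f-\sum_{w\subsetneq v}f_w$. For $p\ge1$ put $\eta(u)=2^{-p-2}u^{-p-1}\exp(2^p-u^{-p})$ for $u\in(0,1/2]$, and for $\theta\in(0,1/2]$ let $w_\theta:(0,1)\to(0,\infty)$ be $$w_\theta(u)=\begin{cases}(1-\theta)^{-1}\eta(u/\theta),&u\in(0,\theta/2],\\(1-\theta)^{-1}(1-\eta(1-u/\theta)),&u\in(\theta/2,\theta),\\(1-\theta)^{-1},&u\in[\theta,1/2],\\w_\theta(1-u),&u\in(1/2,1).\end{cases}$$ For $\theta_1,\dots,\theta_s\in(0,1/2]$ let $T_j(u)=\Phi^{-1}\big(\int_0^u w_{\theta_j}(t)\,dt\big)$ and $$f^w(u)=\Big(\prod_{j=1}^s w_{\theta_j}(u_j)\Big)\,f\big(T_1(u_1),\dots,T_s(u_s)\big),\qquad u\in(0,1)^s.$$ Let $b\ge2$ be an integer. For $k=\sum_{i=1}^r\kappa_ib^{i-1}$ and $u=\sum_{i\ge1}v_ib^{-i}\in[0,1)$ in base $b$ let ${}_b\mathrm{wal}_k(u)=\exp\big(\frac{2\pi\mathrm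 i}{b}\sum_{i=1}^r\kappa_iv_i\big)$, and for $\boldsymbol k\in\mathbb N_0^s$ let $\hat g(\boldsymbol k)=\int_{(0,1)^s}g(u)\,\overline{\prod_{j=1}^s{}_b\mathrm{wal}_{k_j}(u_j)}\,du$. Let $\lceil k\rceil$ be the number of base-$b$ digits of $k$ ($\lceil0\rceil=0$). For $\ell\in\mathbb N_0^s$ let $s(\ell)=\{j:\ell_j\ne0\}$, $\|\ell\|_1=\sum_j\ell_j$ and $L_\ell=\{\boldsymbol k\in\mathbb N_0^s:\lceil k_j\rceil=\ell_j\text{ for all }j\}$. **Theorem.** Let $\alpha\in(0,1)$, $\varepsilon>0$, $p\ge1$, $q>1$, let $b\ge2$ be an integer, and put $\nu_{\alpha,q}=\max(2\alpha/q,\,2/q+\alpha-1)$. There is a constant $C>0$ depending only on $\varphi,\varepsilon,p,q,b,\alpha$ such that for every $s$, every $f\in W^{1,q}_{\mathrm{mix}}(\mathbb R^s,\varphi)$ and all $\theta_1,\dots,\theta_s\in(0,1/2]$, every ANOVA term $f_v$ belongs to $W^{1,q}_{\mathrm{mix}}(\mathbb R^s,\varphi)$, $f^w\in L^2((0,1)^s)$,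 and for every $\ell\in\mathbb N_0^s\setminus\{0\}$ $$\sigma_\ell^2:=\sum_{\boldsymbol k\in L_\ell}|\widehat{f^w}(\boldsymbol k)|^2\le C^{|s(\ell)|}\,b^{-\alpha\|\ell\|_1}\sum_{v\subseteq s(\ell)}\|f_v\|^2_{W^{1,q}_{\mathrm{mix}}(\mathbb R^s,\varphi)}\prod_{j\in v}\theta_j^{-\nu_{\alpha,q}-\varepsilon}\prod_{j\in s(\ell)\setminus v}\theta_j^{1-\alpha}.$$ -/

import Mathlib

open MeasureTheory

noncomputable section

namespace BDIS

/-! ### The density, its distribution function and the weighted measure -/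

/-- The cumulative distribution function `Φ(x) = ∫_{-∞}^x φ(y) dy`. -/
def cdf (φ : ℝ → ℝ) (x : ℝ) : ℝ := ∫ y in Set.Iic x, φ y

/-- The quantile function `Φ⁻¹`, meant for arguments in `(0, 1)`. -/
def quantile (φ : ℝ → ℝ) (t : ℝ) : ℝ := sInf {x : ℝ | t ≤ cdf φ x}

/-- A strictly positive, symmetric, bounded, light-tailed probability density on `ℝ`. -/
structure IsAdmissibleDensity (φ : ℝ → ℝ) : Prop where
  measurable : Measurable φ
  integrable : Integrable φ
  integral_eq_one : ∫ x, φ x = 1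
  pos : ∀ x, 0 < φ x
  symm : ∀ x, φ (-x) = φ x
  bdd : BddAbove (Set.range φ)
  light_tail : ∀ ε : ℝ, 0 < ε → ∃ c : ℝ, 0 < c ∧ ∀ x ≤ 0, c * cdf φ x ^ (1 + ε) ≤ φ x

/-- The probability measure `φ(x) dx` on `ℝ`. -/
def wMeasure (φ : ℝ → ℝ) : Measure ℝ := volume.withDensity fun x => ENNReal.ofReal (φ x)

/-- The product measure `∏_j φ(x_j) dx` on `ℝ^ι`. -/
def wMeasurePi (φ : ℝ → ℝ) (ι : Type) [Fintype ι] : Measure (ι → ℝ) :=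
  Measure.pi fun _ => wMeasure φ

/-! ### Weak mixed first derivatives and the mixed Sobolev space -/

/-- The classical mixed derivative `(∏_{j ∈ v} ∂/∂x_j) ψ` (used for smooth `ψ`). -/
def mixedPartial {s : ℕ} (v : Finset (Fin s)) (ψ : (Fin s → ℝ) → ℝ) : (Fin s → ℝ) → ℝ :=
  (v.sort (· ≤ ·)).foldr (fun j h x => fderiv ℝ h x (Pi.single j 1)) ψ

/-- `g` is the weak mixed derivative `∂^v f` on `ℝ^s`. -/
def IsWeakMixedDeriv {s : ℕ} (v : Finset (Fin s)) (f g : (Fin s → ℝ) → ℝ) : Prop :=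
  LocallyIntegrable f ∧ LocallyIntegrable g ∧
    ∀ ψ : (Fin s → ℝ) → ℝ, ContDiff ℝ ((⊤ : ℕ∞) : WithTop ℕ∞) ψ → HasCompactSupport ψ →
      ∫ x, f x * mixedPartial v ψ x = (-1) ^ v.card * ∫ x, g x * ψ x

open Classical in
/-- A representative of the weak mixed derivative `∂^v f` (unique up to null sets), and `0` if
there is none. -/
def weakMixedDeriv {s : ℕ} (v : Finset (Fin s)) (f : (Fin s → ℝ) → ℝ) : (Fin s → ℝ) → ℝ :=
  if h : ∃ g, IsWeakMixedDeriv v f g then h.choose else 0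

/-- Membership in `W^{1,q}_mix(ℝ^s, φ)`: all weak mixed derivatives `∂^v f`, `v ⊆ {1,…,s}`, exist
and lie in `L^q(ℝ^s, φ)`. -/
def MemWMix {s : ℕ} (φ : ℝ → ℝ) (q : ℝ) (f : (Fin s → ℝ) → ℝ) : Prop :=
  ∀ v : Finset (Fin s), ∃ g, IsWeakMixedDeriv v f g ∧
    MemLp g (ENNReal.ofReal q) (wMeasurePi φ (Fin s))

/-- The norm of `W^{1,q}_mix(ℝ^s, φ)`. -/
def wMixNorm {s : ℕ} (φ : ℝ → ℝ) (q : ℝ) (f : (Fin s → ℝ) → ℝ) : ℝ :=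
  (∑ v : Finset (Fin s), ∫ x, |weakMixedDeriv v f x| ^ q ∂wMeasurePi φ (Fin s)) ^ (1 / q)

/-! ### The ANOVA decomposition -/

/-- `P_v f`: the coordinates in `v` are integrated out against `φ`. -/
def integrateOut {s : ℕ} (φ : ℝ → ℝ) (v : Finset (Fin s)) (f : (Fin s → ℝ) → ℝ) :
    (Fin s → ℝ) → ℝ :=
  fun x => ∫ y, f (Function.updateFinset x v y) ∂wMeasurePi φ v

/-- The ANOVA term `f_v = P_{vᶜ} f - ∑_{w ⊊ v} f_w`. -/
def anovaTerm {s : ℕ} (φ : ℝ → ℝ) (f : (Fin s → ℝ) → ℝ) (v : Finset (Fin s)) :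
    (Fin s → ℝ) → ℝ :=
  fun x => integrateOut φ vᶜ f x - ∑ w ∈ v.ssubsets.attach, anovaTerm φ f w.1 x
termination_by v.card
decreasing_by exact Finset.card_lt_card (Finset.mem_ssubsets.mp w.2)

/-! ### Boundary-damping importance sampling -/

/-- The function `η_p` on `[0, 1/2]`. -/
def eta (p u : ℝ) : ℝ :=
  if u = 0 then 0 else (2 : ℝ) ^ (-p - 2) * u ^ (-p - 1) * Real.exp ((2 : ℝ) ^ p - u ^ (-p))

/-- `w_θ` on the left half `(0, 1/2]`. -/
def weightLeft (p θ u : ℝ) : ℝ :=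
  if u ≤ θ / 2 then (1 - θ)⁻¹ * eta p (u / θ)
  else if u < θ then (1 - θ)⁻¹ * (1 - eta p (1 - u / θ))
  else (1 - θ)⁻¹

/-- The weight function `w_θ` on `(0, 1)`, symmetric about `1/2`. -/
def weight (p θ u : ℝ) : ℝ :=
  if u ≤ 1 / 2 then weightLeft p θ u else weightLeft p θ (1 - u)

/-- The transport map `T_θ(u) = Φ⁻¹(∫_0^u w_θ(t) dt)`. -/
def transport (φ : ℝ → ℝ) (p θ u : ℝ) : ℝ := quantile φ (∫ t in (0 : ℝ)..u, weight p θ t)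

/-- `f^w(u) = (∏_j w_{θ_j}(u_j)) f(T_{θ_1}(u_1), …, T_{θ_s}(u_s))`. -/
def weightedIntegrand {s : ℕ} (φ : ℝ → ℝ) (p : ℝ) (θ : Fin s → ℝ) (f : (Fin s → ℝ) → ℝ) :
    (Fin s → ℝ) → ℝ :=
  fun u => (∏ j, weight p (θ j) (u j)) * f fun j => transport φ p (θ j) (u j)

/-! ### Walsh functions and variance components -/

/-- The open unit cube `(0, 1)^s`. -/
def unitCube (s : ℕ) : Set (Fin s → ℝ) := Set.univ.pi fun _ => Set.Ioo 0 1

/-- `⌈k⌉`: the number of base-`b` digits of `k`, with `⌈0⌉ = 0`. -/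
def digitLength (b k : ℕ) : ℕ := (Nat.digits b k).length

/-- The `k`-th `b`-adic Walsh function on `[0, 1)`: the coefficient of `b^i` in `k` is
`⌊k / b^i⌋ mod b`, and that of `b^{-(i+1)}` in `u` is `⌊b^{i+1} u⌋ mod b`. -/
def walsh (b k : ℕ) (u : ℝ) : ℂ :=
  Complex.exp (2 * Real.pi * Complex.I / b *
    ∑ i ∈ Finset.range (digitLength b k),
      ((k / b ^ i % b : ℕ) : ℂ) * ((⌊(b : ℝ) ^ (i + 1) * u⌋₊ % b : ℕ) : ℂ))

/-- The multivariate Walsh function. -/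
def walshPi {s : ℕ} (b : ℕ) (k : Fin s → ℕ) (u : Fin s → ℝ) : ℂ := ∏ j, walsh b (k j) (u j)

/-- The Walsh coefficient of `g`. -/
def walshCoeff {s : ℕ} (b : ℕ) (g : (Fin s → ℝ) → ℝ) (k : Fin s → ℕ) : ℂ :=
  ∫ u in unitCube s, (g u : ℂ) * starRingEnd ℂ (walshPi b k u)

/-- The frequency block `L_ℓ = {k | ⌈k⌉ = ℓ}`. -/
def walshBlock {s : ℕ} (b : ℕ) (ℓ : Fin s → ℕ) : Set (Fin s → ℕ) :=
  {k | ∀ j, digitLength b (k j) = ℓ j}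

/-- The frequency blocks are finite, so that the sums over them are finite sums. -/
theorem walshBlock_finite {s b : ℕ} (hb : 2 ≤ b) (ℓ : Fin s → ℕ) : (walshBlock b ℓ).Finite := by
  refine (Set.Finite.pi fun j => Set.finite_Iio (b ^ ℓ j)).subset fun k hk j _ => ?_
  have h := Nat.lt_base_pow_length_digits (b := b) (m := k j) (by omega)
  have h2 : (Nat.digits b (k j)).length = ℓ j := hk j
  simpa [h2] using h

/-- The variance component `σ_ℓ² = ∑_{k ∈ L_ℓ} |ĝ(k)|²`. -/
def varianceComponent {s : ℕ} (b : ℕ) (g : (Fin s → ℝ) → ℝ) (ℓ : Fin s → ℕ) : ℝ :=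
  ∑' k : walshBlock b ℓ, ‖walshCoeff b g k.1‖ ^ 2

/-- The support `{j | ℓ_j ≠ 0}` of a multi-index. -/
def supp {s : ℕ} (ℓ : Fin s → ℕ) : Finset (Fin s) := Finset.univ.filter fun j => ℓ j ≠ 0

/-- The exponent `ν_{α,q} = max(2α/q, 2/q + α - 1)`. -/
def nuExp (α q : ℝ) : ℝ := max (2 * α / q) (2 / q + α - 1)

end BDIS

end

noncomputable section

namespace BDIS

open Set Filter Topology

/-! ### The distribution function Φ and integrability of tail powers -/

section Density

variable {φ : ℝ → ℝ}

/-! Write W for the primitive of the weight w, so that T = Φ⁻¹ ∘ W. In one variable, averaging F(y)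
− F(x) = ∫_x^y F' over y distributed as φ gives F(x) = ∫ F φ + ∫ F'(z) r(x,z) φ(z) dz with r(x,z) =
(Φ(z) − 1[x < z])/φ(z). Applied in every coordinate, this writes f as a sum over v of the integral
of P_{vᶜ} ∂^v f = ∂^v f_v against ∏_{j∈v} r(x_j,z_j) (`MemWMix.exists_representation`). Weak
derivatives are handled as the fundamental theorem of calculus on almost every line
(`HasLineDeriv`), a form that survives averaging over other coordinates.

Substituting x = T(u) and multiplying by the weights turns coordinate j into the weight itself when
j ∉ v, and into φ(z)⁻¹ w(u) (t − 1[W(u) < t]) with t = Φ(z) when j ∈ v. The Walsh coefficients of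
f^w become z-integrals of products of one-dimensional coefficients. The kernel has mean zero, so
only v ⊆ s(ℓ) contribute, and Minkowski's inequality in ℓ²(L_ℓ) (`sum_norm_sq_integral_le`) reduces
the estimate to block energies of functions of one variable.

Such an energy is at most a constant times b^{-ℓ} times a squared variation
(`blockEnergy_succ_le_of_monotoneOn`), and at most the squared L² norm; taking the powers α and 1 −
α of the two gives the decay b^{-αℓ}. For the weight, the constant 1 may be removed, and w − 1 has
squared L² norm O(θ), whence θ^{1-α}. For the kernel put m = min(t, 1 − t), W(τ) = m and D = m +
w(τ): the two bounds are of order b^{-ℓ} D² and m D. Since η vanishes like exp(−u^{-p}), D ≤ C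
(m/θ)^κ for every κ < 1, and κ = γ/(1+α) yields θ^{-γ} m^{γ+1-α}
(`exists_blockEnergy_weightKernel_le`).

What remains is the integral of |∂^v f_v| against ∏ m^{(γ+1-α)/2}/φ. By Hölder and the light tail φ
≥ c m^{1+δ} it is finite once (γ+1−α)/2 > 1/q (`memLp_tailMin_rpow_div`), that is γ > 2/q + α − 1,
and `exists_gamma` finds such a γ in (0, 1+α) with γ ≤ ν + ε. -/

theorem wMeasure_apply_Iic (hφ : IsAdmissibleDensity φ) (x : ℝ) :
    wMeasure φ (Iic x) = ENNReal.ofReal (cdf φ x) := by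
  rw [wMeasure, withDensity_apply _ measurableSet_Iic, cdf,
    ofReal_integral_eq_lintegral_ofReal hφ.integrable.integrableOn
      (ae_of_all _ fun y => (hφ.pos y).le)]

theorem isProbabilityMeasure_wMeasure (hφ : IsAdmissibleDensity φ) :
    IsProbabilityMeasure (wMeasure φ) := by
  constructor
  rw [wMeasure, withDensity_apply _ MeasurableSet.univ, Measure.restrict_univ,
    ← ofReal_integral_eq_lintegral_ofReal hφ.integrable (ae_of_all _ fun y => (hφ.pos y).le),
    hφ.integral_eq_one, ENNReal.ofReal_one]

theorem cdf_nonneg (hφ : IsAdmissibleDensity φ) (x : ℝ) : 0 ≤ cdf φ x :=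
  integral_nonneg fun y => (hφ.pos y).le

theorem cdf_eq_probability_cdf (hφ : IsAdmissibleDensity φ) (x : ℝ) :
    cdf φ x = ProbabilityTheory.cdf (wMeasure φ) x := by
  have := isProbabilityMeasure_wMeasure hφ
  rw [ProbabilityTheory.cdf_eq_real, measureReal_def, wMeasure_apply_Iic hφ,
    ENNReal.toReal_ofReal (cdf_nonneg hφ x)]

theorem cdf_sub (hφ : IsAdmissibleDensity φ) (x y : ℝ) :
    cdf φ y - cdf φ x = ∫ t in x..y, φ t :=
  intervalIntegral.integral_Iic_sub_Iic hφ.integrable.integrableOn hφ.integrable.integrableOn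

theorem continuous_cdf (hφ : IsAdmissibleDensity φ) : Continuous (cdf φ) := by
  have h : cdf φ = fun x => cdf φ 0 + ∫ t in (0 : ℝ)..x, φ t := by
    ext x; rw [← cdf_sub hφ]; ring
  rw [h]
  exact continuous_const.add
    (intervalIntegral.continuous_primitive (fun a b => hφ.integrable.intervalIntegrable) 0)

theorem strictMono_cdf (hφ : IsAdmissibleDensity φ) : StrictMono (cdf φ) := by
  intro x y hxy
  have := intervalIntegral.intervalIntegral_pos_of_pos (f := φ) (a := x) (b := y)
    hφ.integrable.intervalIntegrable hφ.pos hxy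
  rw [← cdf_sub hφ] at this
  linarith

theorem tendsto_cdf_atBot (hφ : IsAdmissibleDensity φ) : Tendsto (cdf φ) atBot (𝓝 0) := by
  have := isProbabilityMeasure_wMeasure hφ
  exact (ProbabilityTheory.tendsto_cdf_atBot (wMeasure φ)).congr
    fun x => (cdf_eq_probability_cdf hφ x).symm

theorem tendsto_cdf_atTop (hφ : IsAdmissibleDensity φ) : Tendsto (cdf φ) atTop (𝓝 1) := by
  have := isProbabilityMeasure_wMeasure hφ
  exact (ProbabilityTheory.tendsto_cdf_atTop (wMeasure φ)).congr
    fun x => (cdf_eq_probability_cdf hφ x).symm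

theorem cdf_pos (hφ : IsAdmissibleDensity φ) (x : ℝ) : 0 < cdf φ x :=
  (cdf_nonneg hφ (x - 1)).trans_lt (strictMono_cdf hφ (by linarith))

theorem cdf_lt_one (hφ : IsAdmissibleDensity φ) (x : ℝ) : cdf φ x < 1 :=
  (strictMono_cdf hφ (show x < x + 1 by linarith)).trans_le
    ((strictMono_cdf hφ).monotone.ge_of_tendsto (tendsto_cdf_atTop hφ) _)

theorem cdf_neg (hφ : IsAdmissibleDensity φ) (x : ℝ) : cdf φ (-x) = 1 - cdf φ x := by
  have h1 : cdf φ (-x) = ∫ y in Ioi x, φ y := by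
    rw [cdf, ← integral_comp_neg_Ioi]
    simp [hφ.symm]
  have h2 := intervalIntegral.integral_Iic_add_Ioi (b := x) (μ := volume)
    hφ.integrable.integrableOn hφ.integrable.integrableOn
  rw [hφ.integral_eq_one] at h2
  rw [h1, cdf]
  linarith

theorem exists_cdf_eq (hφ : IsAdmissibleDensity φ) {t : ℝ} (h0 : 0 < t) (h1 : t < 1) :
    ∃ x, cdf φ x = t := by
  obtain ⟨a, ha⟩ := ((tendsto_cdf_atBot hφ).eventually_lt_const h0).exists
  obtain ⟨b, hb⟩ := ((tendsto_cdf_atTop hφ).eventually_const_lt h1).exists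
  exact mem_range_of_exists_le_of_exists_ge (continuous_cdf hφ) ⟨a, ha.le⟩ ⟨b, hb.le⟩

theorem quantile_cdf (hφ : IsAdmissibleDensity φ) (x : ℝ) : quantile φ (cdf φ x) = x := by
  have : {y : ℝ | cdf φ x ≤ cdf φ y} = Ici x := by
    ext y; exact (strictMono_cdf hφ).le_iff_le
  rw [quantile, this, csInf_Ici]

theorem cdf_quantile (hφ : IsAdmissibleDensity φ) {t : ℝ} (h0 : 0 < t) (h1 : t < 1) :
    cdf φ (quantile φ t) = t := by
  obtain ⟨x, rfl⟩ := exists_cdf_eq hφ h0 h1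
  rw [quantile_cdf hφ]

/-- The smaller of the two tail probabilities `Φ(z)` and `1 - Φ(z)`. -/
def tailMin (φ : ℝ → ℝ) (z : ℝ) : ℝ := min (cdf φ z) (1 - cdf φ z)

theorem tailMin_pos (hφ : IsAdmissibleDensity φ) (z : ℝ) : 0 < tailMin φ z :=
  lt_min (cdf_pos hφ z) (sub_pos.2 (cdf_lt_one hφ z))

theorem tailMin_le_half (z : ℝ) : tailMin φ z ≤ 1 / 2 := by
  rw [tailMin]
  rcases le_total (cdf φ z) (1 / 2) with h | h
  · exact (min_le_left _ _).trans h
  · exact (min_le_right _ _).trans (by linarith)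

theorem continuous_tailMin (hφ : IsAdmissibleDensity φ) : Continuous (tailMin φ) :=
  (continuous_cdf hφ).min (continuous_const.sub (continuous_cdf hφ))

theorem tailMin_neg (hφ : IsAdmissibleDensity φ) (z : ℝ) : tailMin φ (-z) = tailMin φ z := by
  rw [tailMin, tailMin, cdf_neg hφ, sub_sub_cancel, min_comm]

/-- The light-tail hypothesis concerns the left half-line only. Symmetry carries it to the right,
and `tailMin` is at most Φ, so it may replace Φ in the lower bound. -/
theorem exists_tailMin_rpow_le (hφ : IsAdmissibleDensity φ) {δ : ℝ} (hδ : 0 < δ) :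
    ∃ c : ℝ, 0 < c ∧ ∀ x, c * tailMin φ x ^ (1 + δ) ≤ φ x := by
  obtain ⟨c, hc, h⟩ := hφ.light_tail δ hδ
  have key : ∀ x ≤ 0, c * tailMin φ x ^ (1 + δ) ≤ φ x := fun x hx =>
    (mul_le_mul_of_nonneg_left (Real.rpow_le_rpow (tailMin_pos hφ x).le (min_le_left _ _)
      (by linarith)) hc.le).trans (h x hx)
  refine ⟨c, hc, fun x => ?_⟩
  rcases le_total x 0 with hx | hx
  · exact key x hx
  · have := key (-x) (by linarith)
    rwa [tailMin_neg hφ, hφ.symm] at this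

theorem measurable_cdf (hφ : IsAdmissibleDensity φ) : Measurable (cdf φ) :=
  (continuous_cdf hφ).measurable

/-- The probability integral transform: strict monotonicity makes preimages of half-lines
half-lines. It turns integrals of functions of Φ(z) into integrals over (0, 1). -/
theorem map_cdf_wMeasure (hφ : IsAdmissibleDensity φ) :
    (wMeasure φ).map (cdf φ) = volume.restrict (Ioo 0 1) := by
  have := isProbabilityMeasure_wMeasure hφ
  have hm : IsProbabilityMeasure ((wMeasure φ).map (cdf φ)) :=
    Measure.isProbabilityMeasure_map (measurable_cdf hφ).aemeasurable
  refine Measure.ext_of_Iic _ _ fun t => ?_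
  rw [Measure.map_apply (measurable_cdf hφ) measurableSet_Iic,
    Measure.restrict_apply measurableSet_Iic]
  rcases le_or_gt t 0 with h0 | h0
  · have h1 : cdf φ ⁻¹' Iic t = ∅ := by
      ext x; simpa using h0.trans_lt (cdf_pos hφ x)
    have h2 : Iic t ∩ Ioo (0 : ℝ) 1 = ∅ := by
      ext x; simp only [mem_inter_iff, mem_Iic, mem_Ioo, mem_empty_iff_false, iff_false]
      rintro ⟨h, h', _⟩; linarith
    rw [h1, h2]; simp
  rcases le_or_gt 1 t with h1 | h1
  · have h1' : cdf φ ⁻¹' Iic t = univ := by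
      ext x; simpa using (cdf_lt_one hφ x).le.trans h1
    have h2 : Iic t ∩ Ioo (0 : ℝ) 1 = Ioo 0 1 := by
      ext x; simp only [mem_inter_iff, mem_Iic, mem_Ioo, and_iff_right_iff_imp]
      rintro ⟨_, h⟩; linarith
    rw [h1', h2]; simp
  · obtain ⟨x, rfl⟩ := exists_cdf_eq hφ h0 h1
    have h1' : cdf φ ⁻¹' Iic (cdf φ x) = Iic x := by
      ext y; simp [(strictMono_cdf hφ).le_iff_le]
    have h2 : Iic (cdf φ x) ∩ Ioo (0 : ℝ) 1 = Ioc 0 (cdf φ x) := by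
      ext y; simp only [mem_inter_iff, mem_Iic, mem_Ioo, mem_Ioc]
      exact ⟨fun h => ⟨h.2.1, h.1⟩, fun h => ⟨h.2, h.1, h.2.trans_lt h1⟩⟩
    rw [h1', h2, wMeasure_apply_Iic hφ, Real.volume_Ioc, sub_zero]

/-- After t = Φ(z) the integrand is min(t, 1 − t)^ρ. Whatever the sign of ρ it is at most t^ρ + (1 −
t)^ρ, because the minimum is one of its two arguments. -/
theorem integrable_tailMin_rpow (hφ : IsAdmissibleDensity φ) {ρ : ℝ} (hρ : -1 < ρ) :
    Integrable (fun z => tailMin φ z ^ ρ) (wMeasure φ) := by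
  have hI : Integrable (fun t : ℝ => t ^ ρ + (1 - t) ^ ρ) (volume.restrict (Ioo 0 1)) := by
    have h1 : IntervalIntegrable (fun t : ℝ => t ^ ρ) volume 0 1 :=
      intervalIntegral.intervalIntegrable_rpow' hρ
    have h2 : IntervalIntegrable (fun t : ℝ => (1 - t) ^ ρ) volume 0 1 := by
      simpa using (h1.comp_sub_left 1).symm
    have h3 := h1.add h2
    rw [intervalIntegrable_iff_integrableOn_Ioo_of_le zero_le_one] at h3
    exact h3
  rw [← map_cdf_wMeasure hφ] at hI
  have hI2 := hI.comp_measurable (measurable_cdf hφ)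
  refine hI2.mono' ((continuous_tailMin hφ).measurable.pow_const ρ).aestronglyMeasurable
    (ae_of_all _ fun z => ?_)
  have h0 := cdf_pos hφ z
  have h1 := sub_pos.2 (cdf_lt_one hφ z)
  have e1 := Real.rpow_pos_of_pos h0 ρ
  have e2 := Real.rpow_pos_of_pos h1 ρ
  rw [Real.norm_of_nonneg (Real.rpow_nonneg (tailMin_pos hφ z).le _), tailMin]
  simp only [Function.comp]
  rcases min_choice (cdf φ z) (1 - cdf φ z) with h | h <;> rw [h] <;> linarith

/-- `t ↦ tailMin^a / φ` lies in `L^{q'}(φ)` as soon as `a > 1/q`. -/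
theorem memLp_tailMin_rpow_div (hφ : IsAdmissibleDensity φ) {a q q' : ℝ}
    (hq : q.HolderConjugate q') (ha : 1 / q < a) :
    MemLp (fun z => tailMin φ z ^ a / φ z) (ENNReal.ofReal q') (wMeasure φ) := by
  have hq' : 0 < q' := hq.symm.pos
  have hinv : 1 / q' = 1 - 1 / q := by have := hq.inv_add_inv_eq_one; rw [one_div, one_div]; linarith
  -- Half of the available margin. Dividing by φ costs the power 1 + δ of `tailMin`, and (a − 1 − δ)
  -- q' > −1 amounts to δ < a − 1/q because 1/q' = 1 − 1/q.
  set δ := (a - 1 / q) / 2 with hδdef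
  have hδ : 0 < δ := by simp only [hδdef]; linarith
  obtain ⟨c, hc, hcl⟩ := exists_tailMin_rpow_le hφ hδ
  have hmeas : Measurable fun z => tailMin φ z ^ a / φ z :=
    ((continuous_tailMin hφ).measurable.pow_const a).div hφ.measurable
  refine (integrable_norm_rpow_iff hmeas.aestronglyMeasurable (by simpa using hq')
    ENNReal.ofReal_ne_top).1 ?_
  rw [ENNReal.toReal_ofReal hq'.le]
  have hexp : -1 < (a - (1 + δ)) * q' := by
    have : -(1 / q') < a - (1 + δ) := by rw [hinv]; simp only [hδdef]; linarith
    calc -1 = -(1 / q') * q' := by field_simp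
      _ < _ := mul_lt_mul_of_pos_right this hq'
  refine ((integrable_tailMin_rpow hφ hexp).const_mul ((1 / c) ^ q')).mono'
    (hmeas.norm.pow_const q').aestronglyMeasurable (ae_of_all _ fun z => ?_)
  have ht := tailMin_pos hφ z
  have hz := hφ.pos z
  have hb : tailMin φ z ^ a / φ z ≤ 1 / c * tailMin φ z ^ (a - (1 + δ)) := by
    rw [Real.rpow_sub ht, div_mul_div_comm, one_mul]
    exact div_le_div_of_nonneg_left (Real.rpow_nonneg ht.le _) (by positivity) (hcl z)
  have hpos : 0 ≤ tailMin φ z ^ a / φ z := by positivity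
  rw [Real.norm_of_nonneg (Real.rpow_nonneg (norm_nonneg _) _), Real.norm_of_nonneg hpos,
    Real.rpow_mul ht.le, ← Real.mul_rpow (by positivity) (by positivity)]
  exact Real.rpow_le_rpow hpos hb hq'.le

/-- The density is not assumed continuous, so compactness gives no positive minimum. The tail bound
does, since `tailMin` on [−R, R] is at least its value at R. -/
theorem exists_pos_le_of_abs_le (hφ : IsAdmissibleDensity φ) (R : ℝ) :
    ∃ c : ℝ, 0 < c ∧ ∀ x, |x| ≤ R → c ≤ φ x := by
  obtain ⟨c, hc, h⟩ := exists_tailMin_rpow_le hφ one_pos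
  refine ⟨c * tailMin φ R ^ (1 + 1 : ℝ), mul_pos hc (Real.rpow_pos_of_pos (tailMin_pos hφ R) _),
    fun x hx => ?_⟩
  refine (mul_le_mul_of_nonneg_left (Real.rpow_le_rpow (tailMin_pos hφ R).le ?_ (by norm_num))
    hc.le).trans (h x)
  obtain ⟨h1, h2⟩ := abs_le.1 hx
  have m := (strictMono_cdf hφ).monotone
  have e1 : cdf φ x ≤ cdf φ R := m h2
  have e2 : cdf φ (-R) ≤ cdf φ x := m h1
  rw [cdf_neg hφ] at e2
  refine le_min ((min_le_right _ _).trans e2) ((min_le_right _ _).trans (by linarith))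

end Density


/-! ### The damping profile η and its primitive -/

section Eta

variable {p : ℝ}

theorem eta_zero (p : ℝ) : eta p 0 = 0 := by simp [eta]

theorem eta_of_pos {u : ℝ} (hu : 0 < u) :
    eta p u = (2 : ℝ) ^ (-p - 2) * u ^ (-p - 1) * Real.exp ((2 : ℝ) ^ p - u ^ (-p)) := by
  rw [eta, if_neg hu.ne']

theorem eta_pos {u : ℝ} (hu : 0 < u) : 0 < eta p u := by
  rw [eta_of_pos hu]; positivity

theorem eta_half (p : ℝ) : eta p (1 / 2) = 1 / 2 := by
  have h2 : (0 : ℝ) < 2 := two_pos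
  have e1 : (1 / 2 : ℝ) ^ (-p) = 2 ^ p := by
    rw [one_div, Real.inv_rpow h2.le, ← Real.rpow_neg h2.le, neg_neg]
  have e2 : (1 / 2 : ℝ) ^ (-p - 1) = 2 ^ (p + 1) := by
    rw [one_div, Real.inv_rpow h2.le, ← Real.rpow_neg h2.le]; congr 1; ring
  rw [eta_of_pos (by norm_num), e1, e2, sub_self, Real.exp_zero, mul_one, ← Real.rpow_add h2]
  have : -p - 2 + (p + 1) = -1 := by ring
  rw [this, Real.rpow_neg_one]; norm_num

/-- With L = log v − log u, taking logarithms reduces the claim to (p+1) L ≤ v^{-p} (e^{pL} − 1).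
This follows from e^x − 1 ≥ x, v^{-p} ≥ 2^p ≥ 2 and p + 1 ≤ 2p; the last two use p ≥ 1. -/
theorem eta_le_eta (hp : 1 ≤ p) {u v : ℝ} (hu : 0 ≤ u) (huv : u ≤ v) (hv : v ≤ 1 / 2) :
    eta p u ≤ eta p v := by
  rcases hu.eq_or_lt with rfl | hu
  · rw [eta_zero]
    rcases huv.eq_or_lt with rfl | h
    · rw [eta_zero]
    · exact (eta_pos h).le
  have hv0 : 0 < v := hu.trans_le huv
  rw [eta_of_pos hu, eta_of_pos hv0, mul_assoc, mul_assoc]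
  refine mul_le_mul_of_nonneg_left ?_ (by positivity)
  rw [Real.rpow_def_of_pos hu, Real.rpow_def_of_pos hv0, ← Real.exp_add, ← Real.exp_add]
  refine Real.exp_le_exp.2 ?_
  set L := Real.log v - Real.log u with hL
  have hL0 : 0 ≤ L := sub_nonneg.2 (Real.log_le_log hu huv)
  have h1 : u ^ (-p) = v ^ (-p) * Real.exp (p * L) := by
    rw [Real.rpow_def_of_pos hu, Real.rpow_def_of_pos hv0, ← Real.exp_add]
    congr 1; rw [hL]; ring
  have h2 : (2 : ℝ) ≤ v ^ (-p) := by
    have : (1 / 2 : ℝ) ^ (-p) ≤ v ^ (-p) :=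
      Real.rpow_le_rpow_of_nonpos hv0 hv (by linarith)
    have e1 : (1 / 2 : ℝ) ^ (-p) = 2 ^ p := by
      rw [one_div, Real.inv_rpow two_pos.le, ← Real.rpow_neg two_pos.le, neg_neg]
    have e2 : (2 : ℝ) ^ (1 : ℝ) ≤ 2 ^ p := Real.rpow_le_rpow_of_exponent_le one_le_two hp
    rw [Real.rpow_one] at e2
    linarith
  have h3 : p * L + 1 ≤ Real.exp (p * L) := Real.add_one_le_exp _
  have h4 : 2 * (p * L) ≤ v ^ (-p) * (Real.exp (p * L) - 1) :=
    mul_le_mul h2 (by linarith) (by positivity) (by linarith)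
  have h5 : (p + 1) * L ≤ 2 * (p * L) := by nlinarith
  rw [h1]
  have : Real.log u = Real.log v - L := by rw [hL]; ring
  rw [this]
  nlinarith

theorem eta_nonneg {u : ℝ} (hu : 0 ≤ u) : 0 ≤ eta p u := by
  rcases hu.eq_or_lt with rfl | hu
  · rw [eta_zero]
  · exact (eta_pos hu).le

theorem eta_le_half (hp : 1 ≤ p) {u : ℝ} (hu : 0 ≤ u) (hv : u ≤ 1 / 2) : eta p u ≤ 1 / 2 :=
  (eta_le_eta hp hu hv le_rfl).trans (eta_half p).le

theorem measurable_eta (p : ℝ) : Measurable (eta p) := by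
  unfold eta
  refine Measurable.ite (measurableSet_singleton 0) measurable_const ?_
  fun_prop

/-- The antiderivative of `eta p` vanishing at `0`. -/
def etaPrim (p u : ℝ) : ℝ :=
  if u = 0 then 0 else (2 : ℝ) ^ (-p - 2) / p * Real.exp ((2 : ℝ) ^ p - u ^ (-p))

theorem etaPrim_of_pos {u : ℝ} (hu : 0 < u) :
    etaPrim p u = (2 : ℝ) ^ (-p - 2) / p * Real.exp ((2 : ℝ) ^ p - u ^ (-p)) := by
  rw [etaPrim, if_neg hu.ne']

theorem hasDerivAt_etaPrim (hp : 1 ≤ p) {u : ℝ} (hu : 0 < u) :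
    HasDerivAt (etaPrim p) (eta p u) u := by
  have h1 : HasDerivAt (fun u : ℝ => (2 : ℝ) ^ (-p - 2) / p * Real.exp ((2 : ℝ) ^ p - u ^ (-p)))
      (eta p u) u := by
    have h := (((Real.hasDerivAt_rpow_const (p := -p) (Or.inl hu.ne')).const_sub
      ((2 : ℝ) ^ p)).exp).const_mul ((2 : ℝ) ^ (-p - 2) / p)
    refine h.congr_deriv ?_
    rw [eta_of_pos hu]
    field_simp
  refine h1.congr_of_eventuallyEq ?_
  filter_upwards [lt_mem_nhds hu] with v hv
  rw [etaPrim_of_pos hv]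

theorem continuousWithinAt_etaPrim_zero (hp : 1 ≤ p) :
    ContinuousWithinAt (etaPrim p) (Ioi 0) 0 := by
  have h1 : Tendsto (fun u : ℝ => u ^ (-p)) (𝓝[>] 0) atTop :=
    tendsto_rpow_neg_nhdsGT_zero (by linarith)
  have h2 : Tendsto (fun u : ℝ => (2 : ℝ) ^ (-p - 2) / p * Real.exp ((2 : ℝ) ^ p - u ^ (-p)))
      (𝓝[>] 0) (𝓝 ((2 : ℝ) ^ (-p - 2) / p * 0)) := by
    refine Tendsto.const_mul _ (Real.tendsto_exp_atBot.comp ?_)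
    exact tendsto_const_nhds.add_atBot (tendsto_neg_atTop_atBot.comp h1)
  rw [mul_zero] at h2
  rw [ContinuousWithinAt]
  have h0 : etaPrim p 0 = 0 := by simp [etaPrim]
  rw [h0]
  refine h2.congr' ?_
  filter_upwards [self_mem_nhdsWithin] with v hv
  rw [etaPrim_of_pos hv]

theorem intervalIntegrable_eta (hp : 1 ≤ p) {u : ℝ} (hu : 0 ≤ u) (hu2 : u ≤ 1 / 2) :
    IntervalIntegrable (eta p) volume 0 u := by
  refine MonotoneOn.intervalIntegrable ?_
  rw [uIcc_of_le hu]
  exact fun x hx y hy hxy => eta_le_eta hp hx.1 hxy (hy.2.trans hu2)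

theorem integral_eta (hp : 1 ≤ p) {u : ℝ} (hu : 0 ≤ u) (hu2 : u ≤ 1 / 2) :
    ∫ t in (0 : ℝ)..u, eta p t = etaPrim p u := by
  have h0 : etaPrim p 0 = 0 := by simp [etaPrim]
  rw [intervalIntegral.integral_eq_sub_of_hasDerivAt_of_le hu (f := etaPrim p) ?_
    (fun x hx => hasDerivAt_etaPrim hp hx.1) (intervalIntegrable_eta hp hu hu2), h0, sub_zero]
  intro x hx
  rcases hx.1.eq_or_lt with rfl | hx0
  · have := continuousWithinAt_etaPrim_zero hp
    exact (this.insert).mono (fun y hy => by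
      rcases hy.1.eq_or_lt with rfl | h
      · exact mem_insert _ _
      · exact mem_insert_of_mem _ h)
  · exact (hasDerivAt_etaPrim hp hx0).continuousAt.continuousWithinAt

/-- In y = s^{-p}, the profile is at most a constant times y² e^{-y} (as s ≤ 1 ≤ p), while the κ-th
power of its primitive is a constant times e^{-κy}. The surplus factor e^{-(1-κ)y} absorbs y². -/
theorem exists_eta_le_etaPrim_rpow (hp : 1 ≤ p) {κ : ℝ} (h0 : 0 < κ) (h1 : κ < 1) :
    ∃ C : ℝ, 0 < C ∧ ∀ s, 0 < s → s ≤ 1 / 2 → eta p s ≤ C * etaPrim p s ^ κ := by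
  have hp0 : 0 < p := by linarith
  set A : ℝ := (2 : ℝ) ^ (-p - 2) with hA
  have hA0 : 0 < A := by positivity
  set d := 1 - κ with hd
  have hd0 : 0 < d := by linarith
  refine ⟨A * (2 / d ^ 2 * Real.exp (d * 2 ^ p)) * ((A / p) ^ κ)⁻¹, by positivity, fun s hs hs2 => ?_⟩
  set y := s ^ (-p) with hy
  have hy0 : 0 < y := by positivity
  rw [eta_of_pos hs, etaPrim_of_pos hs, Real.mul_rpow (by positivity) (by positivity),
    ← Real.exp_mul]
  have e1 : s ^ (-p - 1) ≤ y ^ 2 := by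
    rw [hy, ← Real.rpow_natCast, ← Real.rpow_mul hs.le]
    exact Real.rpow_le_rpow_of_exponent_ge hs (by linarith) (by push_cast; linarith)
  have e2 : y ^ 2 ≤ 2 / d ^ 2 * Real.exp (d * y) := by
    have := Real.quadratic_le_exp_of_nonneg (x := d * y) (by positivity)
    rw [div_mul_eq_mul_div, le_div_iff₀ (by positivity)]
    have : 0 ≤ d * y := by positivity
    nlinarith
  calc A * s ^ (-p - 1) * Real.exp (2 ^ p - y)
      ≤ A * (2 / d ^ 2 * Real.exp (d * y)) * Real.exp (2 ^ p - y) := by gcongr; exact e1.trans e2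
    _ = A * (2 / d ^ 2 * Real.exp (d * 2 ^ p)) * Real.exp ((2 ^ p - y) * κ) := by
      have : Real.exp (d * y) * Real.exp (2 ^ p - y) =
          Real.exp (d * 2 ^ p) * Real.exp ((2 ^ p - y) * κ) := by
        rw [← Real.exp_add, ← Real.exp_add]; congr 1; rw [hd]; ring
      linear_combination A * (2 / d ^ 2) * this
    _ = _ := by
      have hne : (A / p) ^ κ ≠ 0 := by positivity
      have h3 : ((A / p) ^ κ)⁻¹ * (A / p) ^ κ = 1 := inv_mul_cancel₀ hne
      linear_combination -(A * (2 / d ^ 2 * Real.exp (d * 2 ^ p)) *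
        Real.exp ((2 ^ p - y) * κ)) * h3

end Eta

/-! ### The weight w_θ, its primitive W and the transport map -/

section Weight

variable {p θ : ℝ}

theorem weightLeft_mem (hp : 1 ≤ p) (h0 : 0 < θ) (h1 : θ ≤ 1 / 2) {u : ℝ} (hu : 0 ≤ u) :
    0 ≤ weightLeft p θ u ∧ weightLeft p θ u ≤ (1 - θ)⁻¹ := by
  have hc : 0 < (1 - θ)⁻¹ := inv_pos.2 (by linarith)
  rw [weightLeft]
  split_ifs with h2 h3
  · have e0 : 0 ≤ u / θ := by positivity
    have e1 : u / θ ≤ 1 / 2 := by rw [div_le_iff₀ h0]; linarith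
    have := eta_le_half hp e0 e1
    exact ⟨mul_nonneg hc.le (eta_nonneg e0), by nlinarith⟩
  · have e0 : 0 ≤ 1 - u / θ := by rw [sub_nonneg, div_le_iff₀ h0]; linarith
    have e1 : 1 - u / θ ≤ 1 / 2 := by
      have : 1 / 2 ≤ u / θ := by rw [le_div_iff₀ h0]; linarith
      linarith
    have := eta_le_half hp e0 e1
    have := eta_nonneg (p := p) e0
    exact ⟨mul_nonneg hc.le (by linarith), by nlinarith⟩
  · exact ⟨hc.le, le_rfl⟩

theorem weightLeft_pos (hp : 1 ≤ p) (h0 : 0 < θ) (h1 : θ ≤ 1 / 2) {u : ℝ} (hu : 0 < u) :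
    0 < weightLeft p θ u := by
  have hc : 0 < (1 - θ)⁻¹ := inv_pos.2 (by linarith)
  rw [weightLeft]
  split_ifs with h2 h3
  · exact mul_pos hc (eta_pos (by positivity))
  · have e0 : 0 ≤ 1 - u / θ := by rw [sub_nonneg, div_le_iff₀ h0]; linarith
    have e1 : 1 - u / θ ≤ 1 / 2 := by
      have : 1 / 2 ≤ u / θ := by rw [le_div_iff₀ h0]; linarith
      linarith
    have := eta_le_half hp e0 e1
    exact mul_pos hc (by linarith)
  · exact hc

/-- Each piece inherits monotonicity from `eta`. Across θ/2 the comparison is η(u/θ) ≤ 1/2 ≤ 1 − η(1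
− v/θ). -/
theorem weightLeft_mono (hp : 1 ≤ p) (h0 : 0 < θ) (h1 : θ ≤ 1 / 2) {u v : ℝ} (hu : 0 ≤ u)
    (huv : u ≤ v) : weightLeft p θ u ≤ weightLeft p θ v := by
  have hc : 0 < (1 - θ)⁻¹ := inv_pos.2 (by linarith)
  have hv : 0 ≤ v := hu.trans huv
  by_cases hv2 : θ ≤ v
  · have : weightLeft p θ v = (1 - θ)⁻¹ := by
      rw [weightLeft, if_neg (by linarith), if_neg (by linarith)]
    rw [this]; exact (weightLeft_mem hp h0 h1 hu).2
  push Not at hv2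
  have hdiv : u / θ ≤ v / θ := by gcongr
  have hv1 : v / θ ≤ 1 := by rw [div_le_iff₀ h0]; linarith
  have hhalf : ∀ w, (w ≤ θ / 2 ↔ w / θ ≤ 1 / 2) := fun w => by rw [div_le_iff₀ h0]; constructor <;> intro <;> linarith
  have hu0 : 0 ≤ u / θ := by positivity
  rw [weightLeft, weightLeft, if_pos (huv.trans_lt hv2), if_pos hv2]
  split_ifs with h2 h3 h3
  · rw [hhalf] at h2 h3
    exact mul_le_mul_of_nonneg_left (eta_le_eta hp hu0 hdiv h3) hc.le
  · rw [hhalf] at h2 h3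
    have e1 := eta_le_half hp hu0 h2
    have e2 := eta_le_half hp (u := 1 - v / θ) (by linarith) (by linarith)
    exact mul_le_mul_of_nonneg_left (by linarith) hc.le
  · linarith
  · rw [hhalf] at h2 h3
    have e2 := eta_le_eta hp (u := 1 - v / θ) (v := 1 - u / θ) (by linarith) (by linarith)
      (by linarith)
    exact mul_le_mul_of_nonneg_left (by linarith) hc.le

theorem weight_one_sub (u : ℝ) : weight p θ (1 - u) = weight p θ u := by
  rw [weight, weight]
  split_ifs with h1 h2 h2
  · have : u = 1 / 2 := by linarith
    rw [this]; norm_num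
  · rfl
  · rw [sub_sub_cancel]
  · linarith

theorem weight_of_le {u : ℝ} (hu : u ≤ 1 / 2) : weight p θ u = weightLeft p θ u := if_pos hu

theorem weight_zero (h0 : 0 < θ) : weight p θ 0 = 0 := by
  rw [weight_of_le (by norm_num), weightLeft, if_pos (by positivity), zero_div, eta_zero, mul_zero]

theorem weight_nonneg (hp : 1 ≤ p) (h0 : 0 < θ) (h1 : θ ≤ 1 / 2) {u : ℝ} (hu : u ∈ Icc (0 : ℝ) 1) :
    0 ≤ weight p θ u := by
  rw [weight]
  split_ifs
  exacts [(weightLeft_mem hp h0 h1 hu.1).1, (weightLeft_mem hp h0 h1 (sub_nonneg.2 hu.2)).1]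

theorem weight_le_two (hp : 1 ≤ p) (h0 : 0 < θ) (h1 : θ ≤ 1 / 2) {u : ℝ} (hu : u ∈ Icc (0 : ℝ) 1) :
    weight p θ u ≤ 2 := by
  have hc : (1 - θ)⁻¹ ≤ 2 := by
    rw [inv_le_comm₀ (by linarith) two_pos]; linarith
  rw [weight]
  split_ifs
  exacts [(weightLeft_mem hp h0 h1 hu.1).2.trans hc,
    (weightLeft_mem hp h0 h1 (sub_nonneg.2 hu.2)).2.trans hc]

theorem weight_pos (hp : 1 ≤ p) (h0 : 0 < θ) (h1 : θ ≤ 1 / 2) {u : ℝ} (hu : u ∈ Ioo (0 : ℝ) 1) :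
    0 < weight p θ u := by
  rw [weight]
  split_ifs
  exacts [weightLeft_pos hp h0 h1 hu.1, weightLeft_pos hp h0 h1 (sub_pos.2 hu.2)]

theorem monotoneOn_weight (hp : 1 ≤ p) (h0 : 0 < θ) (h1 : θ ≤ 1 / 2) :
    MonotoneOn (weight p θ) (Icc 0 (1 / 2)) := by
  intro x hx y hy hxy
  rw [weight_of_le hx.2, weight_of_le hy.2]
  exact weightLeft_mono hp h0 h1 hx.1 hxy

theorem antitoneOn_weight (hp : 1 ≤ p) (h0 : 0 < θ) (h1 : θ ≤ 1 / 2) :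
    AntitoneOn (weight p θ) (Icc (1 / 2) 1) := by
  intro x hx y hy hxy
  rw [← weight_one_sub x, ← weight_one_sub y]
  exact monotoneOn_weight hp h0 h1 ⟨by linarith [hy.2], by linarith [hy.1]⟩
    ⟨by linarith [hx.2], by linarith [hx.1]⟩ (by linarith)

theorem measurable_weight (p θ : ℝ) : Measurable (weight p θ) := by
  have hl : Measurable (weightLeft p θ) := by
    unfold weightLeft
    have := measurable_eta p
    refine Measurable.ite measurableSet_Iic (by fun_prop) ?_
    exact Measurable.ite measurableSet_Iio (by fun_prop) (by fun_prop)
  unfold weight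
  exact Measurable.ite measurableSet_Iic hl (hl.comp (by fun_prop))

theorem intervalIntegrable_weight (hp : 1 ≤ p) (h0 : 0 < θ) (h1 : θ ≤ 1 / 2) {a b : ℝ}
    (ha : a ∈ Icc (0 : ℝ) 1) (hb : b ∈ Icc (0 : ℝ) 1) :
    IntervalIntegrable (weight p θ) volume a b := by
  rw [intervalIntegrable_iff]
  refine Measure.integrableOn_of_bounded (M := 2) (by simp)
    (measurable_weight p θ).aestronglyMeasurable ?_
  refine (ae_restrict_iff' measurableSet_uIoc).2 (ae_of_all _ fun x hx => ?_)
  have hx' : x ∈ Icc (0 : ℝ) 1 := (uIoc_subset_uIcc.trans (uIcc_subset_Icc ha hb)) hx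
  rw [Real.norm_of_nonneg (weight_nonneg hp h0 h1 hx')]
  exact weight_le_two hp h0 h1 hx'

/-- The distribution function `∫_0^u w_θ` of the weight. -/
def weightCdf (p θ u : ℝ) : ℝ := ∫ t in (0 : ℝ)..u, weight p θ t

theorem weightCdf_zero : weightCdf p θ 0 = 0 := by simp [weightCdf]

theorem weightCdf_sub (hp : 1 ≤ p) (h0 : 0 < θ) (h1 : θ ≤ 1 / 2) {a b : ℝ}
    (ha : a ∈ Icc (0 : ℝ) 1) (hb : b ∈ Icc (0 : ℝ) 1) :
    weightCdf p θ b - weightCdf p θ a = ∫ t in a..b, weight p θ t :=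
  intervalIntegral.integral_interval_sub_left
    (intervalIntegrable_weight hp h0 h1 (by simp) hb)
    (intervalIntegrable_weight hp h0 h1 (by simp) ha)

theorem weightCdf_eq_etaPrim (hp : 1 ≤ p) (h0 : 0 < θ) (h1 : θ ≤ 1 / 2) {u : ℝ} (hu : 0 ≤ u)
    (hu2 : u ≤ θ / 2) : weightCdf p θ u = θ * (1 - θ)⁻¹ * etaPrim p (u / θ) := by
  have : weightCdf p θ u = ∫ t in (0 : ℝ)..u, (1 - θ)⁻¹ * eta p (t / θ) := by
    refine intervalIntegral.integral_congr fun x hx => ?_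
    rw [uIcc_of_le hu] at hx
    rw [weight_of_le (by linarith [hx.2]), weightLeft, if_pos (hx.2.trans hu2)]
  rw [this, intervalIntegral.integral_const_mul, intervalIntegral.integral_comp_div _ h0.ne',
    zero_div, integral_eta hp (by positivity) (by rw [div_le_iff₀ h0]; linarith), smul_eq_mul]
  ring

/-- The reflection t ↦ θ − t shows that the η-terms on (0, θ/2) and (θ/2, θ) cancel. There remains
(1−θ)⁻¹ (θ/2 + 1/2 − θ) = 1/2, which is the reason for the factor (1−θ)⁻¹ in the weight. -/
theorem weightCdf_half (hp : 1 ≤ p) (h0 : 0 < θ) (h1 : θ ≤ 1 / 2) :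
    weightCdf p θ (1 / 2) = 1 / 2 := by
  have I1 : weightCdf p θ (θ / 2) = ∫ t in (0 : ℝ)..θ / 2, (1 - θ)⁻¹ * eta p (t / θ) := by
    refine intervalIntegral.integral_congr fun x hx => ?_
    rw [uIcc_of_le (by linarith)] at hx
    rw [weight_of_le (by linarith [hx.2]), weightLeft, if_pos hx.2]
  have I2 : ∫ t in (θ / 2)..θ, weight p θ t =
      ∫ t in (θ / 2)..θ, ((1 - θ)⁻¹ - (1 - θ)⁻¹ * eta p ((θ - t) / θ)) := by
    refine intervalIntegral.integral_congr_ae ?_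
    refine ae_of_all _ fun x hx => ?_
    rw [uIoc_of_le (by linarith)] at hx
    rw [weight_of_le (by linarith [hx.2]), weightLeft, if_neg (by linarith [hx.1])]
    split_ifs with h
    · rw [sub_div, div_self h0.ne']; ring
    -- At the endpoint t = θ the definition is already on its constant branch; both formulas agree
    -- because `eta p 0 = 0`.
    · have : x = θ := by linarith [hx.2]
      rw [this, sub_self, zero_div, eta_zero]; ring
  have hsub : IntervalIntegrable (fun t => (1 - θ)⁻¹ * eta p (t / θ)) volume 0 (θ / 2) := by
    have := (intervalIntegrable_eta hp (u := 1 / 2) (by norm_num) le_rfl).comp_mul_right (c := θ⁻¹)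
    simp only [div_inv_eq_mul] at this
    refine IntervalIntegrable.const_mul ?_ _
    convert this using 1
    · simp only [div_eq_mul_inv]
    · rw [zero_mul]
    · ring
  have hsub2 : IntervalIntegrable (fun t => (1 - θ)⁻¹ * eta p ((θ - t) / θ)) volume (θ / 2) θ := by
    have := (hsub.comp_sub_left θ).symm
    convert this using 1
    · ring
    · ring
  have I3 : ∫ t in (θ / 2)..θ, (1 - θ)⁻¹ * eta p ((θ - t) / θ) =
      ∫ t in (0 : ℝ)..θ / 2, (1 - θ)⁻¹ * eta p (t / θ) := by
    rw [intervalIntegral.integral_comp_sub_left (fun t => (1 - θ)⁻¹ * eta p (t / θ)) θ]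
    congr 1 <;> ring
  have I4 : ∫ t in θ..(1 / 2), weight p θ t = ∫ t in θ..(1 / 2), (1 - θ)⁻¹ := by
    refine intervalIntegral.integral_congr fun x hx => ?_
    rw [uIcc_of_le h1] at hx
    rw [weight_of_le hx.2, weightLeft, if_neg (by linarith [hx.1]), if_neg (by linarith [hx.1])]
  have m0 : θ / 2 ∈ Icc (0 : ℝ) 1 := ⟨by linarith, by linarith⟩
  have m1 : θ ∈ Icc (0 : ℝ) 1 := ⟨by linarith, by linarith⟩
  have m2 : (1 / 2 : ℝ) ∈ Icc (0 : ℝ) 1 := ⟨by norm_num, by norm_num⟩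
  rw [← weightCdf_sub hp h0 h1 m0 m1, intervalIntegral.integral_sub (by simp) hsub2, I3, ← I1,
    intervalIntegral.integral_const] at I2
  rw [← weightCdf_sub hp h0 h1 m1 m2, intervalIntegral.integral_const] at I4
  have hne : 1 - θ ≠ 0 := by linarith
  simp only [smul_eq_mul] at I2 I4
  have : weightCdf p θ (1 / 2) = (1 / 2 - θ) * (1 - θ)⁻¹ + (θ - θ / 2) * (1 - θ)⁻¹ := by linarith
  rw [this, ← add_mul]
  field_simp
  ring

theorem weightCdf_one_sub (hp : 1 ≤ p) (h0 : 0 < θ) (h1 : θ ≤ 1 / 2) {u : ℝ}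
    (hu : u ∈ Icc (0 : ℝ) 1) : weightCdf p θ (1 - u) = 1 - weightCdf p θ u := by
  have m2 : (1 / 2 : ℝ) ∈ Icc (0 : ℝ) 1 := ⟨by norm_num, by norm_num⟩
  have m3 : 1 - u ∈ Icc (0 : ℝ) 1 := ⟨by linarith [hu.2], by linarith [hu.1]⟩
  have e1 := weightCdf_sub hp h0 h1 m2 m3
  have e2 := weightCdf_sub hp h0 h1 hu m2
  have e3 : ∫ t in (1 / 2 : ℝ)..(1 - u), weight p θ t = ∫ t in u..(1 / 2), weight p θ t := by
    have := intervalIntegral.integral_comp_sub_left (fun t => weight p θ t) (1 : ℝ)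
      (a := u) (b := 1 / 2)
    simp only [weight_one_sub] at this
    rw [this]; norm_num
  rw [weightCdf_half hp h0 h1] at e1 e2
  linarith

theorem weightCdf_one (hp : 1 ≤ p) (h0 : 0 < θ) (h1 : θ ≤ 1 / 2) : weightCdf p θ 1 = 1 := by
  have := weightCdf_one_sub hp h0 h1 (u := 0) (by simp)
  rwa [sub_zero, weightCdf_zero, sub_zero] at this

theorem strictMonoOn_weightCdf (hp : 1 ≤ p) (h0 : 0 < θ) (h1 : θ ≤ 1 / 2) :
    StrictMonoOn (weightCdf p θ) (Icc 0 1) := by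
  intro x hx y hy hxy
  have := intervalIntegral.intervalIntegral_pos_of_pos_on (f := weight p θ) (a := x) (b := y)
    (intervalIntegrable_weight hp h0 h1 hx hy)
    (fun z hz => weight_pos hp h0 h1 ⟨hx.1.trans_lt hz.1, hz.2.trans_le hy.2⟩) hxy
  rw [← weightCdf_sub hp h0 h1 hx hy] at this
  linarith

theorem continuousOn_weightCdf (hp : 1 ≤ p) (h0 : 0 < θ) (h1 : θ ≤ 1 / 2) :
    ContinuousOn (weightCdf p θ) (Icc 0 1) := by
  have h := intervalIntegrable_weight hp h0 h1 (a := 0) (b := 1) (by simp) (by simp)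
  have := intervalIntegral.continuousOn_primitive_interval' h (a := 0) (by simp)
  rwa [uIcc_of_le zero_le_one] at this

theorem exists_weightCdf_eq (hp : 1 ≤ p) (h0 : 0 < θ) (h1 : θ ≤ 1 / 2) {t : ℝ}
    (ht : t ∈ Ioo (0 : ℝ) 1) : ∃ τ ∈ Ioo (0 : ℝ) 1, weightCdf p θ τ = t := by
  have := intermediate_value_Ioo zero_le_one (continuousOn_weightCdf hp h0 h1)
  rw [weightCdf_zero, weightCdf_one hp h0 h1] at this
  exact this ht

theorem weightCdf_mem_Ioo (hp : 1 ≤ p) (h0 : 0 < θ) (h1 : θ ≤ 1 / 2) {u : ℝ}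
    (hu : u ∈ Ioo (0 : ℝ) 1) : weightCdf p θ u ∈ Ioo (0 : ℝ) 1 := by
  have hs := strictMonoOn_weightCdf hp h0 h1
  have a := hs (by simp) ⟨hu.1.le, hu.2.le⟩ hu.1
  have b := hs ⟨hu.1.le, hu.2.le⟩ (by simp) hu.2
  rw [weightCdf_zero] at a
  rw [weightCdf_one hp h0 h1] at b
  exact ⟨a, b⟩

/-- Near the boundary the weight is controlled by any power `κ < 1` of its primitive. -/
theorem exists_weight_le_rpow (hp : 1 ≤ p) {κ : ℝ} (hκ0 : 0 < κ) (hκ1 : κ < 1) :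
    ∃ C : ℝ, 0 < C ∧ ∀ θ τ : ℝ, 0 < θ → θ ≤ 1 / 2 → 0 < τ → τ ≤ 1 / 2 →
      weight p θ τ ≤ C * (weightCdf p θ τ / θ) ^ κ := by
  obtain ⟨C, hC, h⟩ := exists_eta_le_etaPrim_rpow hp hκ0 hκ1
  have hh0 : 0 < etaPrim p (1 / 2) := by rw [etaPrim_of_pos (by norm_num)]; positivity
  -- The first summand serves τ ≤ θ/2, where W(τ)/θ = (1−θ)⁻¹ `etaPrim p (τ / θ)`. The second serves
  -- τ ≥ θ/2, where w ≤ 2 while W(τ)/θ ≥ `etaPrim p (1 / 2)`.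
  refine ⟨2 * C + 2 / etaPrim p (1 / 2) ^ κ, by positivity, fun θ τ h0 h1 hτ hτ2 => ?_⟩
  have hc : 1 ≤ (1 - θ)⁻¹ := by rw [one_le_inv₀ (by linarith)]; linarith
  have hc2 : (1 - θ)⁻¹ ≤ 2 := by rw [inv_le_comm₀ (by linarith) two_pos]; linarith
  have hW0 : 0 ≤ weightCdf p θ τ / θ :=
    div_nonneg (weightCdf_mem_Ioo hp h0 h1 ⟨hτ, by linarith⟩).1.le h0.le
  rcases le_total τ (θ / 2) with hcase | hcase
  · have hs : 0 < τ / θ := by positivity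
    have hs2 : τ / θ ≤ 1 / 2 := by rw [div_le_iff₀ h0]; linarith
    have hP : 0 ≤ etaPrim p (τ / θ) := by rw [etaPrim_of_pos hs]; positivity
    have hW : etaPrim p (τ / θ) ≤ weightCdf p θ τ / θ := by
      rw [weightCdf_eq_etaPrim hp h0 h1 hτ.le hcase, mul_assoc, mul_div_cancel_left₀ _ h0.ne']
      nlinarith
    calc weight p θ τ = (1 - θ)⁻¹ * eta p (τ / θ) := by
          rw [weight_of_le hτ2, weightLeft, if_pos hcase]
      _ ≤ 2 * (C * etaPrim p (τ / θ) ^ κ) :=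
          mul_le_mul hc2 (h _ hs hs2) (eta_nonneg hs.le) two_pos.le
      _ ≤ 2 * C * (weightCdf p θ τ / θ) ^ κ := by
          rw [mul_assoc]; gcongr
      _ ≤ _ := by
          gcongr
          have : 0 < 2 / etaPrim p (1 / 2) ^ κ := by positivity
          linarith
  · have hW : etaPrim p (1 / 2) ≤ weightCdf p θ τ / θ := by
      have e1 : weightCdf p θ (θ / 2) ≤ weightCdf p θ τ :=
        (strictMonoOn_weightCdf hp h0 h1).monotoneOn ⟨by linarith, by linarith⟩
          ⟨hτ.le, by linarith⟩ hcase
      rw [weightCdf_eq_etaPrim hp h0 h1 (by linarith) le_rfl] at e1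
      have e3 : θ / 2 / θ = 1 / 2 := by field_simp
      rw [e3] at e1
      rw [le_div_iff₀ h0]
      nlinarith [mul_pos h0 hh0]
    calc weight p θ τ ≤ 2 := weight_le_two hp h0 h1 ⟨hτ.le, by linarith⟩
      _ = 2 / etaPrim p (1 / 2) ^ κ * etaPrim p (1 / 2) ^ κ := by field_simp
      _ ≤ (2 * C + 2 / etaPrim p (1 / 2) ^ κ) * (weightCdf p θ τ / θ) ^ κ := by
          refine mul_le_mul (by linarith) (Real.rpow_le_rpow hh0.le hW hκ0.le) (by positivity)
            (by positivity)

/-- In the two boundary layers of width θ one has |w − 1| ≤ 1; between them w − 1 = θ/(1−θ) ≤ 2θ.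
The total is at most 2θ + 4θ² ≤ 4θ. -/
theorem integral_weight_sub_one_sq_le (hp : 1 ≤ p) (h0 : 0 < θ) (h1 : θ ≤ 1 / 2) :
    ∫ u in Ioo (0 : ℝ) 1, (weight p θ u - 1) ^ 2 ≤ 4 * θ := by
  have hb : ∀ u ∈ Ioo (0 : ℝ) 1, (weight p θ u - 1) ^ 2 ≤
      (Ioc 0 θ).indicator 1 u + (Ico (1 - θ) 1).indicator 1 u + 4 * θ ^ 2 := by
    intro u hu
    have a := weight_nonneg hp h0 h1 (Ioo_subset_Icc_self hu)
    have b := weight_le_two hp h0 h1 (Ioo_subset_Icc_self hu)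
    have hi1 : (0 : ℝ) ≤ (Ioc 0 θ).indicator 1 u := indicator_nonneg (by simp) _
    have hi2 : (0 : ℝ) ≤ (Ico (1 - θ) 1).indicator 1 u := indicator_nonneg (by simp) _
    by_cases c1 : u ≤ θ
    · rw [indicator_of_mem (show u ∈ Ioc 0 θ from ⟨hu.1, c1⟩), Pi.one_apply]
      nlinarith
    by_cases c2 : 1 - θ ≤ u
    · rw [indicator_of_mem (show u ∈ Ico (1 - θ) 1 from ⟨c2, hu.2⟩), Pi.one_apply]
      nlinarith
    have e : weight p θ u = (1 - θ)⁻¹ := by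
      rw [weight]
      split_ifs <;> rw [weightLeft, if_neg (by linarith), if_neg (by linarith)]
    have e2 : weight p θ u - 1 = θ * (1 - θ)⁻¹ := by
      rw [e]; field_simp [show 1 - θ ≠ 0 by linarith]; ring
    have hc2 : (1 - θ)⁻¹ ≤ 2 := by rw [inv_le_comm₀ (by linarith) two_pos]; linarith
    have hc0 : 0 < (1 - θ)⁻¹ := inv_pos.2 (by linarith)
    rw [e2, mul_pow]
    have hsq : (1 - θ)⁻¹ ^ 2 ≤ 4 := by nlinarith
    nlinarith [mul_le_mul_of_nonneg_left hsq (sq_nonneg θ)]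
  have i1 : Integrable ((Ioc 0 θ).indicator (1 : ℝ → ℝ)) (volume.restrict (Ioo (0 : ℝ) 1)) :=
    (integrable_const (1 : ℝ)).indicator measurableSet_Ioc
  have i2 : Integrable ((Ico (1 - θ) 1).indicator (1 : ℝ → ℝ)) (volume.restrict (Ioo (0 : ℝ) 1)) :=
    (integrable_const (1 : ℝ)).indicator measurableSet_Ico
  have hle : ∀ s, MeasurableSet s → ∫ u in Ioo (0 : ℝ) 1, s.indicator (1 : ℝ → ℝ) u
      ≤ volume.real s ∨ volume s = ⊤ := by
    intro s hs
    by_cases htop : volume s = ⊤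
    · exact Or.inr htop
    left
    rw [integral_indicator_one hs, measureReal_restrict_apply hs]
    exact measureReal_mono inter_subset_left htop
  have k1 := (hle _ (measurableSet_Ioc (a := 0) (b := θ))).resolve_right (by simp)
  have k2 := (hle _ (measurableSet_Ico (a := 1 - θ) (b := 1))).resolve_right (by simp)
  rw [Real.volume_real_Ioc_of_le h0.le] at k1
  rw [Real.volume_real_Ico_of_le (by linarith)] at k2
  calc ∫ u in Ioo (0 : ℝ) 1, (weight p θ u - 1) ^ 2
      ≤ ∫ u in Ioo (0 : ℝ) 1, ((Ioc 0 θ).indicator 1 u + (Ico (1 - θ) 1).indicator 1 u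
          + 4 * θ ^ 2) := by
        refine integral_mono_of_nonneg (ae_of_all _ fun _ => sq_nonneg _)
          ((i1.add i2).add (integrable_const _)) ?_
        exact (ae_restrict_iff' measurableSet_Ioo).2 (ae_of_all _ hb)
    _ ≤ θ + θ + 4 * θ ^ 2 := by
        have e1 := integral_add (i1.add i2) (integrable_const (4 * θ ^ 2))
        have e2 := integral_add i1 i2
        simp only [Pi.add_apply] at e1
        have e3 : ∫ _ in Ioo (0 : ℝ) 1, 4 * θ ^ 2 = 4 * θ ^ 2 := by simp
        rw [e1, e2, e3]
        linarith
    _ ≤ 4 * θ := by nlinarith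

/-- The measure `w_θ(u) du` on `(0, 1)`. -/
def weightMeasure (p θ : ℝ) : Measure ℝ :=
  (volume.restrict (Ioo 0 1)).withDensity fun u => ENNReal.ofReal (weight p θ u)

theorem cdf_transport {φ : ℝ → ℝ} (hφ : IsAdmissibleDensity φ) (hp : 1 ≤ p) (h0 : 0 < θ)
    (h1 : θ ≤ 1 / 2) {u : ℝ} (hu : u ∈ Ioo (0 : ℝ) 1) :
    cdf φ (transport φ p θ u) = weightCdf p θ u :=
  cdf_quantile hφ (weightCdf_mem_Ioo hp h0 h1 hu).1 (weightCdf_mem_Ioo hp h0 h1 hu).2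

theorem aemeasurable_transport {φ : ℝ → ℝ} (hφ : IsAdmissibleDensity φ) (hp : 1 ≤ p) (h0 : 0 < θ)
    (h1 : θ ≤ 1 / 2) : AEMeasurable (transport φ p θ) (volume.restrict (Ioo 0 1)) := by
  refine aemeasurable_restrict_of_monotoneOn measurableSet_Ioo ?_
  intro x hx y hy hxy
  rw [← (strictMono_cdf hφ).le_iff_le, cdf_transport hφ hp h0 h1 hx, cdf_transport hφ hp h0 h1 hy]
  exact (strictMonoOn_weightCdf hp h0 h1).monotoneOn (Ioo_subset_Icc_self hx)
    (Ioo_subset_Icc_self hy) hxy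

theorem weightMeasure_Ioc (hp : 1 ≤ p) (h0 : 0 < θ) (h1 : θ ≤ 1 / 2) {τ : ℝ}
    (hτ : τ ∈ Ioo (0 : ℝ) 1) : weightMeasure p θ (Ioc 0 τ) = ENNReal.ofReal (weightCdf p θ τ) := by
  have hI := intervalIntegrable_weight hp h0 h1 (a := 0) (b := τ) (by simp) (Ioo_subset_Icc_self hτ)
  rw [intervalIntegrable_iff_integrableOn_Ioc_of_le hτ.1.le] at hI
  have hss : Ioc 0 τ ∩ Ioo 0 1 = Ioc 0 τ :=
    inter_eq_left.2 fun x hx => ⟨hx.1, hx.2.trans_lt hτ.2⟩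
  rw [weightMeasure, withDensity_apply _ measurableSet_Ioc, Measure.restrict_restrict
    measurableSet_Ioc, hss, weightCdf, intervalIntegral.integral_of_le hτ.1.le,
    ofReal_integral_eq_lintegral_ofReal hI]
  refine (ae_restrict_iff' measurableSet_Ioc).2 (ae_of_all _ fun x hx => ?_)
  exact weight_nonneg hp h0 h1 ⟨hx.1.le, hx.2.trans hτ.2.le⟩

theorem weightMeasure_univ (hp : 1 ≤ p) (h0 : 0 < θ) (h1 : θ ≤ 1 / 2) :
    weightMeasure p θ univ = 1 := by
  have hI := intervalIntegrable_weight hp h0 h1 (a := 0) (b := 1) (by simp) (by simp)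
  rw [intervalIntegrable_iff_integrableOn_Ioo_of_le zero_le_one] at hI
  rw [weightMeasure, withDensity_apply _ MeasurableSet.univ, Measure.restrict_univ,
    ← ofReal_integral_eq_lintegral_ofReal hI, ← integral_Ioc_eq_integral_Ioo,
    ← intervalIntegral.integral_of_le zero_le_one]
  · have := weightCdf_one hp h0 h1
    rw [weightCdf] at this
    rw [this, ENNReal.ofReal_one]
  refine (ae_restrict_iff' measurableSet_Ioo).2 (ae_of_all _ fun x hx => ?_)
  exact weight_nonneg hp h0 h1 (Ioo_subset_Icc_self hx)

/-- Since Φ(T(u)) = W(u), the condition T(u) ≤ x means u ≤ τ, where W(τ) = Φ(x), and both measures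
give this event the mass W(τ). -/
theorem map_transport_weightMeasure {φ : ℝ → ℝ} (hφ : IsAdmissibleDensity φ) (hp : 1 ≤ p)
    (h0 : 0 < θ) (h1 : θ ≤ 1 / 2) :
    (weightMeasure p θ).map (transport φ p θ) = wMeasure φ := by
  have hac : weightMeasure p θ ≪ volume.restrict (Ioo 0 1) := withDensity_absolutelyContinuous _ _
  have hT := (aemeasurable_transport hφ hp h0 h1).mono_ac hac
  have : IsProbabilityMeasure (weightMeasure p θ) := ⟨weightMeasure_univ hp h0 h1⟩
  have := isProbabilityMeasure_wMeasure hφ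
  have := Measure.isProbabilityMeasure_map hT
  refine Measure.ext_of_Iic _ _ fun x => ?_
  obtain ⟨τ, hτ, hτe⟩ := exists_weightCdf_eq hp h0 h1 ⟨cdf_pos hφ x, cdf_lt_one hφ x⟩
  rw [wMeasure_apply_Iic hφ, Measure.map_apply_of_aemeasurable hT measurableSet_Iic, ← hτe,
    ← weightMeasure_Ioc hp h0 h1 hτ]
  refine measure_congr ?_
  have hae : ∀ᵐ u ∂weightMeasure p θ, u ∈ Ioo (0 : ℝ) 1 :=
    hac.ae_le (ae_restrict_mem measurableSet_Ioo)
  filter_upwards [hae] with u hu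
  refine propext ?_
  change transport φ p θ u ≤ x ↔ 0 < u ∧ u ≤ τ
  rw [← (strictMono_cdf hφ).le_iff_le, cdf_transport hφ hp h0 h1 hu, ← hτe,
    (strictMonoOn_weightCdf hp h0 h1).le_iff_le (Ioo_subset_Icc_self hu) (Ioo_subset_Icc_self hτ)]
  exact ⟨fun h => ⟨hu.1, h⟩, fun h => h.2⟩

end Weight


/-! ### Walsh coefficients, discrete Parseval and block energies -/

section Walsh

theorem sum_range_mul_eq {M : Type*} [AddCommMonoid M] (b m : ℕ) (f : ℕ → M) :
    ∑ k ∈ Finset.range (b * m), f k =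
      ∑ j ∈ Finset.range m, ∑ c ∈ Finset.range b, f (b * j + c) := by
  induction m with
  | zero => simp
  | succ m ih => rw [Nat.mul_succ, Finset.sum_range_add, ih, Finset.sum_range_succ]

/-- The numbers below b^n are exactly the digit strings of length n, so a sum of products over
digits factors. The induction splits off the lowest digit, k = b j + c. -/
theorem sum_range_pow_prod_digit {b : ℕ} (hb : 0 < b) (n : ℕ) (F : ℕ → ℕ → ℂ) :
    ∑ k ∈ Finset.range (b ^ n), ∏ i ∈ Finset.range n, F i (k / b ^ i % b) =
      ∏ i ∈ Finset.range n, ∑ c ∈ Finset.range b, F i c := by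
  induction n generalizing F with
  | zero => simp
  | succ n ih =>
    rw [pow_succ', sum_range_mul_eq, Finset.prod_range_succ', ← ih fun i => F (i + 1),
      Finset.sum_mul]
    refine Finset.sum_congr rfl fun j _ => ?_
    rw [Finset.mul_sum]
    refine Finset.sum_congr rfl fun c hc => ?_
    have hc := Finset.mem_range.1 hc
    rw [Finset.prod_range_succ']
    congr 1
    · refine Finset.prod_congr rfl fun i _ => ?_
      rw [pow_succ', ← Nat.div_div_eq_div_mul, Nat.mul_add_div hb, Nat.div_eq_of_lt hc, add_zero]
    · rw [pow_zero, Nat.div_one, Nat.mul_add_mod, Nat.mod_eq_of_lt hc]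

theorem mod_pow_eq_of_digit_eq {b n a a' : ℕ}
    (h : ∀ i < n, a / b ^ i % b = a' / b ^ i % b) : a % b ^ n = a' % b ^ n := by
  induction n with
  | zero => simp [Nat.mod_one]
  | succ n ih =>
    rw [Nat.mod_pow_succ, Nat.mod_pow_succ, ih fun i hi => h i (by omega), h n (by omega)]

/-- The value of the `k`-th Walsh function on the `a`-th elementary interval of length `b^{-n}`. -/
def walshDiscrete (b n k a : ℕ) : ℂ :=
  ∏ i ∈ Finset.range n,
    Complex.exp (2 * Real.pi * Complex.I / b * (((k / b ^ i % b : ℕ) : ℂ) *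
      ((a / b ^ (n - 1 - i) % b : ℕ) : ℂ)))

theorem digitLength_le_iff {b : ℕ} (hb : 2 ≤ b) (k n : ℕ) : digitLength b k ≤ n ↔ k < b ^ n := by
  rw [digitLength]; exact Nat.digits_length_le_iff (by omega) k

/-- Such a Walsh function sees only the first n digits of u, and on the a-th cell these are the
digits of a in reverse order. Padding k by leading zeros changes nothing. -/
theorem walsh_eq_walshDiscrete {b : ℕ} (hb : 2 ≤ b) {n k a : ℕ} (hk : k < b ^ n) {u : ℝ}
    (hu : u ∈ Ico ((a : ℝ) / (b : ℝ) ^ n) (((a + 1 : ℕ) : ℝ) / (b : ℝ) ^ n)) :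
    walsh b k u = walshDiscrete b n k a := by
  have hb0 : (0 : ℝ) < b := by positivity
  have hbn : (0 : ℝ) < (b : ℝ) ^ n := by positivity
  have hfl : ⌊(b : ℝ) ^ n * u⌋₊ = a := by
    have h0 : 0 ≤ u := le_trans (by positivity) hu.1
    rw [Nat.floor_eq_iff (by positivity)]
    have h1 := hu.1
    have h2 := hu.2
    rw [div_le_iff₀ hbn] at h1
    rw [lt_div_iff₀ hbn] at h2
    push_cast at h2
    constructor <;> linarith
  have hdl := (digitLength_le_iff hb k n).2 hk
  rw [walsh, walshDiscrete, ← Complex.exp_sum, ← Finset.mul_sum]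
  congr 2
  have hss : Finset.range (digitLength b k) ⊆ Finset.range n := Finset.range_subset_range.2 hdl
  rw [← Finset.sum_subset hss]
  · refine Finset.sum_congr rfl fun i hi => ?_
    have hi := (Finset.mem_range.1 hi).trans_le hdl
    congr 3
    -- Flooring commutes with division by a natural number, so each prefix of u is an integer
    -- quotient of ⌊b^n u⌋ = a.
    have e : (b : ℝ) ^ (i + 1) * u = (b : ℝ) ^ n * u / ((b ^ (n - 1 - i) : ℕ) : ℝ) := by
      push_cast
      rw [eq_div_iff (by positivity), mul_right_comm, ← pow_add]
      congr 2; omega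
    rw [e, Nat.floor_div_natCast, hfl]
  · intro i _ hi
    have hi : digitLength b k ≤ i := by simpa using hi
    rw [Nat.div_eq_of_lt ((digitLength_le_iff hb k i).1 hi)]
    simp

/-- A full geometric sum in z = exp(2πi(d' − d)/b), a b-th root of unity different from 1 because 0
< |d' − d| < b. -/
theorem sum_exp_eq_zero {b d d' : ℕ} (hd : d < b) (hd' : d' < b) (hne : d ≠ d') :
    ∑ c ∈ Finset.range b, (starRingEnd ℂ (Complex.exp (2 * Real.pi * Complex.I / b *
      ((c : ℂ) * (d : ℂ)))) * Complex.exp (2 * Real.pi * Complex.I / b * ((c : ℂ) * (d' : ℂ)))) = 0 := by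
  have hb : (b : ℂ) ≠ 0 := by
    have : b ≠ 0 := by omega
    exact_mod_cast this
  set z := Complex.exp (2 * Real.pi * Complex.I / b * ((d' : ℂ) - d)) with hz
  have hterm : ∀ c : ℕ, starRingEnd ℂ (Complex.exp (2 * Real.pi * Complex.I / b *
      ((c : ℂ) * (d : ℂ)))) * Complex.exp (2 * Real.pi * Complex.I / b * ((c : ℂ) * (d' : ℂ)))
      = z ^ c := by
    intro c
    rw [← Complex.exp_conj, ← Complex.exp_add, hz, ← Complex.exp_nat_mul]
    congr 1
    simp only [map_mul, map_div₀, Complex.conj_I, Complex.conj_ofReal, map_ofNat,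
      Complex.conj_natCast]
    ring
  simp only [hterm]
  have hz1 : z ≠ 1 := by
    rw [hz, Ne, Complex.exp_eq_one_iff]
    rintro ⟨m, hm⟩
    have h2 : (2 * Real.pi * Complex.I : ℂ) ≠ 0 := Complex.two_pi_I_ne_zero
    have h3 : ((d' : ℂ) - d) = m * b := by
      field_simp at hm
      linear_combination hm
    have h4 : (d' : ℤ) - d = m * b := by exact_mod_cast h3
    have h5 : (b : ℤ) ∣ (d' : ℤ) - d := ⟨m, by rw [h4]; ring⟩
    have h6 := Int.eq_zero_of_abs_lt_dvd h5 (by rw [abs_lt]; constructor <;> omega)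
    omega
  have hzb : z ^ b = 1 := by
    rw [hz, ← Complex.exp_nat_mul, Complex.exp_eq_one_iff]
    refine ⟨(d' : ℤ) - d, ?_⟩
    push_cast
    field_simp
  rw [geom_sum_eq hz1, hzb, sub_self, zero_div]

theorem sum_walshDiscrete {b : ℕ} (hb : 2 ≤ b) {n a a' : ℕ} (ha : a < b ^ n) (ha' : a' < b ^ n) :
    ∑ k ∈ Finset.range (b ^ n), starRingEnd ℂ (walshDiscrete b n k a) * walshDiscrete b n k a' =
      if a = a' then (b : ℂ) ^ n else 0 := by
  have hb0 : 0 < b := by omega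
  set F : ℕ → ℕ → ℂ := fun i c => starRingEnd ℂ (Complex.exp (2 * Real.pi * Complex.I / b *
      ((c : ℂ) * ((a / b ^ (n - 1 - i) % b : ℕ) : ℂ)))) * Complex.exp (2 * Real.pi * Complex.I / b *
      ((c : ℂ) * ((a' / b ^ (n - 1 - i) % b : ℕ) : ℂ))) with hF
  have e1 : ∀ k, starRingEnd ℂ (walshDiscrete b n k a) * walshDiscrete b n k a' =
      ∏ i ∈ Finset.range n, F i (k / b ^ i % b) := by
    intro k
    rw [walshDiscrete, walshDiscrete, map_prod, ← Finset.prod_mul_distrib]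
  simp only [e1]
  rw [sum_range_pow_prod_digit hb0]
  split_ifs with h
  · subst h
    have : ∀ i c, F i c = 1 := by
      intro i c
      rw [hF]
      simp only
      rw [← Complex.exp_conj, ← Complex.exp_add]
      simp only [map_mul, map_div₀, Complex.conj_I, Complex.conj_ofReal, map_ofNat,
        Complex.conj_natCast]
      rw [← Complex.exp_zero]
      congr 1
      ring
    simp [this]
  · have : ∃ i < n, a / b ^ i % b ≠ a' / b ^ i % b := by
      by_contra! hcon
      have := mod_pow_eq_of_digit_eq hcon
      rw [Nat.mod_eq_of_lt ha, Nat.mod_eq_of_lt ha'] at this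
      exact h this
    obtain ⟨i, hi, hne⟩ := this
    -- Digit i of a pairs with digit n − 1 − i of k, so this is the factor that vanishes.
    refine Finset.prod_eq_zero (Finset.mem_range.2 (show n - 1 - i < n by omega)) ?_
    have e2 : n - 1 - (n - 1 - i) = i := by omega
    rw [hF]
    simp only [e2]
    exact sum_exp_eq_zero (Nat.mod_lt _ hb0) (Nat.mod_lt _ hb0) hne

/-- Finite Parseval: by `sum_walshDiscrete` the columns of the Walsh matrix are orthogonal with
squared length b^n. -/
theorem sum_normSq_walshDiscrete {b : ℕ} (hb : 2 ≤ b) (n : ℕ) (X : ℕ → ℝ) :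
    ∑ k ∈ Finset.range (b ^ n),
      ‖∑ a ∈ Finset.range (b ^ n), (X a : ℂ) * starRingEnd ℂ (walshDiscrete b n k a)‖ ^ 2 =
      (b : ℝ) ^ n * ∑ a ∈ Finset.range (b ^ n), X a ^ 2 := by
  have key : ∀ k, ((‖∑ a ∈ Finset.range (b ^ n), (X a : ℂ) *
      starRingEnd ℂ (walshDiscrete b n k a)‖ ^ 2 : ℝ) : ℂ) =
      ∑ a ∈ Finset.range (b ^ n), ∑ a' ∈ Finset.range (b ^ n), (X a : ℂ) * X a' *
        (starRingEnd ℂ (walshDiscrete b n k a) * walshDiscrete b n k a') := by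
    intro k
    rw [Complex.ofReal_pow, ← Complex.mul_conj', map_sum, Finset.sum_mul_sum]
    refine Finset.sum_congr rfl fun a _ => Finset.sum_congr rfl fun a' _ => ?_
    rw [map_mul, Complex.conj_ofReal, Complex.conj_conj]
    ring
  have : ((∑ k ∈ Finset.range (b ^ n),
      ‖∑ a ∈ Finset.range (b ^ n), (X a : ℂ) * starRingEnd ℂ (walshDiscrete b n k a)‖ ^ 2 : ℝ) : ℂ)
      = (((b : ℝ) ^ n * ∑ a ∈ Finset.range (b ^ n), X a ^ 2 : ℝ) : ℂ) := by
    rw [Complex.ofReal_sum]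
    simp only [key]
    rw [Finset.sum_comm]
    push_cast
    rw [Finset.mul_sum]
    refine Finset.sum_congr rfl fun a ha => ?_
    rw [Finset.sum_comm]
    simp only [← Finset.mul_sum]
    rw [Finset.sum_congr rfl fun a' ha' => by
      rw [sum_walshDiscrete hb (Finset.mem_range.1 ha) (Finset.mem_range.1 ha')]]
    simp only [mul_ite, mul_zero, Finset.sum_ite_eq, ha, if_true]
    ring
  exact_mod_cast this

theorem norm_walsh (b k : ℕ) (u : ℝ) : ‖walsh b k u‖ = 1 := by
  rw [walsh]
  have : (2 * Real.pi * Complex.I / b *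
    ∑ i ∈ Finset.range (digitLength b k),
      ((k / b ^ i % b : ℕ) : ℂ) * ((⌊(b : ℝ) ^ (i + 1) * u⌋₊ % b : ℕ) : ℂ)) =
      ((2 * Real.pi / b * ∑ i ∈ Finset.range (digitLength b k),
      ((k / b ^ i % b : ℕ) : ℝ) * ((⌊(b : ℝ) ^ (i + 1) * u⌋₊ % b : ℕ) : ℝ) : ℝ) : ℂ) * Complex.I := by
    push_cast; ring
  rw [this, Complex.norm_exp_ofReal_mul_I]

theorem measurable_walsh (b k : ℕ) : Measurable (walsh b k) := by
  unfold walsh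
  refine Complex.measurable_exp.comp (Measurable.const_mul ?_ _)
  refine Finset.measurable_fun_sum _ fun i _ => Measurable.const_mul ?_ _
  have h1 : Measurable fun u : ℝ => ⌊(b : ℝ) ^ (i + 1) * u⌋₊ :=
    Nat.measurable_floor.comp (measurable_const.mul measurable_id)
  have h2 : Measurable fun m : ℕ => ((m % b : ℕ) : ℂ) := measurable_from_nat
  exact h2.comp h1

theorem walsh_zero (b : ℕ) (u : ℝ) : walsh b 0 u = 1 := by simp [walsh, digitLength]

/-- The Walsh coefficient of a function of one variable. -/
def walshCoeffOne (b : ℕ) (g : ℝ → ℝ) (k : ℕ) : ℂ :=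
  ∫ u in Ioo (0 : ℝ) 1, (g u : ℂ) * starRingEnd ℂ (walsh b k u)

theorem integrable_mul_conj_walsh {b k : ℕ} {g : ℝ → ℝ} {μ : Measure ℝ} (hg : Integrable g μ) :
    Integrable (fun u => (g u : ℂ) * starRingEnd ℂ (walsh b k u)) μ := by
  refine hg.ofReal.mul_bdd (c := 1) ?_ (ae_of_all _ fun u => ?_)
  · exact (Complex.continuous_conj.measurable.comp (measurable_walsh b k)).aestronglyMeasurable
  · rw [RCLike.norm_conj, norm_walsh]

theorem walshCoeffOne_add {b : ℕ} {f g : ℝ → ℝ} (hf : IntegrableOn f (Ioo 0 1))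
    (hg : IntegrableOn g (Ioo 0 1)) (k : ℕ) :
    walshCoeffOne b (fun u => f u + g u) k = walshCoeffOne b f k + walshCoeffOne b g k := by
  rw [walshCoeffOne, walshCoeffOne, walshCoeffOne,
    ← integral_add (integrable_mul_conj_walsh hf) (integrable_mul_conj_walsh hg)]
  congr 1; ext u; push_cast; ring

theorem walshCoeffOne_const_mul (b : ℕ) (c : ℝ) (g : ℝ → ℝ) (k : ℕ) :
    walshCoeffOne b (fun u => c * g u) k = c * walshCoeffOne b g k := by
  rw [walshCoeffOne, walshCoeffOne, ← integral_const_mul]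
  congr 1; ext u; push_cast; ring

theorem grid_mem_Icc {b : ℕ} (hb : 2 ≤ b) {n a : ℕ} (ha : a ≤ b ^ n) :
    (a : ℝ) / (b : ℝ) ^ n ∈ Icc (0 : ℝ) 1 := by
  have hbn : (0 : ℝ) < (b : ℝ) ^ n := by positivity
  refine ⟨by positivity, ?_⟩
  rw [div_le_one hbn]
  exact_mod_cast ha

theorem grid_mono {b : ℕ} (n : ℕ) {a a' : ℕ} (h : a ≤ a') :
    (a : ℝ) / (b : ℝ) ^ n ≤ (a' : ℝ) / (b : ℝ) ^ n := by
  gcongr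

theorem sum_integral_grid {b : ℕ} (hb : 2 ≤ b) (n : ℕ) {E : Type*} [NormedAddCommGroup E]
    [NormedSpace ℝ E] {g : ℝ → E} (hg : IntegrableOn g (Ioo 0 1)) :
    ∫ u in Ioo (0 : ℝ) 1, g u = ∑ a ∈ Finset.range (b ^ n),
      ∫ u in ((a : ℝ) / (b : ℝ) ^ n)..(((a + 1 : ℕ) : ℝ) / (b : ℝ) ^ n), g u := by
  have hgI : IntervalIntegrable g volume 0 1 := by
    rwa [intervalIntegrable_iff_integrableOn_Ioo_of_le zero_le_one]
  rw [intervalIntegral.sum_integral_adjacent_intervals (a := fun a : ℕ => (a : ℝ) / (b : ℝ) ^ n)]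
  · have : (b : ℝ) ^ n ≠ 0 := by positivity
    rw [← integral_Ioc_eq_integral_Ioo, ← intervalIntegral.integral_of_le zero_le_one]
    simp [this]
  · intro a ha
    refine hgI.mono_set ?_
    rw [uIcc_of_le (grid_mono n (Nat.le_succ a)), uIcc_of_le zero_le_one]
    exact Icc_subset_Icc (grid_mem_Icc hb ha.le).1 (grid_mem_Icc hb ha).2

/-- The Parseval identity for all Walsh coefficients below `b ^ n`. -/
theorem sum_norm_sq_walshCoeffOne {b : ℕ} (hb : 2 ≤ b) (n : ℕ) {g : ℝ → ℝ}
    (hg : IntegrableOn g (Ioo 0 1)) :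
    ∑ k ∈ Finset.range (b ^ n), ‖walshCoeffOne b g k‖ ^ 2 =
      (b : ℝ) ^ n * ∑ a ∈ Finset.range (b ^ n),
        (∫ u in ((a : ℝ) / (b : ℝ) ^ n)..(((a + 1 : ℕ) : ℝ) / (b : ℝ) ^ n), g u) ^ 2 := by
  rw [← sum_normSq_walshDiscrete hb]
  refine Finset.sum_congr rfl fun k hk => ?_
  rw [walshCoeffOne, sum_integral_grid hb n (integrable_mul_conj_walsh hg)]
  congr 2
  refine Finset.sum_congr rfl fun a _ => ?_
  rw [← intervalIntegral.integral_ofReal, ← intervalIntegral.integral_mul_const,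
    intervalIntegral.integral_of_le (grid_mono n (Nat.le_succ a)),
    intervalIntegral.integral_of_le (grid_mono n (Nat.le_succ a)),
    integral_Ioc_eq_integral_Ioo, integral_Ioc_eq_integral_Ioo]
  refine setIntegral_congr_fun measurableSet_Ioo fun u hu => ?_
  rw [walsh_eq_walshDiscrete hb (Finset.mem_range.1 hk) ⟨hu.1.le, hu.2⟩]

/-- The energy of `g` in the block of frequencies with exactly `ℓ` base-`b` digits. -/
def blockEnergy (b : ℕ) (g : ℝ → ℝ) (ℓ : ℕ) : ℝ :=
  ∑ k ∈ (Finset.range (b ^ ℓ)).filter (fun k => digitLength b k = ℓ), ‖walshCoeffOne b g k‖ ^ 2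

theorem blockEnergy_nonneg (b : ℕ) (g : ℝ → ℝ) (ℓ : ℕ) : 0 ≤ blockEnergy b g ℓ :=
  Finset.sum_nonneg fun _ _ => by positivity

theorem blockEnergy_add_le {b : ℕ} {f g : ℝ → ℝ} (hf : IntegrableOn f (Ioo 0 1))
    (hg : IntegrableOn g (Ioo 0 1)) (ℓ : ℕ) :
    blockEnergy b (fun u => f u + g u) ℓ ≤ 2 * (blockEnergy b f ℓ + blockEnergy b g ℓ) := by
  rw [blockEnergy, blockEnergy, blockEnergy, ← Finset.sum_add_distrib, Finset.mul_sum]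
  refine Finset.sum_le_sum fun k _ => ?_
  rw [walshCoeffOne_add hf hg]
  have := norm_add_le (walshCoeffOne b f k) (walshCoeffOne b g k)
  have h0 := norm_nonneg (walshCoeffOne b f k + walshCoeffOne b g k)
  nlinarith [sq_nonneg (‖walshCoeffOne b f k‖ - ‖walshCoeffOne b g k‖)]

theorem blockEnergy_const_mul (b : ℕ) (c : ℝ) (g : ℝ → ℝ) (ℓ : ℕ) :
    blockEnergy b (fun u => c * g u) ℓ = c ^ 2 * blockEnergy b g ℓ := by
  rw [blockEnergy, blockEnergy, Finset.mul_sum]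
  refine Finset.sum_congr rfl fun k _ => ?_
  rw [walshCoeffOne_const_mul, norm_mul, mul_pow, Complex.norm_real, Real.norm_eq_abs, sq_abs]

theorem blockEnergy_congr {b : ℕ} {f g : ℝ → ℝ} (h : ∀ u ∈ Ioo (0 : ℝ) 1, f u = g u) (ℓ : ℕ) :
    blockEnergy b f ℓ = blockEnergy b g ℓ := by
  have : ∀ k, walshCoeffOne b f k = walshCoeffOne b g k := fun k =>
    setIntegral_congr_fun measurableSet_Ioo fun u hu => by simp only [h u hu]
  simp only [blockEnergy, this]

/-- Cauchy–Schwarz, read off from the nonnegative integral of ((b−a) g − S)². The expansion carries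
an extra factor b − a, so the degenerate interval is treated separately. -/
theorem sq_integral_le {a b : ℝ} (hab : a ≤ b) {g : ℝ → ℝ}
    (hg : IntervalIntegrable g volume a b) (hg2 : IntervalIntegrable (fun u => g u ^ 2) volume a b) :
    (∫ u in a..b, g u) ^ 2 ≤ (b - a) * ∫ u in a..b, g u ^ 2 := by
  set S := ∫ u in a..b, g u
  have h : 0 ≤ ∫ u in a..b, ((b - a) * g u - S) ^ 2 :=
    intervalIntegral.integral_nonneg hab fun _ _ => sq_nonneg _
  have e : ∫ u in a..b, ((b - a) * g u - S) ^ 2 =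
      (b - a) ^ 2 * (∫ u in a..b, g u ^ 2) - 2 * (b - a) * S * S + (b - a) * S ^ 2 := by
    have : (fun u => ((b - a) * g u - S) ^ 2) =
        fun u => ((b - a) ^ 2 * g u ^ 2 - 2 * (b - a) * S * g u) + S ^ 2 := by ext u; ring
    rw [this, intervalIntegral.integral_add ((hg2.const_mul _).sub (hg.const_mul _))
      intervalIntegrable_const, intervalIntegral.integral_sub (hg2.const_mul _) (hg.const_mul _),
      intervalIntegral.integral_const_mul, intervalIntegral.integral_const_mul,
      intervalIntegral.integral_const, smul_eq_mul]
  rw [e] at h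
  rcases hab.eq_or_lt with rfl | hlt
  · simp [S]
  · have h2 : 0 ≤ (b - a) * ((b - a) * (∫ u in a..b, g u ^ 2) - S ^ 2) := by nlinarith
    have := nonneg_of_mul_nonneg_right h2 (by linarith)
    linarith

/-- Bessel's inequality, from Parseval on the grid of mesh b^{-ℓ} and Cauchy–Schwarz on each cell.
-/
theorem blockEnergy_le_integral_sq {b : ℕ} (hb : 2 ≤ b) {g : ℝ → ℝ} (ℓ : ℕ)
    (hg : IntegrableOn g (Ioo 0 1)) (hg2 : IntegrableOn (fun u => g u ^ 2) (Ioo 0 1)) :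
    blockEnergy b g ℓ ≤ ∫ u in Ioo (0 : ℝ) 1, g u ^ 2 := by
  have hbn : (0 : ℝ) < (b : ℝ) ^ ℓ := by positivity
  refine (Finset.sum_le_sum_of_subset_of_nonneg (Finset.filter_subset _ _)
    fun _ _ _ => by positivity).trans ?_
  rw [sum_norm_sq_walshCoeffOne hb ℓ hg, sum_integral_grid hb ℓ hg2, Finset.mul_sum]
  refine Finset.sum_le_sum fun a ha => ?_
  have ha := Finset.mem_range.1 ha
  have hii : ∀ {f : ℝ → ℝ}, IntegrableOn f (Ioo 0 1) → IntervalIntegrable f volume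
      ((a : ℝ) / (b : ℝ) ^ ℓ) (((a + 1 : ℕ) : ℝ) / (b : ℝ) ^ ℓ) := by
    intro f hf
    rw [← intervalIntegrable_iff_integrableOn_Ioo_of_le zero_le_one] at hf
    refine hf.mono_set ?_
    rw [uIcc_of_le (grid_mono ℓ (Nat.le_succ a)), uIcc_of_le zero_le_one]
    exact Icc_subset_Icc (grid_mem_Icc hb ha.le).1 (grid_mem_Icc hb ha).2
  have := sq_integral_le (grid_mono ℓ (Nat.le_succ a)) (hii hg) (hii hg2)
  have e : ((a + 1 : ℕ) : ℝ) / (b : ℝ) ^ ℓ - (a : ℝ) / (b : ℝ) ^ ℓ = ((b : ℝ) ^ ℓ)⁻¹ := by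
    push_cast; field_simp; ring
  rw [e] at this
  calc _ ≤ (b : ℝ) ^ ℓ * (((b : ℝ) ^ ℓ)⁻¹ * _) := mul_le_mul_of_nonneg_left this hbn.le
    _ = _ := by rw [← mul_assoc, mul_inv_cancel₀ hbn.ne', one_mul]

/-- The block is the set difference of the frequencies below b^{m+1} and those below b^m, so its
energy compares cell averages on two consecutive grids. -/
theorem blockEnergy_succ {b : ℕ} (hb : 2 ≤ b) (g : ℝ → ℝ) (m : ℕ) :
    blockEnergy b g (m + 1) = ∑ k ∈ Finset.range (b ^ (m + 1)), ‖walshCoeffOne b g k‖ ^ 2 -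
      ∑ k ∈ Finset.range (b ^ m), ‖walshCoeffOne b g k‖ ^ 2 := by
  have hss : Finset.range (b ^ m) ⊆ Finset.range (b ^ (m + 1)) :=
    Finset.range_subset_range.2 (Nat.pow_le_pow_right (by omega) (by omega))
  rw [eq_sub_iff_add_eq, ← Finset.sum_sdiff hss, blockEnergy]
  congr 1
  refine Finset.sum_congr ?_ fun _ _ => rfl
  ext k
  have h1 := digitLength_le_iff hb k m
  have h2 := digitLength_le_iff hb k (m + 1)
  simp only [Finset.mem_filter, Finset.mem_sdiff, Finset.mem_range]
  omega

/-- The energy is the variance of fine cell averages within coarse cells. Inside the coarse cell A,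
monotonicity keeps each fine integral within b^{-(m+1)} Δ_A of the value predicted by the left
endpoint, where Δ_A is the increment of g. Hence the bound b^{-m} ∑ Δ_A², and the nonnegative
increments telescope to g(1) − g(0). -/
theorem blockEnergy_succ_le_of_monotoneOn {b : ℕ} (hb : 2 ≤ b) {g : ℝ → ℝ} (m : ℕ)
    (hg : MonotoneOn g (Icc 0 1)) :
    blockEnergy b g (m + 1) ≤ ((b : ℝ) ^ m)⁻¹ * (g 1 - g 0) ^ 2 := by
  have hb0 : (0 : ℝ) < b := by positivity
  have hbm : (0 : ℝ) < (b : ℝ) ^ m := by positivity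
  have hbn : (0 : ℝ) < (b : ℝ) ^ (m + 1) := by positivity
  have hgI : IntegrableOn g (Ioo 0 1) := by
    have : IntervalIntegrable g volume 0 1 := by
      refine MonotoneOn.intervalIntegrable ?_
      rwa [uIcc_of_le zero_le_one]
    rwa [intervalIntegrable_iff_integrableOn_Ioo_of_le zero_le_one] at this
  have hii : ∀ x y : ℝ, x ∈ Icc (0 : ℝ) 1 → y ∈ Icc (0 : ℝ) 1 → IntervalIntegrable g volume x y := by
    intro x y hx hy
    refine MonotoneOn.intervalIntegrable (hg.mono ?_)
    exact uIcc_subset_Icc hx hy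
  rw [blockEnergy_succ hb, sum_norm_sq_walshCoeffOne hb _ hgI, sum_norm_sq_walshCoeffOne hb _ hgI]
  set X : ℕ → ℝ := fun a =>
    ∫ u in ((a : ℝ) / (b : ℝ) ^ (m + 1))..(((a + 1 : ℕ) : ℝ) / (b : ℝ) ^ (m + 1)), g u with hX
  have hgrid : ∀ A : ℕ, (A : ℝ) / (b : ℝ) ^ m = ((b * A : ℕ) : ℝ) / (b : ℝ) ^ (m + 1) := by
    intro A; push_cast; field_simp; ring
  have hcoarse : ∀ A < b ^ m, ∫ u in ((A : ℝ) / (b : ℝ) ^ m)..(((A + 1 : ℕ) : ℝ) / (b : ℝ) ^ m), g u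
      = ∑ c ∈ Finset.range b, X (b * A + c) := by
    intro A hA
    have := intervalIntegral.sum_integral_adjacent_intervals (f := g) (μ := volume)
      (a := fun c : ℕ => ((b * A + c : ℕ) : ℝ) / (b : ℝ) ^ (m + 1)) (n := b) ?_
    · rw [hgrid A, hgrid (A + 1), Nat.mul_succ]
      exact this.symm
    · intro c hc
      have : b * A + (c + 1) ≤ b ^ (m + 1) := by
        have : b * (A + 1) ≤ b * b ^ m := Nat.mul_le_mul_left _ hA
        rw [pow_succ']; nlinarith
      exact hii _ _ (grid_mem_Icc hb (by omega)) (grid_mem_Icc hb this)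
  set Δ : ℕ → ℝ := fun A => g (((A + 1 : ℕ) : ℝ) / (b : ℝ) ^ m) - g ((A : ℝ) / (b : ℝ) ^ m) with hΔ
  have hΔ0 : ∀ A < b ^ m, 0 ≤ Δ A := fun A hA =>
    sub_nonneg.2 (hg (grid_mem_Icc hb hA.le) (grid_mem_Icc hb hA) (grid_mono m (Nat.le_succ A)))
  have hXb : ∀ A < b ^ m, ∀ c < b,
      (X (b * A + c) - ((b : ℝ) ^ (m + 1))⁻¹ * g ((A : ℝ) / (b : ℝ) ^ m)) ^ 2 ≤
        (((b : ℝ) ^ (m + 1))⁻¹ * Δ A) ^ 2 := by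
    intro A hA c hc
    have hlow : (A : ℝ) / (b : ℝ) ^ m ≤ ((b * A + c : ℕ) : ℝ) / (b : ℝ) ^ (m + 1) := by
      rw [hgrid]; exact grid_mono _ (by omega)
    have hup : ((b * A + c + 1 : ℕ) : ℝ) / (b : ℝ) ^ (m + 1) ≤ ((A + 1 : ℕ) : ℝ) / (b : ℝ) ^ m := by
      rw [hgrid]; exact grid_mono _ (by rw [Nat.mul_succ]; omega)
    have hmid := grid_mono (b := b) (m + 1) (Nat.le_succ (b * A + c))
    have m0 := grid_mem_Icc hb hA.le
    have m1 := grid_mem_Icc hb (n := m) (show A + 1 ≤ b ^ m from hA)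
    have mem : ∀ u ∈ Icc (((b * A + c : ℕ) : ℝ) / (b : ℝ) ^ (m + 1))
        (((b * A + c + 1 : ℕ) : ℝ) / (b : ℝ) ^ (m + 1)), u ∈ Icc (0 : ℝ) 1 := fun u hu =>
      ⟨m0.1.trans (hlow.trans hu.1), (hu.2.trans hup).trans m1.2⟩
    have hlen : ((b * A + c + 1 : ℕ) : ℝ) / (b : ℝ) ^ (m + 1) -
        ((b * A + c : ℕ) : ℝ) / (b : ℝ) ^ (m + 1) = ((b : ℝ) ^ (m + 1))⁻¹ := by
      push_cast; field_simp; ring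
    have hI := hii _ _ (mem _ (left_mem_Icc.2 hmid)) (mem _ (right_mem_Icc.2 hmid))
    have l1 : ((b : ℝ) ^ (m + 1))⁻¹ * g ((A : ℝ) / (b : ℝ) ^ m) ≤ X (b * A + c) := by
      rw [← hlen, ← smul_eq_mul (a := _ - _), ← intervalIntegral.integral_const]
      refine intervalIntegral.integral_mono_on hmid (by simp) hI fun u hu => ?_
      exact hg m0 (mem u hu) (hlow.trans hu.1)
    have l2 : X (b * A + c) ≤ ((b : ℝ) ^ (m + 1))⁻¹ * g (((A + 1 : ℕ) : ℝ) / (b : ℝ) ^ m) := by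
      rw [← hlen, ← smul_eq_mul (a := _ - _), ← intervalIntegral.integral_const]
      refine intervalIntegral.integral_mono_on hmid hI (by simp) fun u hu => ?_
      exact hg (mem u hu) m1 (hu.2.trans hup)
    refine pow_le_pow_left₀ (by linarith) ?_ 2
    simp only [hΔ]
    rw [mul_sub]
    linarith
  have hblock : ∀ A < b ^ m, ∑ c ∈ Finset.range b, X (b * A + c) ^ 2 -
      (b : ℝ)⁻¹ * (∑ c ∈ Finset.range b, X (b * A + c)) ^ 2 ≤
        b * (((b : ℝ) ^ (m + 1))⁻¹ * Δ A) ^ 2 := by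
    intro A hA
    set Y := ((b : ℝ) ^ (m + 1))⁻¹ * g ((A : ℝ) / (b : ℝ) ^ m)
    set S := ∑ c ∈ Finset.range b, X (b * A + c)
    have h1 : ∑ c ∈ Finset.range b, (X (b * A + c) - Y) ^ 2 =
        ∑ c ∈ Finset.range b, X (b * A + c) ^ 2 - 2 * Y * S + b * Y ^ 2 := by
      have : ∀ c, (X (b * A + c) - Y) ^ 2 = X (b * A + c) ^ 2 - 2 * Y * X (b * A + c) + Y ^ 2 :=
        fun c => by ring
      simp only [this, Finset.sum_add_distrib, Finset.sum_sub_distrib, ← Finset.mul_sum,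
        Finset.sum_const, Finset.card_range, nsmul_eq_mul]
      rfl
    have h2 : ∑ c ∈ Finset.range b, (X (b * A + c) - Y) ^ 2 ≤
        b * (((b : ℝ) ^ (m + 1))⁻¹ * Δ A) ^ 2 := by
      refine (Finset.sum_le_sum fun c hc => hXb A hA c (Finset.mem_range.1 hc)).trans ?_
      simp
    -- Centring at Y instead of the mean increases the sum of squares by exactly this amount.
    have h3 : 0 ≤ (b : ℝ)⁻¹ * (S - b * Y) ^ 2 := by positivity
    have h4 : (b : ℝ)⁻¹ * (S - b * Y) ^ 2 = (b : ℝ)⁻¹ * S ^ 2 - 2 * Y * S + b * Y ^ 2 := by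
      field_simp; ring
    linarith
  have htel : ∑ A ∈ Finset.range (b ^ m), Δ A = g 1 - g 0 := by
    have := Finset.sum_range_sub (fun A : ℕ => g ((A : ℝ) / (b : ℝ) ^ m)) (b ^ m)
    simp only [hΔ]
    rw [this]
    simp [hbm.ne']
  have hc2 : ∑ A ∈ Finset.range (b ^ m),
      (∫ u in ((A : ℝ) / (b : ℝ) ^ m)..(((A + 1 : ℕ) : ℝ) / (b : ℝ) ^ m), g u) ^ 2 =
      ∑ A ∈ Finset.range (b ^ m), (∑ c ∈ Finset.range b, X (b * A + c)) ^ 2 :=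
    Finset.sum_congr rfl fun A hA => by rw [hcoarse A (Finset.mem_range.1 hA)]
  rw [hc2]
  have hfine : ∑ a ∈ Finset.range (b ^ (m + 1)), X a ^ 2 =
      ∑ A ∈ Finset.range (b ^ m), ∑ c ∈ Finset.range b, X (b * A + c) ^ 2 := by
    rw [pow_succ', sum_range_mul_eq]
  change (b : ℝ) ^ (m + 1) * ∑ a ∈ Finset.range (b ^ (m + 1)), X a ^ 2 - _ ≤ _
  rw [hfine]
  calc _ = (b : ℝ) ^ (m + 1) * ∑ A ∈ Finset.range (b ^ m),
        (∑ c ∈ Finset.range b, X (b * A + c) ^ 2 -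
          (b : ℝ)⁻¹ * (∑ c ∈ Finset.range b, X (b * A + c)) ^ 2) := by
        rw [Finset.sum_sub_distrib, ← Finset.mul_sum, mul_sub, ← mul_assoc _ ((b : ℝ)⁻¹)]
        congr 2
        rw [pow_succ]; field_simp
    _ ≤ (b : ℝ) ^ (m + 1) * ∑ A ∈ Finset.range (b ^ m), b * (((b : ℝ) ^ (m + 1))⁻¹ * Δ A) ^ 2 :=
        mul_le_mul_of_nonneg_left (Finset.sum_le_sum fun A hA => hblock A (Finset.mem_range.1 hA))
          hbn.le
    _ = ((b : ℝ) ^ m)⁻¹ * ∑ A ∈ Finset.range (b ^ m), Δ A ^ 2 := by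
        rw [Finset.mul_sum, Finset.mul_sum]
        refine Finset.sum_congr rfl fun A _ => ?_
        rw [pow_succ]; field_simp
    _ ≤ ((b : ℝ) ^ m)⁻¹ * (g 1 - g 0) ^ 2 := by
        refine mul_le_mul_of_nonneg_left ?_ (by positivity)
        rw [← htel]
        exact Finset.sum_sq_le_sq_sum_of_nonneg fun A hA => hΔ0 A (Finset.mem_range.1 hA)

end Walsh


/-! ### One-dimensional energy estimates for the weight and the kernel -/

section OneDim

theorem blockEnergy_succ_le_of_antitoneOn {b : ℕ} (hb : 2 ≤ b) {g : ℝ → ℝ} (m : ℕ)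
    (hg : AntitoneOn g (Icc 0 1)) :
    blockEnergy b g (m + 1) ≤ ((b : ℝ) ^ m)⁻¹ * (g 1 - g 0) ^ 2 := by
  have hmono : MonotoneOn (fun u => (-1) * g u) (Icc 0 1) := fun x hx y hy hxy => by
    have := hg hx hy hxy
    simp only; linarith
  have h := blockEnergy_succ_le_of_monotoneOn hb m hmono
  rw [blockEnergy_const_mul] at h
  linarith

/-- From x = x^α x^{1-α}. This is how decay in the frequency is traded against a small L² norm. -/
theorem interpolate_le {x y z α : ℝ} (hα0 : 0 ≤ α) (hα1 : α ≤ 1) (hx : 0 ≤ x) (hy : x ≤ y)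
    (hz : x ≤ z) : x ≤ y ^ α * z ^ (1 - α) := by
  rcases hx.eq_or_lt with rfl | hx0
  · exact mul_nonneg (Real.rpow_nonneg hy _) (Real.rpow_nonneg hz _)
  · calc x = x ^ α * x ^ (1 - α) := by rw [← Real.rpow_add hx0]; simp
      _ ≤ y ^ α * z ^ (1 - α) := mul_le_mul (Real.rpow_le_rpow hx hy hα0)
        (Real.rpow_le_rpow hx hz (by linarith)) (Real.rpow_nonneg hx _)
        (Real.rpow_nonneg (hx.trans hy) _)

theorem integrableOn_of_bdd {g : ℝ → ℝ} (hm : Measurable g) {M : ℝ}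
    (hM : ∀ u ∈ Ioo (0 : ℝ) 1, |g u| ≤ M) : IntegrableOn g (Ioo 0 1) :=
  Measure.integrableOn_of_bounded (M := M) (by simp) hm.aestronglyMeasurable
    ((ae_restrict_iff' measurableSet_Ioo).2 (ae_of_all _ hM))

variable {p θ : ℝ}

theorem abs_weight_le (hp : 1 ≤ p) (h0 : 0 < θ) (h1 : θ ≤ 1 / 2) {u : ℝ}
    (hu : u ∈ Icc (0 : ℝ) 1) : |weight p θ u| ≤ 2 := by
  rw [abs_of_nonneg (weight_nonneg hp h0 h1 hu)]
  exact weight_le_two hp h0 h1 hu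

theorem weight_le_weight_of_le (hp : 1 ≤ p) (h0 : 0 < θ) (h1 : θ ≤ 1 / 2) {u τ : ℝ} (hu : 0 ≤ u)
    (hut : u ≤ τ) (hτ : τ ≤ 1 / 2) : weight p θ u ≤ weight p θ τ :=
  monotoneOn_weight hp h0 h1 ⟨hu, hut.trans hτ⟩ ⟨hu.trans hut, hτ⟩ hut

theorem weight_le_weight_of_ge (hp : 1 ≤ p) (h0 : 0 < θ) (h1 : θ ≤ 1 / 2) {u τ : ℝ} (hu : u ≤ 1)
    (hut : τ ≤ u) (hτ : 1 / 2 ≤ τ) : weight p θ u ≤ weight p θ τ :=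
  antitoneOn_weight hp h0 h1 ⟨hτ, hut.trans hu⟩ ⟨hτ.trans hut, hu⟩ hut

/-- The truncated weight is the monotone function w(min(u, τ)) − w(τ) plus the antitone step w(τ)
1[u < τ]. Each has total change w(τ), because w(0) = 0, so the bound shrinks as τ approaches the
boundary. -/
theorem blockEnergy_weight_lt_le {b : ℕ} (hb : 2 ≤ b) (hp : 1 ≤ p) (h0 : 0 < θ) (h1 : θ ≤ 1 / 2)
    (m : ℕ) {τ : ℝ} (ht0 : 0 ≤ τ) (ht1 : τ ≤ 1 / 2) :
    blockEnergy b (fun u => if u < τ then weight p θ u else 0) (m + 1) ≤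
      4 * ((b : ℝ) ^ m)⁻¹ * weight p θ τ ^ 2 := by
  have hmw := measurable_weight p θ
  have hw0 : 0 ≤ weight p θ τ := weight_nonneg hp h0 h1 ⟨ht0, by linarith⟩
  set A : ℝ → ℝ := fun u => weight p θ (min u τ) with hA
  set B : ℝ → ℝ := fun u => if u < τ then weight p θ τ else 0 with hB
  have hAm : MonotoneOn A (Icc 0 1) := fun x hx y hy hxy =>
    weight_le_weight_of_le hp h0 h1 (le_min hx.1 ht0) (min_le_min_right _ hxy)
      ((min_le_right _ _).trans ht1) |>.trans' (le_refl _)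
  have hBm : AntitoneOn B (Icc 0 1) := fun x hx y hy hxy => by
    simp only [hB]
    split_ifs <;> linarith
  have hAi : IntegrableOn A (Ioo 0 1) := integrableOn_of_bdd (M := 2)
    (hmw.comp (by fun_prop)) fun u hu => abs_weight_le hp h0 h1
      ⟨le_min hu.1.le ht0, (min_le_left _ _).trans hu.2.le⟩
  have hBi : IntegrableOn B (Ioo 0 1) := integrableOn_of_bdd (M := weight p θ τ)
    (Measurable.ite measurableSet_Iio measurable_const measurable_const) fun u hu => by
      simp only [hB]; split_ifs
      · rw [abs_of_nonneg hw0]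
      · simpa using hw0
  have hAd : IntegrableOn (fun u => A u + -weight p θ τ) (Ioo 0 1) := hAi.add (by simp)
  have e : blockEnergy b (fun u => if u < τ then weight p θ u else 0) (m + 1) =
      blockEnergy b (fun u => (A u + -weight p θ τ) + B u) (m + 1) := by
    refine blockEnergy_congr (fun u hu => ?_) _
    simp only [hA, hB]
    split_ifs with h
    · rw [min_eq_left h.le]; ring
    · rw [min_eq_right (not_lt.1 h)]; ring
  have hAm' : MonotoneOn (fun u => A u + -weight p θ τ) (Icc 0 1) := fun x hx y hy hxy =>
    add_le_add_left (hAm hx hy hxy) _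
  have e1 := blockEnergy_succ_le_of_monotoneOn hb m hAm'
  have e2 := blockEnergy_succ_le_of_antitoneOn hb m hBm
  have e3 := blockEnergy_add_le (b := b) hAd hBi (m + 1)
  have hA1 : (A 1 + -weight p θ τ - (A 0 + -weight p θ τ)) ^ 2 ≤ weight p θ τ ^ 2 := by
    simp only [hA]
    rw [min_eq_right (by linarith : τ ≤ 1), min_eq_left ht0, weight_zero h0]
    apply le_of_eq; ring
  have hB1 : (B 1 - B 0) ^ 2 ≤ weight p θ τ ^ 2 := by
    simp only [hB]
    split_ifs <;> nlinarith
  have hbm : (0 : ℝ) ≤ ((b : ℝ) ^ m)⁻¹ := by positivity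
  have := mul_le_mul_of_nonneg_left hA1 hbm
  have := mul_le_mul_of_nonneg_left hB1 hbm
  rw [e]
  linarith

/-- Mirror image of `blockEnergy_weight_lt_le`, using that the weight also vanishes at 1. -/
theorem blockEnergy_weight_ge_le {b : ℕ} (hb : 2 ≤ b) (hp : 1 ≤ p) (h0 : 0 < θ) (h1 : θ ≤ 1 / 2)
    (m : ℕ) {τ : ℝ} (ht0 : 1 / 2 ≤ τ) (ht1 : τ ≤ 1) :
    blockEnergy b (fun u => if u < τ then 0 else weight p θ u) (m + 1) ≤
      4 * ((b : ℝ) ^ m)⁻¹ * weight p θ τ ^ 2 := by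
  have hmw := measurable_weight p θ
  have hw0 : 0 ≤ weight p θ τ := weight_nonneg hp h0 h1 ⟨by linarith, ht1⟩
  set A : ℝ → ℝ := fun u => weight p θ (max u τ) with hA
  set B : ℝ → ℝ := fun u => if u < τ then 0 else weight p θ τ with hB
  have hAm : AntitoneOn A (Icc 0 1) := fun x hx y hy hxy =>
    weight_le_weight_of_ge hp h0 h1 (max_le hy.2 ht1) (max_le_max_right _ hxy)
      (ht0.trans (le_max_right _ _))
  have hBm : MonotoneOn B (Icc 0 1) := fun x hx y hy hxy => by
    simp only [hB]
    split_ifs <;> linarith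
  have hAi : IntegrableOn A (Ioo 0 1) := integrableOn_of_bdd (M := 2)
    (hmw.comp (by fun_prop)) fun u hu => abs_weight_le hp h0 h1
      ⟨hu.1.le.trans (le_max_left _ _), max_le hu.2.le ht1⟩
  have hBi : IntegrableOn B (Ioo 0 1) := integrableOn_of_bdd (M := weight p θ τ)
    (Measurable.ite measurableSet_Iio measurable_const measurable_const) fun u hu => by
      simp only [hB]; split_ifs
      · simpa using hw0
      · rw [abs_of_nonneg hw0]
  have hAd : IntegrableOn (fun u => A u + -weight p θ τ) (Ioo 0 1) := hAi.add (by simp)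
  have e : blockEnergy b (fun u => if u < τ then 0 else weight p θ u) (m + 1) =
      blockEnergy b (fun u => (A u + -weight p θ τ) + B u) (m + 1) := by
    refine blockEnergy_congr (fun u hu => ?_) _
    simp only [hA, hB]
    split_ifs with h
    · rw [max_eq_right h.le]; ring
    · rw [max_eq_left (not_lt.1 h)]; ring
  have hAm' : AntitoneOn (fun u => A u + -weight p θ τ) (Icc 0 1) := fun x hx y hy hxy =>
    add_le_add_left (hAm hx hy hxy) _
  have e1 := blockEnergy_succ_le_of_antitoneOn hb m hAm'
  have e2 := blockEnergy_succ_le_of_monotoneOn hb m hBm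
  have e3 := blockEnergy_add_le (b := b) hAd hBi (m + 1)
  have hA1 : (A 1 + -weight p θ τ - (A 0 + -weight p θ τ)) ^ 2 ≤ weight p θ τ ^ 2 := by
    have hw1 : weight p θ 1 = 0 := by
      rw [← weight_one_sub, sub_self, weight_zero h0]
    simp only [hA]
    rw [max_eq_left ht1, max_eq_right (by linarith : (0 : ℝ) ≤ τ), hw1]
    apply le_of_eq; ring
  have hB1 : (B 1 - B 0) ^ 2 ≤ weight p θ τ ^ 2 := by
    simp only [hB]
    split_ifs <;> nlinarith
  have hbm : (0 : ℝ) ≤ ((b : ℝ) ^ m)⁻¹ := by positivity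
  have := mul_le_mul_of_nonneg_left hA1 hbm
  have := mul_le_mul_of_nonneg_left hB1 hbm
  rw [e]
  linarith

theorem integrableOn_weight (hp : 1 ≤ p) (h0 : 0 < θ) (h1 : θ ≤ 1 / 2) :
    IntegrableOn (weight p θ) (Ioo 0 1) :=
  integrableOn_of_bdd (measurable_weight p θ) fun _ hu =>
    abs_weight_le hp h0 h1 (Ioo_subset_Icc_self hu)

theorem blockEnergy_weight_le {b : ℕ} (hb : 2 ≤ b) (hp : 1 ≤ p) (h0 : 0 < θ) (h1 : θ ≤ 1 / 2)
    (m : ℕ) : blockEnergy b (weight p θ) (m + 1) ≤ 64 * ((b : ℝ) ^ m)⁻¹ := by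
  have hmw := measurable_weight p θ
  have hi : ∀ s : Set ℝ, MeasurableSet s → IntegrableOn (s.indicator (weight p θ)) (Ioo 0 1) :=
    fun s hs => (integrableOn_weight hp h0 h1).indicator hs
  have e : blockEnergy b (weight p θ) (m + 1) =
      blockEnergy b (fun u => (if u < 1 / 2 then weight p θ u else 0) +
        (if u < 1 / 2 then 0 else weight p θ u)) (m + 1) := by
    refine blockEnergy_congr (fun u hu => ?_) _
    split_ifs <;> simp
  have i1 : IntegrableOn (fun u => if u < 1 / 2 then weight p θ u else 0) (Ioo 0 1) := by
    refine (hi (Iio (1 / 2)) measurableSet_Iio).congr_fun (fun u _ => ?_) measurableSet_Ioo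
    simp only [indicator, mem_Iio]
  have i2 : IntegrableOn (fun u => if u < 1 / 2 then 0 else weight p θ u) (Ioo 0 1) := by
    refine (hi (Ici (1 / 2)) measurableSet_Ici).congr_fun (fun u _ => ?_) measurableSet_Ioo
    by_cases h : u < 1 / 2
    · simp only [indicator, mem_Ici, if_pos h, if_neg (not_le.2 h)]
    · simp only [indicator, mem_Ici, if_neg h, if_pos (not_lt.1 h)]
  have hw : weight p θ (1 / 2) ^ 2 ≤ 4 := by
    have a := weight_nonneg hp h0 h1 (u := 1 / 2) ⟨by norm_num, by norm_num⟩
    have b := weight_le_two hp h0 h1 (u := 1 / 2) ⟨by norm_num, by norm_num⟩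
    nlinarith
  have e1 := blockEnergy_weight_lt_le hb hp h0 h1 m (τ := 1 / 2) (by norm_num) le_rfl
  have e2 := blockEnergy_weight_ge_le hb hp h0 h1 m (τ := 1 / 2) le_rfl (by norm_num)
  have e3 := blockEnergy_add_le (b := b) i1 i2 (m + 1)
  have hbm : (0 : ℝ) ≤ ((b : ℝ) ^ m)⁻¹ := by positivity
  have := mul_le_mul_of_nonneg_left hw hbm
  rw [e]
  linarith

theorem inv_pow_rpow_le {b : ℕ} (hb : 2 ≤ b) {α : ℝ} (m : ℕ) :
    (((b : ℝ) ^ m)⁻¹) ^ α = (b : ℝ) ^ α * (b : ℝ) ^ (-α * ((m + 1 : ℕ) : ℝ)) := by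
  have hb0 : (0 : ℝ) < b := by positivity
  rw [← Real.rpow_natCast, ← Real.rpow_neg hb0.le, ← Real.rpow_mul hb0.le, ← Real.rpow_add hb0]
  congr 1; push_cast; ring

/-- A constant has no energy in blocks with ℓ ≠ 0, so the weight may be replaced by w − 1, whose
squared L² norm is at most 4θ. Interpolation with the bound 64 b^{-m} gives the claim. -/
theorem exists_blockEnergy_weight_le {b : ℕ} (hb : 2 ≤ b) (hp : 1 ≤ p) {α : ℝ} (hα0 : 0 < α)
    (hα1 : α < 1) :
    ∃ C : ℝ, 0 < C ∧ ∀ θ : ℝ, 0 < θ → θ ≤ 1 / 2 → ∀ ℓ : ℕ, ℓ ≠ 0 →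
      blockEnergy b (weight p θ) ℓ ≤ C * (b : ℝ) ^ (-α * (ℓ : ℝ)) * θ ^ (1 - α) := by
  have hb0 : (0 : ℝ) < b := by positivity
  -- The factor b^α pays for the shift between m and ℓ = m + 1; 8 is 2 · 4, with the 2 from
  -- `blockEnergy_add_le`.
  refine ⟨64 ^ α * (b : ℝ) ^ α * 8 ^ (1 - α), by positivity, fun θ h0 h1 ℓ hℓ => ?_⟩
  obtain ⟨m, rfl⟩ := Nat.exists_eq_succ_of_ne_zero hℓ
  have e1 := blockEnergy_weight_le hb hp h0 h1 m
  have hm1 : Measurable fun u => weight p θ u + (-1) := (measurable_weight p θ).add_const _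
  have hbd : ∀ u ∈ Ioo (0 : ℝ) 1, |weight p θ u + (-1)| ≤ 1 := fun u hu => by
    have a := weight_nonneg hp h0 h1 (Ioo_subset_Icc_self hu)
    have b := weight_le_two hp h0 h1 (Ioo_subset_Icc_self hu)
    rw [abs_le]; constructor <;> linarith
  have i1 : IntegrableOn (fun u => weight p θ u + (-1)) (Ioo 0 1) := integrableOn_of_bdd hm1 hbd
  have i2 : IntegrableOn (fun u => (weight p θ u + (-1)) ^ 2) (Ioo 0 1) :=
    integrableOn_of_bdd (M := 1) (hm1.pow_const 2) fun u hu => by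
      rw [abs_pow]; exact pow_le_one₀ (abs_nonneg _) (hbd u hu)
  have e2 : blockEnergy b (weight p θ) (m + 1) ≤ 8 * θ := by
    have c : blockEnergy b (fun _ => (1 : ℝ)) (m + 1) ≤ 0 := by
      have := blockEnergy_succ_le_of_monotoneOn hb (g := fun _ => (1 : ℝ)) m
        (fun _ _ _ _ _ => le_rfl)
      simpa using this
    have a := blockEnergy_add_le (b := b) i1 (g := fun _ => (1 : ℝ)) (by simp) (m + 1)
    simp only [neg_add_cancel_right] at a
    have d := blockEnergy_le_integral_sq hb (m + 1) i1 i2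
    have f := integral_weight_sub_one_sq_le hp h0 h1
    simp only [← sub_eq_add_neg] at d
    simp only [← sub_eq_add_neg] at a
    linarith
  refine (interpolate_le hα0.le hα1.le (blockEnergy_nonneg _ _ _) e1 e2).trans (le_of_eq ?_)
  rw [Real.mul_rpow (by norm_num) (by positivity), Real.mul_rpow (by norm_num) h0.le,
    inv_pow_rpow_le hb]
  ring

/-- The weighted representation kernel `w_θ(u) (t - 1[W(u) < t])`, where `W` is extended from
`[0, 1]` to a continuous function on `ℝ`. -/
def weightKernel (p θ t u : ℝ) : ℝ :=
  weight p θ u * (t - if weightCdf p θ (max 0 (min u 1)) < t then 1 else 0)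

/-- Only the behaviour of W on [0, 1] is controlled; clamping the argument is what makes the kernel
jointly measurable on the plane. -/
theorem continuous_weightCdf_clamp (hp : 1 ≤ p) (h0 : 0 < θ) (h1 : θ ≤ 1 / 2) :
    Continuous fun u => weightCdf p θ (max 0 (min u 1)) :=
  (continuousOn_weightCdf hp h0 h1).comp_continuous (by fun_prop)
    fun u => ⟨le_max_left _ _, max_le zero_le_one (min_le_right _ _)⟩

theorem clamp_eq {u : ℝ} (hu : u ∈ Ioo (0 : ℝ) 1) : max 0 (min u 1) = u := by
  rw [min_eq_left hu.2.le, max_eq_right hu.1.le]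

theorem measurable_weightKernel (hp : 1 ≤ p) (h0 : 0 < θ) (h1 : θ ≤ 1 / 2) :
    Measurable fun q : ℝ × ℝ => weightKernel p θ q.1 q.2 := by
  have hW := (continuous_weightCdf_clamp hp h0 h1).measurable
  have hw := measurable_weight p θ
  unfold weightKernel
  refine (hw.comp measurable_snd).mul (measurable_fst.sub ?_)
  exact Measurable.ite (measurableSet_lt (hW.comp measurable_snd) measurable_fst)
    measurable_const measurable_const

theorem abs_weightKernel_le (hp : 1 ≤ p) (h0 : 0 < θ) (h1 : θ ≤ 1 / 2) {t u : ℝ}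
    (ht : t ∈ Ioo (0 : ℝ) 1) (hu : u ∈ Ioo (0 : ℝ) 1) : |weightKernel p θ t u| ≤ 2 := by
  have a := abs_weight_le hp h0 h1 (Ioo_subset_Icc_self hu)
  rw [weightKernel, abs_mul]
  have : |t - if weightCdf p θ (max 0 (min u 1)) < t then (1 : ℝ) else 0| ≤ 1 := by
    rw [abs_le]; split_ifs <;> constructor <;> linarith [ht.1, ht.2]
  calc _ ≤ 2 * (1 : ℝ) := mul_le_mul a this (abs_nonneg _) two_pos.le
    _ = 2 := mul_one _

theorem integrableOn_weightKernel (hp : 1 ≤ p) (h0 : 0 < θ) (h1 : θ ≤ 1 / 2) {t : ℝ}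
    (ht : t ∈ Ioo (0 : ℝ) 1) : IntegrableOn (weightKernel p θ t) (Ioo 0 1) :=
  integrableOn_of_bdd ((measurable_weightKernel hp h0 h1).comp measurable_prodMk_left)
    fun _ hu => abs_weightKernel_le hp h0 h1 ht hu

theorem integrableOn_weightKernel_sq (hp : 1 ≤ p) (h0 : 0 < θ) (h1 : θ ≤ 1 / 2) {t : ℝ}
    (ht : t ∈ Ioo (0 : ℝ) 1) : IntegrableOn (fun u => weightKernel p θ t u ^ 2) (Ioo 0 1) :=
  integrableOn_of_bdd (M := 2 ^ 2)
    (((measurable_weightKernel hp h0 h1).comp measurable_prodMk_left).pow_const 2)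
    fun _ hu => by
      rw [abs_pow]; exact pow_le_pow_left₀ (abs_nonneg _) (abs_weightKernel_le hp h0 h1 ht hu) 2

theorem weightKernel_eq (hp : 1 ≤ p) (h0 : 0 < θ) (h1 : θ ≤ 1 / 2) {τ u : ℝ}
    (hτ : τ ∈ Ioo (0 : ℝ) 1) (hu : u ∈ Ioo (0 : ℝ) 1) :
    weightKernel p θ (weightCdf p θ τ) u =
      weight p θ u * (weightCdf p θ τ - if u < τ then 1 else 0) := by
  have := (strictMonoOn_weightCdf hp h0 h1).lt_iff_lt (Ioo_subset_Icc_self hu)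
    (Ioo_subset_Icc_self hτ)
  simp only [weightKernel, clamp_eq hu, this]

theorem setIntegral_weight_lt {τ : ℝ} (hτ : τ ∈ Ioo (0 : ℝ) 1) :
    ∫ u in Ioo (0 : ℝ) 1, (if u < τ then weight p θ u else 0) = weightCdf p θ τ := by
  have : (fun u => if u < τ then weight p θ u else 0) = (Iio τ).indicator (weight p θ) := by
    ext u; simp only [indicator, mem_Iio]
  rw [this, setIntegral_indicator measurableSet_Iio, weightCdf,
    intervalIntegral.integral_of_le hτ.1.le, integral_Ioc_eq_integral_Ioo]
  congr 2
  ext u; simp only [mem_inter_iff, mem_Ioo, mem_Iio]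
  exact ⟨fun h => ⟨h.1.1, h.2⟩, fun h => ⟨⟨h.1, h.2.trans hτ.2⟩, h.2⟩⟩

theorem setIntegral_weight (hp : 1 ≤ p) (h0 : 0 < θ) (h1 : θ ≤ 1 / 2) :
    ∫ u in Ioo (0 : ℝ) 1, weight p θ u = 1 := by
  have := weightCdf_one hp h0 h1
  rwa [weightCdf, intervalIntegral.integral_of_le zero_le_one, integral_Ioc_eq_integral_Ioo] at this

theorem integrableOn_ite_weight (hp : 1 ≤ p) (h0 : 0 < θ) (h1 : θ ≤ 1 / 2) (τ : ℝ) :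
    IntegrableOn (fun u => if u < τ then weight p θ u else 0) (Ioo 0 1) := by
  have : (fun u => if u < τ then weight p θ u else 0) = (Iio τ).indicator (weight p θ) := by
    ext u; simp only [indicator, mem_Iio]
  rw [this]
  exact (integrableOn_weight hp h0 h1).indicator measurableSet_Iio

theorem integrableOn_ite_weight' (hp : 1 ≤ p) (h0 : 0 < θ) (h1 : θ ≤ 1 / 2) (τ : ℝ) :
    IntegrableOn (fun u => if u < τ then 0 else weight p θ u) (Ioo 0 1) := by
  refine ((integrableOn_weight hp h0 h1).sub (integrableOn_ite_weight hp h0 h1 τ)).congr_fun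
    (fun u _ => ?_) measurableSet_Ioo
  simp only [Pi.sub_apply]
  split_ifs <;> simp

theorem setIntegral_weight_ge (hp : 1 ≤ p) (h0 : 0 < θ) (h1 : θ ≤ 1 / 2) {τ : ℝ}
    (hτ : τ ∈ Ioo (0 : ℝ) 1) :
    ∫ u in Ioo (0 : ℝ) 1, (if u < τ then 0 else weight p θ u) = 1 - weightCdf p θ τ := by
  have := integral_sub (integrableOn_weight hp h0 h1) (integrableOn_ite_weight hp h0 h1 τ)
  rw [setIntegral_weight_lt hτ, setIntegral_weight hp h0 h1] at this
  rw [← this]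
  congr 1; ext u; split_ifs <;> simp

/-- For t = W(τ), the weight has total mass 1 and mass t below τ. This cancellation later removes
every v that is not contained in s(ℓ). -/
theorem integral_weightKernel (hp : 1 ≤ p) (h0 : 0 < θ) (h1 : θ ≤ 1 / 2) {t : ℝ}
    (ht : t ∈ Ioo (0 : ℝ) 1) : ∫ u in Ioo (0 : ℝ) 1, weightKernel p θ t u = 0 := by
  obtain ⟨τ, hτ, rfl⟩ := exists_weightCdf_eq hp h0 h1 ht
  have : ∫ u in Ioo (0 : ℝ) 1, weightKernel p θ (weightCdf p θ τ) u = ∫ u in Ioo (0 : ℝ) 1,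
      (weightCdf p θ τ * weight p θ u - if u < τ then weight p θ u else 0) := by
    refine setIntegral_congr_fun measurableSet_Ioo fun u hu => ?_
    rw [weightKernel_eq hp h0 h1 hτ hu]
    split_ifs <;> ring
  rw [this, integral_sub ((integrableOn_weight hp h0 h1).const_mul _)
    (integrableOn_ite_weight hp h0 h1 τ), integral_const_mul, setIntegral_weight hp h0 h1,
    setIntegral_weight_lt hτ, mul_one, sub_self]

/-- Expand (c w − J)² ≤ 2c²w² + 2J², then use w² ≤ 2w, J² ≤ a J and ∫ w = 1. In the applications J
is the weight restricted to the outer side of τ. -/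
theorem integral_weightKernel_sq_le (hp : 1 ≤ p) (h0 : 0 < θ) (h1 : θ ≤ 1 / 2) {t c a : ℝ}
    (ht : t ∈ Ioo (0 : ℝ) 1) {J : ℝ → ℝ} (hJ : IntegrableOn J (Ioo 0 1))
    (hJ0 : ∀ u ∈ Ioo (0 : ℝ) 1, 0 ≤ J u) (hJa : ∀ u ∈ Ioo (0 : ℝ) 1, J u ≤ a)
    (hG : ∀ u ∈ Ioo (0 : ℝ) 1, |weightKernel p θ t u| = |c * weight p θ u - J u|) :
    ∫ u in Ioo (0 : ℝ) 1, weightKernel p θ t u ^ 2 ≤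
      4 * c ^ 2 + 2 * a * ∫ u in Ioo (0 : ℝ) 1, J u := by
  have hI := integrableOn_weight hp h0 h1
  calc ∫ u in Ioo (0 : ℝ) 1, weightKernel p θ t u ^ 2
      ≤ ∫ u in Ioo (0 : ℝ) 1, (4 * c ^ 2 * weight p θ u + 2 * a * J u) := by
        refine setIntegral_mono_on (integrableOn_weightKernel_sq hp h0 h1 ht)
          ((hI.const_mul _).add (hJ.const_mul _)) measurableSet_Ioo fun u hu => ?_
        rw [← sq_abs, hG u hu, sq_abs]
        have w0 := weight_nonneg hp h0 h1 (Ioo_subset_Icc_self hu)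
        have w2 := weight_le_two hp h0 h1 (Ioo_subset_Icc_self hu)
        have j0 := hJ0 u hu
        have j1 := hJa u hu
        have e1 : J u ^ 2 ≤ a * J u := by nlinarith
        have e2 : c ^ 2 * weight p θ u ^ 2 ≤ 2 * c ^ 2 * weight p θ u := by
          nlinarith [mul_nonneg (mul_nonneg (sq_nonneg c) w0) (sub_nonneg.2 w2)]
        nlinarith [sq_nonneg (c * weight p θ u + J u)]
    _ = _ := by
        rw [integral_add (hI.const_mul _) (hJ.const_mul _), integral_const_mul, integral_const_mul,
          setIntegral_weight hp h0 h1, mul_one]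

theorem blockEnergy_weightKernel_aux {b : ℕ} (hb : 2 ≤ b) (hp : 1 ≤ p) (h0 : 0 < θ)
    (h1 : θ ≤ 1 / 2) {c e E : ℝ} {J : ℝ → ℝ} (hJ : IntegrableOn J (Ioo 0 1)) {m : ℕ}
    (hE : blockEnergy b J (m + 1) ≤ 4 * ((b : ℝ) ^ m)⁻¹ * E ^ 2) (he : e ^ 2 = 1) :
    blockEnergy b (fun u => c * weight p θ u + e * J u) (m + 1) ≤
      ((b : ℝ) ^ m)⁻¹ * (128 * c ^ 2 + 8 * E ^ 2) := by
  have h := blockEnergy_add_le (b := b) ((integrableOn_weight hp h0 h1).const_mul c)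
    (hJ.const_mul e) (m + 1)
  rw [blockEnergy_const_mul, blockEnergy_const_mul, he, one_mul] at h
  have := mul_le_mul_of_nonneg_left (blockEnergy_weight_le hb hp h0 h1 m) (sq_nonneg c)
  linarith

/-- Energy and `L²` bounds for the kernel in terms of `m = min t (1 - t)` and the size of the
weight at the corresponding point. -/
theorem weightKernel_bounds {b : ℕ} (hb : 2 ≤ b) (hp : 1 ≤ p) (h0 : 0 < θ) (h1 : θ ≤ 1 / 2) {t : ℝ}
    (ht : t ∈ Ioo (0 : ℝ) 1) :
    ∃ τ, 0 < τ ∧ τ ≤ 1 / 2 ∧ weightCdf p θ τ = min t (1 - t) ∧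
      (∀ m, blockEnergy b (weightKernel p θ t) (m + 1) ≤
        128 * ((b : ℝ) ^ m)⁻¹ * (min t (1 - t) + weight p θ τ) ^ 2) ∧
      ∫ u in Ioo (0 : ℝ) 1, weightKernel p θ t u ^ 2 ≤
        4 * (min t (1 - t) * (min t (1 - t) + weight p θ τ)) := by
  obtain ⟨τ, hτ, rfl⟩ := exists_weightCdf_eq hp h0 h1 ht
  have hW := strictMonoOn_weightCdf hp h0 h1
  have hτI := Ioo_subset_Icc_self hτ
  have hhalf : (1 / 2 : ℝ) ∈ Icc (0 : ℝ) 1 := ⟨by norm_num, by norm_num⟩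
  have hw0 := weight_nonneg hp h0 h1 hτI
  have hfin : ∀ m : ℕ, ∀ c w : ℝ, 0 ≤ c → 0 ≤ w → ((b : ℝ) ^ m)⁻¹ * (128 * c ^ 2 + 8 * w ^ 2) ≤
      128 * ((b : ℝ) ^ m)⁻¹ * (c + w) ^ 2 := by
    intro m c w hc hw
    have hbm : (0 : ℝ) ≤ ((b : ℝ) ^ m)⁻¹ := by positivity
    rw [mul_assoc, mul_left_comm]
    refine mul_le_mul_of_nonneg_left ?_ hbm
    nlinarith [mul_nonneg hc hw]
  -- On either side the kernel is written, up to sign, as (small mass) · w minus the weight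
  -- truncated to the outer side of τ. For τ ≤ 1/2 this is W(τ) w − w 1[u < τ].
  rcases le_total τ (1 / 2) with hc | hc
  · have hle : weightCdf p θ τ ≤ 1 / 2 := by
      rw [← weightCdf_half hp h0 h1]; exact hW.monotoneOn hτI hhalf hc
    have hmin : min (weightCdf p θ τ) (1 - weightCdf p θ τ) = weightCdf p θ τ :=
      min_eq_left (by linarith)
    have hJ := integrableOn_ite_weight hp h0 h1 τ
    refine ⟨τ, hτ.1, hc, hmin.symm, fun m => ?_, ?_⟩
    · rw [hmin]
      have e := blockEnergy_congr (b := b) (f := weightKernel p θ (weightCdf p θ τ))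
        (g := fun u => weightCdf p θ τ * weight p θ u +
          (-1) * (if u < τ then weight p θ u else 0)) (fun u hu => by
          rw [weightKernel_eq hp h0 h1 hτ hu]; split_ifs <;> ring) (m + 1)
      rw [e]
      refine (blockEnergy_weightKernel_aux hb hp h0 h1 hJ
        (blockEnergy_weight_lt_le hb hp h0 h1 m hτ.1.le hc) (by norm_num)).trans
        (hfin m _ _ ht.1.le hw0)
    · rw [hmin]
      have := integral_weightKernel_sq_le hp h0 h1 ht (c := weightCdf p θ τ) (a := weight p θ τ) hJ
        (fun u hu => by
          split_ifs
          · exact weight_nonneg hp h0 h1 (Ioo_subset_Icc_self hu)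
          · exact le_rfl) (fun u hu => by
          split_ifs with h
          · exact weight_le_weight_of_le hp h0 h1 hu.1.le h.le hc
          · exact hw0) (fun u hu => by
          rw [weightKernel_eq hp h0 h1 hτ hu]
          congr 1; split_ifs <;> ring)
      rw [setIntegral_weight_lt hτ] at this
      nlinarith [mul_nonneg hw0 ht.1.le]
  · have hle : 1 / 2 ≤ weightCdf p θ τ := by
      rw [← weightCdf_half hp h0 h1]; exact hW.monotoneOn hhalf hτI hc
    have hmin : min (weightCdf p θ τ) (1 - weightCdf p θ τ) = 1 - weightCdf p θ τ :=
      min_eq_right (by linarith)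
    have hJ := integrableOn_ite_weight' hp h0 h1 τ
    have hc0 : 0 ≤ 1 - weightCdf p θ τ := by linarith [ht.2]
    -- For τ ≥ 1/2 the reflected point is the witness, and the kernel is −(1 − W(τ)) w + w 1[u ≥ τ],
    -- so that again both coefficient and truncated piece are measured from the nearer endpoint.
    refine ⟨1 - τ, by linarith [hτ.2], by linarith, ?_, fun m => ?_, ?_⟩
    · rw [weightCdf_one_sub hp h0 h1 hτI, hmin]
    · rw [hmin, weight_one_sub]
      have e := blockEnergy_congr (b := b) (f := weightKernel p θ (weightCdf p θ τ))
        (g := fun u => (-(1 - weightCdf p θ τ)) * weight p θ u +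
          1 * (if u < τ then 0 else weight p θ u)) (fun u hu => by
          rw [weightKernel_eq hp h0 h1 hτ hu]; split_ifs <;> ring) (m + 1)
      rw [e]
      refine (blockEnergy_weightKernel_aux hb hp h0 h1 hJ
        (blockEnergy_weight_ge_le hb hp h0 h1 m hc hτ.2.le) (by norm_num)).trans ?_
      rw [neg_sq]
      exact hfin m _ _ hc0 hw0
    · rw [hmin, weight_one_sub]
      have := integral_weightKernel_sq_le hp h0 h1 ht (c := 1 - weightCdf p θ τ)
        (a := weight p θ τ) hJ
        (fun u hu => by
          split_ifs
          · exact le_rfl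
          · exact weight_nonneg hp h0 h1 (Ioo_subset_Icc_self hu)) (fun u hu => by
          split_ifs with h
          · exact hw0
          · exact weight_le_weight_of_ge hp h0 h1 hu.2.le (not_lt.1 h) hc) (fun u hu => by
          rw [weightKernel_eq hp h0 h1 hτ hu, ← abs_neg]
          congr 1; split_ifs <;> ring)
      rw [setIntegral_weight_ge hp h0 h1 hτ] at this
      nlinarith [mul_nonneg hw0 hc0]

/-- Adding W(τ) to `exists_weight_le_rpow` is free: W ≤ W^κ ≤ (W/θ)^κ, as W, θ and κ lie in (0, 1).
-/
theorem exists_add_weight_le (hp : 1 ≤ p) {κ : ℝ} (hκ0 : 0 < κ) (hκ1 : κ < 1) :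
    ∃ C : ℝ, 0 < C ∧ ∀ θ τ : ℝ, 0 < θ → θ ≤ 1 / 2 → 0 < τ → τ ≤ 1 / 2 →
      weightCdf p θ τ + weight p θ τ ≤ C * (weightCdf p θ τ / θ) ^ κ := by
  obtain ⟨C, hC, h⟩ := exists_weight_le_rpow hp hκ0 hκ1
  refine ⟨1 + C, by positivity, fun θ τ h0 h1 hτ hτ2 => ?_⟩
  have hm := weightCdf_mem_Ioo hp h0 h1 (u := τ) ⟨hτ, by linarith⟩
  have e1 : weightCdf p θ τ ≤ (weightCdf p θ τ / θ) ^ κ :=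
    calc weightCdf p θ τ = weightCdf p θ τ ^ (1 : ℝ) := (Real.rpow_one _).symm
      _ ≤ weightCdf p θ τ ^ κ := Real.rpow_le_rpow_of_exponent_ge hm.1 hm.2.le hκ1.le
      _ ≤ (weightCdf p θ τ / θ) ^ κ := by
        refine Real.rpow_le_rpow hm.1.le ?_ hκ0.le
        rw [le_div_iff₀ h0]
        nlinarith [hm.1]
  have := h θ τ h0 h1 hτ hτ2
  linarith

/-- With M = min(t, 1−t) and D = M + w(τ), interpolating b^{-m} D² against M D gives b^{-αm} M^{1-α}
D^{1+α}. Inserting D ≤ C (M/θ)^κ with κ = γ/(1+α) produces θ^{-γ} M^γ; the condition κ < 1 is γ < 1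
+ α. -/
theorem exists_blockEnergy_weightKernel_le {b : ℕ} (hb : 2 ≤ b) (hp : 1 ≤ p) {α γ : ℝ}
    (hα0 : 0 < α) (hα1 : α < 1) (hγ0 : 0 < γ) (hγ1 : γ < 1 + α) :
    ∃ C : ℝ, 0 < C ∧ ∀ θ : ℝ, 0 < θ → θ ≤ 1 / 2 → ∀ t ∈ Ioo (0 : ℝ) 1, ∀ ℓ : ℕ, ℓ ≠ 0 →
      blockEnergy b (weightKernel p θ t) ℓ ≤
        C * (b : ℝ) ^ (-α * (ℓ : ℝ)) * θ ^ (-γ) * min t (1 - t) ^ (γ + 1 - α) := by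
  have hb0 : (0 : ℝ) < b := by positivity
  have hκ0 : 0 < γ / (1 + α) := by positivity
  have hκ1 : γ / (1 + α) < 1 := by rw [div_lt_one (by linarith)]; exact hγ1
  obtain ⟨C, hC, h⟩ := exists_add_weight_le hp hκ0 hκ1
  refine ⟨128 ^ α * (b : ℝ) ^ α * 4 ^ (1 - α) * C ^ (1 + α), by positivity,
    fun θ h0 h1 t ht ℓ hℓ => ?_⟩
  obtain ⟨m, rfl⟩ := Nat.exists_eq_succ_of_ne_zero hℓ
  obtain ⟨τ, hτ0, hτ1, hW, hE, hL⟩ := weightKernel_bounds hb hp h0 h1 ht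
  have h' := h θ τ h0 h1 hτ0 hτ1
  have hm0 : 0 < min t (1 - t) := lt_min ht.1 (by linarith [ht.2])
  have hw0 := weight_nonneg hp h0 h1 (u := τ) ⟨hτ0.le, by linarith⟩
  rw [hW] at h'
  set M := min t (1 - t)
  set D := M + weight p θ τ
  have hD : 0 < D := by simp only [D]; linarith
  have e2 := (blockEnergy_le_integral_sq hb (m + 1) (integrableOn_weightKernel hp h0 h1 ht)
    (integrableOn_weightKernel_sq hp h0 h1 ht)).trans hL
  refine (interpolate_le hα0.le hα1.le (blockEnergy_nonneg _ _ _) (hE m) e2).trans ?_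
  have hD2 : (D ^ 2) ^ α = D ^ (2 * α) := by
    rw [← Real.rpow_natCast, ← Real.rpow_mul hD.le]; norm_num
  have hDD : D ^ (2 * α) * D ^ (1 - α) = D ^ (1 + α) := by
    rw [← Real.rpow_add hD]; congr 1; ring
  have hDle : D ^ (1 + α) ≤ C ^ (1 + α) * (M ^ γ * θ ^ (-γ)) := by
    calc D ^ (1 + α) ≤ (C * (M / θ) ^ (γ / (1 + α))) ^ (1 + α) :=
          Real.rpow_le_rpow hD.le h' (by linarith)
      _ = C ^ (1 + α) * (M ^ γ * θ ^ (-γ)) := by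
          rw [Real.mul_rpow hC.le (by positivity), ← Real.rpow_mul (by positivity),
            div_mul_cancel₀ _ (by linarith), Real.div_rpow hm0.le h0.le, Real.rpow_neg h0.le,
            div_eq_mul_inv]
  have hMM : M ^ γ * M ^ (1 - α) = M ^ (γ + 1 - α) := by
    rw [← Real.rpow_add hm0]; congr 1; ring
  rw [Real.mul_rpow (by positivity) (by positivity), Real.mul_rpow (by norm_num) (by positivity),
    Real.mul_rpow (by norm_num) (by positivity), Real.mul_rpow hm0.le hD.le, hD2,
    inv_pow_rpow_le hb]
  set B := (b : ℝ) ^ (-α * ((m + 1 : ℕ) : ℝ))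
  calc 128 ^ α * ((b : ℝ) ^ α * B) * D ^ (2 * α) * (4 ^ (1 - α) * (M ^ (1 - α) * D ^ (1 - α)))
      = 128 ^ α * (b : ℝ) ^ α * B * 4 ^ (1 - α) * M ^ (1 - α) * (D ^ (2 * α) * D ^ (1 - α)) := by
        ring
    _ ≤ 128 ^ α * (b : ℝ) ^ α * B * 4 ^ (1 - α) * M ^ (1 - α) *
          (C ^ (1 + α) * (M ^ γ * θ ^ (-γ))) := by
        rw [hDD]; gcongr
    _ = 128 ^ α * (b : ℝ) ^ α * 4 ^ (1 - α) * C ^ (1 + α) * B * θ ^ (-γ) *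
          (M ^ γ * M ^ (1 - α)) := by ring
    _ = _ := by rw [hMM]

/-- The L² half of the kernel estimate without interpolation, for the square integrability of f^w.
-/
theorem exists_integral_weightKernel_sq_le (hp : 1 ≤ p) {κ : ℝ} (hκ0 : 0 < κ) (hκ1 : κ < 1) :
    ∃ C : ℝ, 0 < C ∧ ∀ θ : ℝ, 0 < θ → θ ≤ 1 / 2 → ∀ t ∈ Ioo (0 : ℝ) 1,
      ∫ u in Ioo (0 : ℝ) 1, weightKernel p θ t u ^ 2 ≤
        C * θ ^ (-κ) * min t (1 - t) ^ (κ + 1) := by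
  obtain ⟨C, hC, h⟩ := exists_add_weight_le hp hκ0 hκ1
  refine ⟨4 * C, by positivity, fun θ h0 h1 t ht => ?_⟩
  -- The base is fixed to 2 arbitrarily: the conclusion kept here does not involve it.
  obtain ⟨τ, hτ0, hτ1, hW, -, hL⟩ := weightKernel_bounds le_rfl hp h0 h1 ht
  have h' := h θ τ h0 h1 hτ0 hτ1
  have hm0 : 0 < min t (1 - t) := lt_min ht.1 (by linarith [ht.2])
  rw [hW] at h'
  set M := min t (1 - t)
  refine hL.trans ?_
  calc 4 * (M * (M + weight p θ τ)) ≤ 4 * (M * (C * (M / θ) ^ κ)) := by gcongr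
    _ = 4 * C * θ ^ (-κ) * M ^ (κ + 1) := by
      rw [Real.div_rpow hm0.le h0.le, Real.rpow_neg h0.le, Real.rpow_add hm0, Real.rpow_one]
      field_simp

end OneDim


/-! ### Product densities; weighted versus local integrability -/

section ProductDensity

theorem pi_withDensity_ofReal {ι : Type*} [Fintype ι] {α : ι → Type*} [∀ i, MeasurableSpace (α i)]
    (μ : ∀ i, Measure (α i)) [∀ i, SigmaFinite (μ i)] {p : ∀ i, α i → ℝ}
    (hp : ∀ i, Integrable (p i) (μ i)) (h0 : ∀ i, 0 ≤ᵐ[μ i] p i) :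
    Measure.pi (fun i => (μ i).withDensity fun x => ENNReal.ofReal (p i x)) =
      (Measure.pi μ).withDensity fun x => ENNReal.ofReal (∏ i, p i (x i)) := by
  have hfin : ∀ i, IsFiniteMeasure ((μ i).withDensity fun x => ENNReal.ofReal (p i x)) := fun i =>
    isFiniteMeasure_withDensity_ofReal (hp i).2
  refine Measure.pi_eq fun A hA => ?_
  have hr : ∀ i, Integrable (p i) ((μ i).restrict (A i)) := fun i => (hp i).restrict
  have hnn : 0 ≤ᵐ[Measure.pi fun i => (μ i).restrict (A i)] fun x : ∀ i, α i => ∏ i, p i (x i) := by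
    have : ∀ᵐ x ∂Measure.pi fun i => (μ i).restrict (A i), ∀ i, 0 ≤ p i (x i) := by
      rw [ae_all_iff]
      exact fun i => (Measure.quasiMeasurePreserving_eval (fun i => (μ i).restrict (A i)) i).ae
        (ae_restrict_of_ae (h0 i))
    filter_upwards [this] with x hx
    exact Finset.prod_nonneg fun i _ => hx i
  rw [withDensity_apply _ (MeasurableSet.univ_pi hA), Measure.restrict_pi_pi,
    ← ofReal_integral_eq_lintegral_ofReal (Integrable.fintype_prod_dep hr) hnn,
    integral_fintype_prod_eq_prod, ENNReal.ofReal_prod_of_nonneg]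
  · refine Finset.prod_congr rfl fun i _ => ?_
    rw [withDensity_apply _ (hA i), ofReal_integral_eq_lintegral_ofReal (hr i)
      (ae_restrict_of_ae (h0 i))]
  · exact fun i _ => integral_nonneg_of_ae (ae_restrict_of_ae (h0 i))

variable {φ : ℝ → ℝ} {s : ℕ}

theorem wMeasurePi_eq_withDensity (hφ : IsAdmissibleDensity φ) (s : ℕ) :
    wMeasurePi φ (Fin s) = volume.withDensity fun x => ENNReal.ofReal (∏ j, φ (x j)) :=
  pi_withDensity_ofReal (fun _ => volume) (fun _ => hφ.integrable)
    fun _ => ae_of_all _ fun x => (hφ.pos x).le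

theorem isProbabilityMeasure_wMeasurePi (hφ : IsAdmissibleDensity φ) (ι : Type) [Fintype ι] :
    IsProbabilityMeasure (wMeasurePi φ ι) := by
  have := isProbabilityMeasure_wMeasure hφ
  rw [wMeasurePi]; infer_instance

theorem measurable_prod_density (hφ : IsAdmissibleDensity φ) (s : ℕ) :
    Measurable fun x : Fin s → ℝ => ∏ j, φ (x j) :=
  Finset.measurable_fun_prod _ fun j _ => hφ.measurable.comp (measurable_pi_apply j)

theorem wMeasurePi_absolutelyContinuous (hφ : IsAdmissibleDensity φ) (s : ℕ) :
    wMeasurePi φ (Fin s) ≪ volume := by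
  rw [wMeasurePi_eq_withDensity hφ]; exact withDensity_absolutelyContinuous _ _

theorem absolutelyContinuous_wMeasurePi (hφ : IsAdmissibleDensity φ) (s : ℕ) :
    volume ≪ wMeasurePi φ (Fin s) := by
  rw [wMeasurePi_eq_withDensity hφ]
  refine withDensity_absolutelyContinuous' (measurable_prod_density hφ s).ennreal_ofReal.aemeasurable
    (ae_of_all _ fun x => ?_)
  simpa using Finset.prod_pos fun j _ => hφ.pos (x j)

/-- The density is positive everywhere, so null sets coincide and statements pass freely between the
two measures. -/
theorem ae_wMeasurePi (hφ : IsAdmissibleDensity φ) (s : ℕ) :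
    ae (wMeasurePi φ (Fin s)) = ae volume :=
  le_antisymm (wMeasurePi_absolutelyContinuous hφ s).ae_le
    (absolutelyContinuous_wMeasurePi hφ s).ae_le

/-- On a compact set the product density is at least c^s for some c > 0, so dividing by it preserves
integrability there. -/
theorem locallyIntegrable_of_integrable_wMeasurePi (hφ : IsAdmissibleDensity φ)
    {g : (Fin s → ℝ) → ℝ} (hg : Integrable g (wMeasurePi φ (Fin s))) : LocallyIntegrable g := by
  have hD := measurable_prod_density hφ s
  have hgm : AEStronglyMeasurable g volume :=
    hg.aestronglyMeasurable.mono_ac (absolutelyContinuous_wMeasurePi hφ s)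
  rw [wMeasurePi_eq_withDensity hφ, integrable_withDensity_iff_integrable_smul'
    hD.ennreal_ofReal (ae_of_all _ fun _ => ENNReal.ofReal_lt_top)] at hg
  rw [locallyIntegrable_iff]
  intro K hK
  obtain ⟨R, hR⟩ := hK.isBounded.subset_closedBall 0
  obtain ⟨c, hc, hcl⟩ := exists_pos_le_of_abs_le hφ R
  refine ((hg.integrableOn (s := K)).norm.const_mul (c ^ s)⁻¹).mono' hgm.restrict ?_
  refine (ae_restrict_iff' hK.measurableSet).2 (ae_of_all _ fun x hx => ?_)
  have hx' := hR hx
  rw [mem_closedBall_zero_iff] at hx'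
  have hle : c ^ s ≤ ∏ j, φ (x j) := by
    have := Finset.prod_le_prod (s := Finset.univ) (f := fun _ : Fin s => c) (g := fun j => φ (x j))
      (fun _ _ => hc.le) (fun j _ => hcl _ ((norm_le_pi_norm x j).trans hx'))
    simpa using this
  have hpos : 0 < c ^ s := by positivity
  rw [ENNReal.toReal_ofReal (hpos.le.trans hle), norm_smul, Real.norm_of_nonneg (hpos.le.trans hle),
    inv_mul_eq_div, le_div_iff₀ hpos, mul_comm]
  exact mul_le_mul_of_nonneg_right hle (norm_nonneg _)

theorem integrable_of_memLp_wMeasurePi (hφ : IsAdmissibleDensity φ) {q : ℝ} (hq : 1 < q)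
    {g : (Fin s → ℝ) → ℝ} (hg : MemLp g (ENNReal.ofReal q) (wMeasurePi φ (Fin s))) :
    Integrable g (wMeasurePi φ (Fin s)) := by
  have := isProbabilityMeasure_wMeasurePi hφ (Fin s)
  exact hg.integrable (by simpa using hq.le)

theorem locallyIntegrable_of_memLp_wMeasurePi (hφ : IsAdmissibleDensity φ) {q : ℝ} (hq : 1 < q)
    {g : (Fin s → ℝ) → ℝ} (hg : MemLp g (ENNReal.ofReal q) (wMeasurePi φ (Fin s))) :
    LocallyIntegrable g :=
  locallyIntegrable_of_integrable_wMeasurePi hφ (integrable_of_memLp_wMeasurePi hφ hq hg)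

end ProductDensity

/-! ### Weak partial derivatives as the fundamental theorem on lines -/

section LineDerivative

variable {s : ℕ}

open scoped Convolution

/-- As a convolution with the reflected test function, the shifted pairing is smooth in the shift
although f is only locally integrable. -/
theorem integral_shift_eq_convolution (f ψ : (Fin s → ℝ) → ℝ) (v : Fin s → ℝ) :
    ∫ x, f (x + v) * ψ x = (f ⋆[ContinuousLinearMap.mul ℝ ℝ, volume] fun y => ψ (-y)) v := by
  rw [convolution_def]
  rw [← integral_add_right_eq_self (μ := volume) (fun t => (ContinuousLinearMap.mul ℝ ℝ) (f t) _) v]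
  simp

theorem HasCompactSupport.comp_neg' {ψ : (Fin s → ℝ) → ℝ} (hψ : HasCompactSupport ψ) :
    HasCompactSupport fun y => ψ (-y) :=
  hψ.comp_homeomorph (Homeomorph.neg _)

theorem continuous_integral_shift {f ψ : (Fin s → ℝ) → ℝ} (hf : LocallyIntegrable f)
    (hψ : Continuous ψ) (hc : HasCompactSupport ψ) :
    Continuous fun v : Fin s → ℝ => ∫ x, f (x + v) * ψ x := by
  simp only [integral_shift_eq_convolution]
  exact (HasCompactSupport.comp_neg' hc).continuous_convolution_right _ hf (hψ.comp continuous_neg)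

theorem hasDerivAt_integral_shift {f ψ : (Fin s → ℝ) → ℝ} (hf : LocallyIntegrable f)
    (hψ : ContDiff ℝ ((⊤ : ℕ∞) : WithTop ℕ∞) ψ) (hc : HasCompactSupport ψ) (e : Fin s → ℝ) (t : ℝ) :
    HasDerivAt (fun t : ℝ => ∫ x, f (x + t • e) * ψ x)
      (-∫ x, f (x + t • e) * fderiv ℝ ψ x e) t := by
  simp only [integral_shift_eq_convolution]
  set χ : (Fin s → ℝ) → ℝ := fun y => ψ (-y) with hχ
  have hχs : ContDiff ℝ 1 χ := (hψ.comp contDiff_neg).of_le (by exact_mod_cast le_top)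
  have hχc : HasCompactSupport χ := HasCompactSupport.comp_neg' hc
  have h := hχc.hasFDerivAt_convolution_right (ContinuousLinearMap.mul ℝ ℝ) hf hχs (t • e)
  have hl : HasDerivAt (fun t : ℝ => t • e) e t := by
    simpa using (hasDerivAt_id t).smul_const e
  refine (h.comp_hasDerivAt t hl).congr_deriv ?_
  rw [convolution_precompR_apply _ hf (hχc.fderiv ℝ) (hχs.continuous_fderiv one_ne_zero),
    convolution_def, convolution_def, ← integral_neg]
  congr 1
  ext x
  simp only [ContinuousLinearMap.mul_apply']
  have : fderiv ℝ χ (t • e - x) e = -fderiv ℝ ψ (-(t • e - x)) e := by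
    have hd : HasFDerivAt χ ((fderiv ℝ ψ (-(t • e - x))).comp
        (-ContinuousLinearMap.id ℝ (Fin s → ℝ))) (t • e - x) :=
      ((hψ.differentiable (by simp)) _).hasFDerivAt.comp (t • e - x) (hasFDerivAt_id _).neg
    rw [hd.fderiv]; simp
  rw [this]; ring

/-- The shear maps I × K into a compact set K', so g may be cut off to K', where it is integrable;
the shear itself preserves the product measure. -/
theorem integrable_shear {g : (Fin s → ℝ) → ℝ} (hg : LocallyIntegrable g) (e : Fin s → ℝ)
    {I : Set ℝ} (hI : IsCompact I) {K : Set (Fin s → ℝ)} (hK : IsCompact K) :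
    Integrable (fun q : ℝ × (Fin s → ℝ) => g (q.2 + q.1 • e))
      ((volume.restrict I).prod (volume.restrict K)) := by
  set K' : Set (Fin s → ℝ) := (fun q : ℝ × (Fin s → ℝ) => q.2 + q.1 • e) '' (I ×ˢ K) with hK'
  have hK'c : IsCompact K' := (hI.prod hK).image (by fun_prop)
  have : IsFiniteMeasure (volume.restrict I) := ⟨by simpa using hI.measure_lt_top⟩
  have h1 : Integrable (K'.indicator g) volume :=
    (integrable_indicator_iff hK'c.measurableSet).2 (hg.integrableOn_isCompact hK'c)
  have h2 : Integrable (fun q : ℝ × (Fin s → ℝ) => K'.indicator g q.2)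
      ((volume.restrict I).prod volume) := h1.comp_snd _
  have hmp : MeasurePreserving (fun q : ℝ × (Fin s → ℝ) => (q.1, q.2 + q.1 • e))
      ((volume.restrict I).prod volume) ((volume.restrict I).prod volume) := by
    refine (MeasurePreserving.id _).skew_product (g := fun t x => x + t • e) ?_
      (ae_of_all _ fun t => ?_)
    · exact Continuous.measurable (by fun_prop)
    · exact map_add_right_eq_self volume (t • e)
  have h3 := hmp.integrable_comp_of_integrable h2
  have h4 : Integrable (fun q : ℝ × (Fin s → ℝ) => K'.indicator g (q.2 + q.1 • e))
      ((volume.restrict I).prod (volume.restrict K)) :=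
    h3.mono_measure (Measure.prod_mono le_rfl Measure.restrict_le_self)
  refine h4.congr ?_
  rw [Measure.prod_restrict]
  refine (ae_restrict_iff' (hI.measurableSet.prod hK.measurableSet)).2 (ae_of_all _ fun q hq => ?_)
  exact indicator_of_mem (mem_image_of_mem _ hq) g

theorem integrable_shear_mul {g ψ : (Fin s → ℝ) → ℝ} (hg : LocallyIntegrable g) (e : Fin s → ℝ)
    {I : Set ℝ} (hI : IsCompact I) (hψ : Continuous ψ) (hc : HasCompactSupport ψ) :
    Integrable (fun q : ℝ × (Fin s → ℝ) => g (q.2 + q.1 • e) * ψ q.2)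
      ((volume.restrict I).prod volume) := by
  have h1 := integrable_shear hg e hI hc
  obtain ⟨C, hC⟩ := hψ.bounded_above_of_compact_support hc
  have h2 := h1.mul_bdd (c := C) (hψ.comp continuous_snd).aestronglyMeasurable
    (ae_of_all _ fun q => hC q.2)
  have h3 : (volume.restrict I).prod (volume.restrict (tsupport ψ)) =
      ((volume.restrict I).prod volume).restrict (univ ×ˢ tsupport ψ) := by
    rw [← Measure.prod_restrict, Measure.restrict_univ]
  rw [h3] at h2
  refine (integrableOn_iff_integrable_of_support_subset ?_).1 h2
  intro q hq
  refine ⟨mem_univ _, ?_⟩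
  by_contra hn
  exact hq (by simp [image_eq_zero_of_notMem_tsupport hn])

theorem integral_integral_shift {g ψ : (Fin s → ℝ) → ℝ} (hg : LocallyIntegrable g) (e : Fin s → ℝ)
    (h : ℝ) (hψ : Continuous ψ) (hc : HasCompactSupport ψ) :
    ∫ t in (0 : ℝ)..h, ∫ x, g (x + t • e) * ψ x = ∫ x, (∫ t in (0 : ℝ)..h, g (x + t • e)) * ψ x := by
  have key : Integrable (fun q : ℝ × (Fin s → ℝ) => g (q.2 + q.1 • e) * ψ q.2)
      ((volume.restrict (uIoc 0 h)).prod volume) :=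
    (integrable_shear_mul hg e isCompact_uIcc hψ hc).mono_measure
      (Measure.prod_mono (Measure.restrict_mono uIoc_subset_uIcc le_rfl) le_rfl)
  rw [intervalIntegral_integral_swap key]
  simp only [intervalIntegral.integral_mul_const]

theorem locallyIntegrable_lineIntegral {g : (Fin s → ℝ) → ℝ} (hg : LocallyIntegrable g)
    (e : Fin s → ℝ) (h : ℝ) :
    LocallyIntegrable fun x => ∫ t in (0 : ℝ)..h, g (x + t • e) := by
  rw [locallyIntegrable_iff]
  intro K hK
  have key : Integrable (fun q : ℝ × (Fin s → ℝ) => g (q.2 + q.1 • e))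
      ((volume.restrict (uIoc 0 h)).prod (volume.restrict K)) :=
    (integrable_shear hg e isCompact_uIcc hK).mono_measure
      (Measure.prod_mono (Measure.restrict_mono uIoc_subset_uIcc le_rfl) le_rfl)
  have := key.integral_prod_right
  simp only [intervalIntegral.intervalIntegral_eq_integral_uIoc]
  exact this.smul (if 0 ≤ h then 1 else -1 : ℝ)

/-- `g` is the weak derivative of `f` along the `j`-th coordinate, in the form of the fundamental
theorem of calculus for almost every line. -/
def HasLineDeriv (j : Fin s) (f g : (Fin s → ℝ) → ℝ) : Prop :=
  ∀ h : ℝ, ∀ᵐ x, f (x + h • Pi.single j 1) - f x = ∫ t in (0 : ℝ)..h, g (x + t • Pi.single j 1)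

/-- Testing the weak equation with translates of ψ shows that t ↦ ∫ f(x + te) ψ has derivative ∫ g(x
+ te) ψ. Integrating over t, swapping integrals and letting ψ vary identifies the two sides almost
everywhere. -/
theorem hasLineDeriv_of_weak {j : Fin s} {f g : (Fin s → ℝ) → ℝ} (hf : LocallyIntegrable f)
    (hg : LocallyIntegrable g)
    (hw : ∀ ψ : (Fin s → ℝ) → ℝ, ContDiff ℝ ((⊤ : ℕ∞) : WithTop ℕ∞) ψ → HasCompactSupport ψ →
      ∫ x, f x * fderiv ℝ ψ x (Pi.single j 1) = -∫ x, g x * ψ x) :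
    HasLineDeriv j f g := by
  intro h
  set e : Fin s → ℝ := Pi.single j 1 with he
  have hshift : LocallyIntegrable fun x => f (x + h • e) := by
    rw [locallyIntegrable_iff]
    intro K hK
    have hmp := measurePreserving_add_right (volume : Measure (Fin s → ℝ)) (h • e)
    have hK' : IsCompact ((fun x => x + h • e) '' K) := hK.image (by fun_prop)
    have := (hmp.integrableOn_comp_preimage (measurableEmbedding_addRight _)).2
      (hf.integrableOn_isCompact hK')
    exact this.mono_set (subset_preimage_image _ _)
  refine ae_eq_of_integral_contDiff_smul_eq (hshift.sub hf) (locallyIntegrable_lineIntegral hg e h)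
    fun ψ hψ hc => ?_
  have hderiv : ∀ t : ℝ, HasDerivAt (fun t : ℝ => ∫ x, f (x + t • e) * ψ x)
      (∫ x, g (x + t • e) * ψ x) t := by
    intro t
    refine (hasDerivAt_integral_shift hf hψ hc e t).congr_deriv ?_
    have hψt : ContDiff ℝ ((⊤ : ℕ∞) : WithTop ℕ∞) fun x => ψ (x - t • e) :=
      hψ.comp (contDiff_id.sub contDiff_const)
    have hct : HasCompactSupport fun x => ψ (x - t • e) := by
      have := hc.comp_homeomorph (Homeomorph.addRight (-(t • e)))
      simpa [Function.comp_def, sub_eq_add_neg] using this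
    have h1 := hw _ hψt hct
    have h2 : ∀ x, fderiv ℝ (fun x => ψ (x - t • e)) x e = fderiv ℝ ψ (x - t • e) e := by
      intro x
      rw [fderiv_comp_sub]
    simp only [h2] at h1
    rw [← integral_add_right_eq_self _ (t • e), ← integral_add_right_eq_self (fun x => g x * _)
      (t • e)] at h1
    simp only [add_sub_cancel_right] at h1
    rw [h1, neg_neg]
  have hcont : Continuous fun t : ℝ => ∫ x, g (x + t • e) * ψ x :=
    (continuous_integral_shift hg hψ.continuous hc).comp (by fun_prop : Continuous fun t : ℝ => t • e)
  have hftc := intervalIntegral.integral_eq_sub_of_hasDerivAt (a := 0) (b := h)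
    (fun t _ => hderiv t) (hcont.intervalIntegrable _ _)
  rw [integral_integral_shift hg e h hψ.continuous hc] at hftc
  simp only [zero_smul, add_zero] at hftc
  simp only [smul_eq_mul]
  simp only [mul_comm (ψ _), sub_mul]
  rw [hftc, integral_sub]
  · have := hshift.integrable_smul_right_of_hasCompactSupport hψ.continuous hc
    exact this
  · have := hf.integrable_smul_right_of_hasCompactSupport hψ.continuous hc
    exact this

/-- The function h ↦ ∫ f(x + he) ψ is differentiated at 0 in two ways: once with the derivative on
ψ, once through the line identity. Uniqueness of the derivative is the weak equation. -/
theorem weak_of_hasLineDeriv {j : Fin s} {f g : (Fin s → ℝ) → ℝ} (hf : LocallyIntegrable f)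
    (hg : LocallyIntegrable g) (hfg : HasLineDeriv j f g) {ψ : (Fin s → ℝ) → ℝ}
    (hψ : ContDiff ℝ ((⊤ : ℕ∞) : WithTop ℕ∞) ψ) (hc : HasCompactSupport ψ) :
    ∫ x, f x * fderiv ℝ ψ x (Pi.single j 1) = -∫ x, g x * ψ x := by
  set e : Fin s → ℝ := Pi.single j 1 with he
  have hcont : Continuous fun t : ℝ => ∫ x, g (x + t • e) * ψ x :=
    (continuous_integral_shift hg hψ.continuous hc).comp (by fun_prop : Continuous fun t : ℝ => t • e)
  have hshift : ∀ h : ℝ, Integrable fun x => f (x + h • e) * ψ x := by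
    intro h
    have h1 : Integrable fun x => f x * ψ (x - h • e) := by
      refine hf.integrable_smul_right_of_hasCompactSupport
        (hψ.continuous.comp (by fun_prop)) ?_
      have := hc.comp_homeomorph (Homeomorph.addRight (-(h • e)))
      simpa [Function.comp_def, sub_eq_add_neg] using this
    have := h1.comp_add_right (h • e)
    simpa using this
  have heq : ∀ h : ℝ, ∫ x, f (x + h • e) * ψ x =
      (∫ x, f x * ψ x) + ∫ t in (0 : ℝ)..h, ∫ x, g (x + t • e) * ψ x := by
    intro h
    rw [integral_integral_shift hg e h hψ.continuous hc, ← sub_eq_iff_eq_add']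
    have h0 := hshift 0
    simp only [zero_smul, add_zero] at h0
    rw [← integral_sub (hshift h) h0]
    refine integral_congr_ae ?_
    filter_upwards [hfg h] with x hx
    rw [← sub_mul, hx]
  have h1 := hasDerivAt_integral_shift hf hψ hc e 0
  have h2 : HasDerivAt (fun h : ℝ => ∫ x, f (x + h • e) * ψ x)
      (∫ x, g (x + (0 : ℝ) • e) * ψ x) 0 := by
    have h3 := (hcont.integral_hasStrictDerivAt 0 0).hasDerivAt.const_add (∫ x, f x * ψ x)
    refine h3.congr_of_eventuallyEq (Eventually.of_forall heq)
  have h4 := h1.unique h2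
  simp only [zero_smul, add_zero] at h4
  linarith

end LineDerivative


/-! ### Order of differentiation of test functions -/

section MixedPartial

variable {s : ℕ}

/-- Smooth functions on `ℝ^s`. -/
abbrev SmoothFun (s : ℕ) : Type :=
  {ψ : (Fin s → ℝ) → ℝ // ContDiff ℝ ((⊤ : ℕ∞) : WithTop ℕ∞) ψ}

theorem contDiff_coordDeriv {ψ : (Fin s → ℝ) → ℝ} (hψ : ContDiff ℝ ((⊤ : ℕ∞) : WithTop ℕ∞) ψ)
    (e : Fin s → ℝ) : ContDiff ℝ ((⊤ : ℕ∞) : WithTop ℕ∞) fun x => fderiv ℝ ψ x e :=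
  (hψ.fderiv_right (m := ((⊤ : ℕ∞) : WithTop ℕ∞)) (by simp)).clm_apply contDiff_const

theorem coordDeriv_comm {ψ : (Fin s → ℝ) → ℝ} (hψ : ContDiff ℝ ((⊤ : ℕ∞) : WithTop ℕ∞) ψ)
    (e e' : Fin s → ℝ) (x : Fin s → ℝ) :
    fderiv ℝ (fun x => fderiv ℝ ψ x e) x e' = fderiv ℝ (fun x => fderiv ℝ ψ x e') x e := by
  have hd : DifferentiableAt ℝ (fderiv ℝ ψ) x :=
    (hψ.fderiv_right (m := ((⊤ : ℕ∞) : WithTop ℕ∞)) (by simp)).differentiable (by simp) x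
  have h : ∀ a, fderiv ℝ (fun x => fderiv ℝ ψ x a) x = (fderiv ℝ (fderiv ℝ ψ) x).flip a := by
    intro a
    rw [fderiv_clm_apply hd (differentiableAt_const a)]
    simp
  have hsymm : IsSymmSndFDerivAt ℝ ψ x := hψ.contDiffAt.isSymmSndFDerivAt (by
    rw [minSmoothness_of_isRCLikeNormedField]; exact WithTop.coe_le_coe.2 (le_top : (2 : ℕ∞) ≤ ⊤))
  rw [h, h, ContinuousLinearMap.flip_apply, ContinuousLinearMap.flip_apply]
  exact hsymm.eq _ _

/-- The partial derivative as an operator on smooth functions. -/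
def SmoothFun.deriv (j : Fin s) (ψ : SmoothFun s) : SmoothFun s :=
  ⟨fun x => fderiv ℝ ψ.1 x (Pi.single j 1), contDiff_coordDeriv ψ.2 _⟩

theorem foldr_coordDeriv (l : List (Fin s)) (ψ : SmoothFun s) :
    l.foldr (fun j h x => fderiv ℝ h x (Pi.single j 1)) ψ.1 =
      (l.foldr SmoothFun.deriv ψ).1 := by
  induction l with
  | nil => rfl
  | cons j l ih => rw [List.foldr_cons, List.foldr_cons, ih]; rfl

/-- The sorted order in `mixedPartial` is a convention only: partial derivatives of smooth functions
commute, so the fold is permutation invariant and j can be moved innermost. -/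
theorem mixedPartial_insert {ψ : (Fin s → ℝ) → ℝ}
    (hψ : ContDiff ℝ ((⊤ : ℕ∞) : WithTop ℕ∞) ψ) {j : Fin s} {u : Finset (Fin s)} (hj : j ∉ u) :
    mixedPartial (insert j u) ψ = mixedPartial u fun x => fderiv ℝ ψ x (Pi.single j 1) := by
  have hperm : ((insert j u).sort (· ≤ ·)).Perm (u.sort (· ≤ ·) ++ [j]) := by
    rw [List.perm_ext_iff_of_nodup (Finset.sort_nodup _ _)]
    · intro a
      simp [or_comm]
    · refine List.nodup_append.2 ⟨Finset.sort_nodup _ _, List.nodup_singleton _, ?_⟩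
      intro a ha b hb
      rw [List.mem_singleton] at hb
      rw [Finset.mem_sort] at ha
      rintro rfl
      exact hj (hb ▸ ha)
  have hfold := hperm.foldr_eq' (f := SmoothFun.deriv) (fun x _ y _ z =>
    Subtype.ext (funext fun t => coordDeriv_comm z.2 _ _ t)) (⟨ψ, hψ⟩ : SmoothFun s)
  rw [mixedPartial, mixedPartial, foldr_coordDeriv _ (⟨ψ, hψ⟩ : SmoothFun s), hfold,
    List.foldr_append]
  exact (foldr_coordDeriv _ (SmoothFun.deriv j ⟨ψ, hψ⟩)).symm

theorem mixedPartial_empty (ψ : (Fin s → ℝ) → ℝ) : mixedPartial ∅ ψ = ψ := by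
  simp [mixedPartial]

theorem hasCompactSupport_coordDeriv {ψ : (Fin s → ℝ) → ℝ} (hc : HasCompactSupport ψ)
    (e : Fin s → ℝ) : HasCompactSupport fun x => fderiv ℝ ψ x e :=
  hc.fderiv_apply ℝ e

end MixedPartial

/-! ### Compatible systems of mixed weak derivatives -/

section Family

variable {s : ℕ} {φ : ℝ → ℝ} {q : ℝ}

/-- A compatible system of mixed derivatives of `F ∅`, all of them measurable and in `L^q(φ)`. -/
structure IsDerivFamily (φ : ℝ → ℝ) (q : ℝ) (F : Finset (Fin s) → (Fin s → ℝ) → ℝ) : Prop where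
  measurable : ∀ u, Measurable (F u)
  memLp : ∀ u, MemLp (F u) (ENNReal.ofReal q) (wMeasurePi φ (Fin s))
  lineDeriv : ∀ u j, j ∉ u → HasLineDeriv j (F u) (F (insert j u))

theorem IsWeakMixedDeriv.congr_right {v : Finset (Fin s)} {f g g' : (Fin s → ℝ) → ℝ}
    (h : IsWeakMixedDeriv v f g) (hg : g =ᵐ[volume] g') : IsWeakMixedDeriv v f g' := by
  refine ⟨h.1, h.2.1.congr hg, fun ψ hψ hc => ?_⟩
  rw [h.2.2 ψ hψ hc]
  congr 1
  refine integral_congr_ae ?_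
  filter_upwards [hg] with x hx
  rw [hx]

theorem IsWeakMixedDeriv.congr_left {v : Finset (Fin s)} {f f' g : (Fin s → ℝ) → ℝ}
    (h : IsWeakMixedDeriv v f g) (hf : f =ᵐ[volume] f') : IsWeakMixedDeriv v f' g := by
  refine ⟨h.1.congr hf, h.2.1, fun ψ hψ hc => ?_⟩
  rw [← h.2.2 ψ hψ hc]
  refine integral_congr_ae ?_
  filter_upwards [hf] with x hx
  rw [hx]

theorem IsWeakMixedDeriv.ae_eq {v : Finset (Fin s)} {f g g' : (Fin s → ℝ) → ℝ}
    (h : IsWeakMixedDeriv v f g) (h' : IsWeakMixedDeriv v f g') : g =ᵐ[volume] g' := by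
  refine ae_eq_of_integral_contDiff_smul_eq h.2.1 h'.2.1 fun ψ hψ hc => ?_
  have h1 := h.2.2 ψ hψ hc
  rw [h'.2.2 ψ hψ hc] at h1
  have h2 := mul_left_cancel₀ (pow_ne_zero _ (by norm_num : (-1 : ℝ) ≠ 0)) h1
  simp only [smul_eq_mul, mul_comm (ψ _)]
  exact h2.symm

theorem isWeakMixedDeriv_empty {f : (Fin s → ℝ) → ℝ} (hf : LocallyIntegrable f) :
    IsWeakMixedDeriv ∅ f f :=
  ⟨hf, hf, fun ψ _ _ => by simp [mixedPartial_empty]⟩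

/-- Induction on u: the hypothesis for u is tested with ∂_jψ, and then one single-coordinate
integration by parts moves ∂_j off the test function. -/
theorem IsDerivFamily.isWeakMixedDeriv (hφ : IsAdmissibleDensity φ) (hq : 1 < q)
    {F : Finset (Fin s) → (Fin s → ℝ) → ℝ} (hF : IsDerivFamily φ q F) (u : Finset (Fin s)) :
    IsWeakMixedDeriv u (F ∅) (F u) := by
  have hloc := fun u => locallyIntegrable_of_memLp_wMeasurePi hφ hq (hF.memLp u)
  induction u using Finset.induction_on with
  | empty => exact isWeakMixedDeriv_empty (hloc ∅)
  | insert j u hj ih =>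
    refine ⟨hloc _, hloc _, fun ψ hψ hc => ?_⟩
    rw [mixedPartial_insert hψ hj, ih.2.2 _ (contDiff_coordDeriv hψ _)
      (hasCompactSupport_coordDeriv hc _), weak_of_hasLineDeriv (hloc u) (hloc _)
      (hF.lineDeriv u j hj) hψ hc, Finset.card_insert_of_notMem hj, pow_succ]
    ring

theorem IsDerivFamily.memWMix (hφ : IsAdmissibleDensity φ) (hq : 1 < q)
    {F : Finset (Fin s) → (Fin s → ℝ) → ℝ} (hF : IsDerivFamily φ q F) {f : (Fin s → ℝ) → ℝ}
    (hf : F ∅ =ᵐ[volume] f) : MemWMix φ q f :=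
  fun u => ⟨F u, (hF.isWeakMixedDeriv hφ hq u).congr_left hf, hF.memLp u⟩

/-- Testing ∂^u f with ∂_jψ and cancelling (−1)^{|u|} shows that the weak j-derivative of ∂^u f is
∂^{u∪{j}} f. Measurable representatives are fixed once and for all. -/
theorem MemWMix.exists_isDerivFamily (hφ : IsAdmissibleDensity φ)
    {f : (Fin s → ℝ) → ℝ} (hf : MemWMix φ q f) :
    ∃ F : Finset (Fin s) → (Fin s → ℝ) → ℝ, IsDerivFamily φ q F ∧ F ∅ =ᵐ[volume] f := by
  choose g hg hgL using hf
  set F : Finset (Fin s) → (Fin s → ℝ) → ℝ := fun u => (hgL u).aestronglyMeasurable.mk (g u)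
  have hFg : ∀ u, g u =ᵐ[volume] F u := fun u =>
    (absolutelyContinuous_wMeasurePi hφ s).ae_eq (hgL u).aestronglyMeasurable.ae_eq_mk
  have hFw : ∀ u, IsWeakMixedDeriv u f (F u) := fun u => (hg u).congr_right (hFg u)
  refine ⟨F, ⟨fun u => (hgL u).aestronglyMeasurable.stronglyMeasurable_mk.measurable,
    fun u => (hgL u).ae_eq (hgL u).aestronglyMeasurable.ae_eq_mk, fun u j hj => ?_⟩, ?_⟩
  · refine hasLineDeriv_of_weak (hFw u).2.1 (hFw _).2.1 fun ψ hψ hc => ?_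
    have h1 := (hFw (insert j u)).2.2 ψ hψ hc
    have h2 := (hFw u).2.2 _ (contDiff_coordDeriv hψ (Pi.single j 1))
      (hasCompactSupport_coordDeriv hc _)
    rw [mixedPartial_insert hψ hj, h2, Finset.card_insert_of_notMem hj, pow_succ, mul_assoc] at h1
    have := mul_left_cancel₀ (pow_ne_zero _ (by norm_num : (-1 : ℝ) ≠ 0)) h1
    linarith
  · exact (hFw ∅).ae_eq (isWeakMixedDeriv_empty (hFw ∅).1)

end Family

/-! ### Integrating out coordinates by resampling -/

section Piecewise

variable {s : ℕ} {φ : ℝ → ℝ}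

theorem measurable_piecewise (J : Finset (Fin s)) :
    Measurable fun p : (Fin s → ℝ) × (Fin s → ℝ) => J.piecewise p.2 p.1 := by
  refine measurable_pi_iff.2 fun j => ?_
  by_cases h : j ∈ J
  · simp only [Finset.piecewise_eq_of_mem _ _ _ h]
    exact (measurable_pi_apply j).comp measurable_snd
  · simp only [Finset.piecewise_eq_of_notMem _ _ _ h]
    exact (measurable_pi_apply j).comp measurable_fst

/-- Mixing the coordinates of two independent samples gives a sample again. Partial integration thus
becomes Fubini for two copies of the full space, with no splitting of the index set. -/
theorem measurePreserving_piecewise (hφ : IsAdmissibleDensity φ) (J : Finset (Fin s)) :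
    MeasurePreserving (fun p : (Fin s → ℝ) × (Fin s → ℝ) => J.piecewise p.2 p.1)
      ((wMeasurePi φ (Fin s)).prod (wMeasurePi φ (Fin s))) (wMeasurePi φ (Fin s)) := by
  have := isProbabilityMeasure_wMeasure hφ
  refine ⟨measurable_piecewise J, ?_⟩
  symm
  refine Measure.pi_eq fun A hA => ?_
  rw [Measure.map_apply (measurable_piecewise J) (MeasurableSet.univ_pi hA)]
  have : (fun p : (Fin s → ℝ) × (Fin s → ℝ) => J.piecewise p.2 p.1) ⁻¹' univ.pi A =
      (univ.pi fun j => if j ∈ J then univ else A j) ×ˢ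
        (univ.pi fun j => if j ∈ J then A j else univ) := by
    ext p
    simp only [mem_preimage, Set.mem_pi, mem_univ, true_imp_iff, mem_prod, ← forall_and]
    refine forall_congr' fun j => ?_
    by_cases h : j ∈ J <;> simp [h]
  rw [this, wMeasurePi, Measure.prod_prod, Measure.pi_pi, Measure.pi_pi, ← Finset.prod_mul_distrib]
  refine Finset.prod_congr rfl fun j _ => ?_
  by_cases h : j ∈ J <;> simp [h]

theorem measurable_update_pair (j : Fin s) :
    Measurable fun p : (Fin s → ℝ) × ℝ => Function.update p.1 j p.2 := by
  refine measurable_pi_iff.2 fun i => ?_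
  by_cases h : i = j
  · subst h; simpa using measurable_snd
  · simp only [Function.update_of_ne h]
    exact (measurable_pi_apply i).comp measurable_fst

theorem measurePreserving_update (hφ : IsAdmissibleDensity φ) (j : Fin s) :
    MeasurePreserving (fun p : (Fin s → ℝ) × ℝ => Function.update p.1 j p.2)
      ((wMeasurePi φ (Fin s)).prod (wMeasure φ)) (wMeasurePi φ (Fin s)) := by
  have := isProbabilityMeasure_wMeasure hφ
  refine ⟨measurable_update_pair j, ?_⟩
  symm
  refine Measure.pi_eq fun A hA => ?_
  rw [Measure.map_apply (measurable_update_pair j) (MeasurableSet.univ_pi hA)]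
  have : (fun p : (Fin s → ℝ) × ℝ => Function.update p.1 j p.2) ⁻¹' univ.pi A =
      (univ.pi fun i => if i = j then univ else A i) ×ˢ A j := by
    ext p
    simp only [mem_preimage, Set.mem_pi, mem_univ, true_imp_iff, mem_prod]
    constructor
    · intro h
      refine ⟨fun i => ?_, by simpa using h j⟩
      by_cases hi : i = j
      · simp [hi]
      · simpa [hi] using h i
    · rintro ⟨h1, h2⟩ i
      by_cases hi : i = j
      · subst hi; simpa using h2
      · simpa [hi] using h1 i
  rw [this, wMeasurePi, Measure.prod_prod, Measure.pi_pi, ← Finset.mul_prod_erase _ _ (Finset.mem_univ j),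
    ← Finset.mul_prod_erase _ (fun i => wMeasure φ (A i)) (Finset.mem_univ j)]
  simp only [if_true, measure_univ, one_mul]
  rw [mul_comm]
  congr 1
  refine Finset.prod_congr rfl fun i hi => ?_
  rw [if_neg (Finset.ne_of_mem_erase hi)]

theorem ae_ae_piecewise (hφ : IsAdmissibleDensity φ) (J : Finset (Fin s))
    {P : (Fin s → ℝ) → Prop} (h : ∀ᵐ x, P x) :
    ∀ᵐ x, ∀ᵐ z ∂wMeasurePi φ (Fin s), P (J.piecewise z x) := by
  have := isProbabilityMeasure_wMeasurePi hφ (Fin s)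
  rw [← ae_wMeasurePi hφ] at h ⊢
  exact Measure.ae_ae_of_ae_prod
    ((measurePreserving_piecewise hφ J).quasiMeasurePreserving.ae h)

/-- The coordinates in `J` are integrated out against the density. -/
def avgOut (φ : ℝ → ℝ) (J : Finset (Fin s)) (f : (Fin s → ℝ) → ℝ) (x : Fin s → ℝ) : ℝ :=
  ∫ z, f (J.piecewise z x) ∂wMeasurePi φ (Fin s)

theorem measurePreserving_restrict (hφ : IsAdmissibleDensity φ) (J : Finset (Fin s)) :
    MeasurePreserving (fun (z : Fin s → ℝ) (i : J) => z i) (wMeasurePi φ (Fin s))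
      (wMeasurePi φ J) := by
  have := isProbabilityMeasure_wMeasure hφ
  have hm : Measurable fun (z : Fin s → ℝ) (i : J) => z i :=
    measurable_pi_iff.2 fun i => measurable_pi_apply _
  refine ⟨hm, ?_⟩
  symm
  refine Measure.pi_eq fun A hA => ?_
  rw [Measure.map_apply hm (MeasurableSet.univ_pi hA)]
  have : (fun (z : Fin s → ℝ) (i : J) => z i) ⁻¹' univ.pi A =
      univ.pi fun j => if h : j ∈ J then A ⟨j, h⟩ else univ := by
    ext z
    simp only [mem_preimage, Set.mem_pi, mem_univ, true_imp_iff]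
    constructor
    · intro h j
      split_ifs with hj
      · exact h ⟨j, hj⟩
      · exact mem_univ _
    · intro h i
      simpa [i.2] using h i.1
  rw [this, wMeasurePi, Measure.pi_pi, ← Finset.prod_subset (Finset.subset_univ J)]
  · rw [← Finset.prod_coe_sort]
    refine Finset.prod_congr rfl fun i _ => ?_
    simp [i.2]
  · intro j _ hj
    simp [hj]

theorem updateFinset_eq_piecewise (J : Finset (Fin s)) (x z : Fin s → ℝ) :
    Function.updateFinset x J (fun i : J => z i) = J.piecewise z x := by
  ext i
  by_cases h : i ∈ J <;> simp [Function.updateFinset, h]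

theorem measurable_updateFinset_right (J : Finset (Fin s)) (x : Fin s → ℝ) :
    Measurable fun y : J → ℝ => Function.updateFinset x J y := by
  refine measurable_pi_iff.2 fun i => ?_
  by_cases h : i ∈ J
  · simp only [Function.updateFinset, h, dif_pos]
    exact measurable_pi_apply _
  · simp only [Function.updateFinset, h, dif_neg, not_false_iff]
    exact measurable_const

theorem integrateOut_eq_avgOut (hφ : IsAdmissibleDensity φ) (J : Finset (Fin s))
    {f : (Fin s → ℝ) → ℝ} (hf : Measurable f) : integrateOut φ J f = avgOut φ J f := by
  ext x
  rw [integrateOut, avgOut, ← (measurePreserving_restrict hφ J).map_eq,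
    integral_map (f := fun y : J → ℝ => f (Function.updateFinset x J y))
      (measurePreserving_restrict hφ J).measurable.aemeasurable
      (hf.comp (measurable_updateFinset_right J x)).aestronglyMeasurable]
  simp only [updateFinset_eq_piecewise]

/-- Neither function is assumed measurable, so the exceptional set is enlarged to a measurable null
set, almost all of whose slices are null. -/
theorem integrateOut_congr_ae (hφ : IsAdmissibleDensity φ) (J : Finset (Fin s))
    {f g : (Fin s → ℝ) → ℝ} (h : f =ᵐ[volume] g) :
    integrateOut φ J f =ᵐ[volume] integrateOut φ J g := by
  obtain ⟨N, hN, hNm, hN0⟩ := exists_measurable_superset_of_null h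
  have hae : ∀ᵐ x, x ∉ N := measure_eq_zero_iff_ae_notMem.1 hN0
  filter_upwards [ae_ae_piecewise hφ J hae] with x hx
  refine integral_congr_ae ?_
  have hx2 : ∀ᵐ y ∂wMeasurePi φ J, Function.updateFinset x J y ∉ N := by
    rw [← (measurePreserving_restrict hφ J).map_eq]
    refine (ae_map_iff (measurePreserving_restrict hφ J).measurable.aemeasurable
        ((measurable_updateFinset_right J x) hNm.compl)).2 ?_
    simpa only [updateFinset_eq_piecewise, mem_compl_iff] using hx
  filter_upwards [hx2] with y hy
  by_contra hne
  exact hy (hN hne)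

theorem measurable_avgOut (hφ : IsAdmissibleDensity φ) (J : Finset (Fin s))
    {f : (Fin s → ℝ) → ℝ} (hf : Measurable f) : Measurable (avgOut φ J f) := by
  have := isProbabilityMeasure_wMeasurePi hφ (Fin s)
  exact (StronglyMeasurable.integral_prod_right
    (f := fun x z => f (J.piecewise z x)) (hf.comp (measurable_piecewise J)).stronglyMeasurable).measurable

/-- On a probability space the L¹ norm is at most the L^q norm; apply this to each slice and
integrate the slices by `measurePreserving_piecewise`. -/
theorem memLp_avgOut (hφ : IsAdmissibleDensity φ) {q : ℝ} (hq : 1 < q) (J : Finset (Fin s))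
    {f : (Fin s → ℝ) → ℝ} (hf : Measurable f)
    (hfL : MemLp f (ENNReal.ofReal q) (wMeasurePi φ (Fin s))) :
    MemLp (avgOut φ J f) (ENNReal.ofReal q) (wMeasurePi φ (Fin s)) := by
  have := isProbabilityMeasure_wMeasurePi hφ (Fin s)
  have hq0 : 0 < q := by linarith
  refine ⟨(measurable_avgOut hφ J hf).aestronglyMeasurable, ?_⟩
  have hne : ENNReal.ofReal q ≠ 0 := by simpa using hq0
  have hfin := hfL.2
  rw [eLpNorm_lt_top_iff_lintegral_rpow_enorm_lt_top hne ENNReal.ofReal_ne_top,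
    ENNReal.toReal_ofReal hq0.le] at hfin ⊢
  refine lt_of_le_of_lt ?_ hfin
  have hMP := measurePreserving_piecewise hφ (s := s) J
  rw [← hMP.lintegral_comp (hf.enorm.pow_const q),
    lintegral_prod (fun p : (Fin s → ℝ) × (Fin s → ℝ) => ‖f (J.piecewise p.2 p.1)‖ₑ ^ q)
      ((hf.comp hMP.measurable).enorm.pow_const q).aemeasurable]
  refine lintegral_mono fun x => ?_
  have hm : Measurable fun z => f (J.piecewise z x) :=
    (hf.comp (measurable_piecewise J)).comp measurable_prodMk_left
  have h1 : ‖avgOut φ J f x‖ₑ ≤ eLpNorm (fun z => f (J.piecewise z x)) (ENNReal.ofReal q)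
      (wMeasurePi φ (Fin s)) := by
    refine (enorm_integral_le_lintegral_enorm _).trans ?_
    rw [← eLpNorm_one_eq_lintegral_enorm]
    exact eLpNorm_le_eLpNorm_of_exponent_le (by simpa using hq.le) hm.aestronglyMeasurable
  refine (ENNReal.rpow_le_rpow h1 hq0.le).trans (le_of_eq ?_)
  rw [eLpNorm_eq_lintegral_rpow_enorm_toReal hne ENNReal.ofReal_ne_top,
    ENNReal.toReal_ofReal hq0.le, ← ENNReal.rpow_mul, one_div, inv_mul_cancel₀ hq0.ne',
    ENNReal.rpow_one]

end Piecewise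


/-! ### Line derivatives under sums and averages -/

section Lines

variable {s : ℕ}

theorem quasiMeasurePreserving_shift (e : Fin s → ℝ) :
    Measure.QuasiMeasurePreserving (fun q : (Fin s → ℝ) × ℝ => q.1 + q.2 • e)
      ((volume : Measure (Fin s → ℝ)).prod (volume : Measure ℝ)) volume := by
  have hmp : MeasurePreserving (fun q : ℝ × (Fin s → ℝ) => (q.1, q.2 + q.1 • e))
      ((volume : Measure ℝ).prod (volume : Measure (Fin s → ℝ)))
      ((volume : Measure ℝ).prod (volume : Measure (Fin s → ℝ))) := by
    refine (MeasurePreserving.id _).skew_product (g := fun t x => x + t • e) ?_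
      (ae_of_all _ fun t => ?_)
    · exact Continuous.measurable (by fun_prop)
    · exact map_add_right_eq_self volume (t • e)
  exact (Measure.quasiMeasurePreserving_snd.comp hmp.quasiMeasurePreserving).comp
    Measure.measurePreserving_swap.quasiMeasurePreserving

theorem ae_ae_shift (e : Fin s → ℝ) {P : (Fin s → ℝ) → Prop} (h : ∀ᵐ x, P x) :
    ∀ᵐ x, ∀ᵐ t : ℝ, P (x + t • e) :=
  Measure.ae_ae_of_ae_prod ((quasiMeasurePreserving_shift e).ae h)

/-- Fubini for the shear over each ball of an exhaustion of the space. -/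
theorem ae_integrableOn_line {g : (Fin s → ℝ) → ℝ} (hg : LocallyIntegrable g) (e : Fin s → ℝ)
    (h : ℝ) : ∀ᵐ x, IntegrableOn (fun t : ℝ => g (x + t • e)) (uIcc 0 h) := by
  have hn : ∀ n : ℕ, ∀ᵐ x, x ∈ Metric.closedBall (0 : Fin s → ℝ) n →
      IntegrableOn (fun t : ℝ => g (x + t • e)) (uIcc 0 h) := by
    intro n
    have := (integrable_shear hg e (isCompact_uIcc (a := 0) (b := h))
      (isCompact_closedBall (0 : Fin s → ℝ) n)).prod_left_ae
    exact (ae_restrict_iff' measurableSet_closedBall).1 this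
  filter_upwards [ae_all_iff.2 hn] with x hx
  obtain ⟨n, hn⟩ := exists_nat_ge ‖x‖
  exact hx n (by simpa using hn)

theorem ae_intervalIntegrable_line {g : (Fin s → ℝ) → ℝ} (hg : LocallyIntegrable g)
    (e : Fin s → ℝ) (h : ℝ) :
    ∀ᵐ x, IntervalIntegrable (fun t : ℝ => g (x + t • e)) volume 0 h := by
  filter_upwards [ae_integrableOn_line hg e h] with x hx
  exact intervalIntegrable_iff.2 (hx.mono_set uIoc_subset_uIcc)

theorem HasLineDeriv.sub {j : Fin s} {f f' g g' : (Fin s → ℝ) → ℝ} (h : HasLineDeriv j f g)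
    (h' : HasLineDeriv j f' g') (hg : LocallyIntegrable g) (hg' : LocallyIntegrable g') :
    HasLineDeriv j (fun x => f x - f' x) (fun x => g x - g' x) := by
  intro t
  filter_upwards [h t, h' t, ae_intervalIntegrable_line hg (Pi.single j 1) t,
    ae_intervalIntegrable_line hg' (Pi.single j 1) t] with x h1 h2 h3 h4
  rw [intervalIntegral.integral_sub h3 h4, ← h1, ← h2]
  ring

theorem hasLineDeriv_zero (j : Fin s) : HasLineDeriv j (fun _ => 0) (fun _ => 0) := by
  intro t; simp

theorem HasLineDeriv.sum {ι : Type*} {j : Fin s} {f g : ι → (Fin s → ℝ) → ℝ} {S : Finset ι}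
    (h : ∀ i ∈ S, HasLineDeriv j (f i) (g i)) (hg : ∀ i ∈ S, LocallyIntegrable (g i)) :
    HasLineDeriv j (fun x => ∑ i ∈ S, f i x) (fun x => ∑ i ∈ S, g i x) := by
  intro t
  have h1 : ∀ᵐ x, ∀ i ∈ S, f i (x + t • Pi.single j 1) - f i x =
      ∫ r in (0 : ℝ)..t, g i (x + r • Pi.single j 1) :=
    (Finset.eventually_all S).2 fun i hi => h i hi t
  have h2 : ∀ᵐ x, ∀ i ∈ S,
      IntervalIntegrable (fun r : ℝ => g i (x + r • Pi.single j 1)) volume 0 t :=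
    (Finset.eventually_all S).2 fun i hi => ae_intervalIntegrable_line (hg i hi) _ t
  filter_upwards [h1, h2] with x h1 h2
  rw [intervalIntegral.integral_finsetSum h2, ← Finset.sum_sub_distrib]
  exact Finset.sum_congr rfl h1

theorem piecewise_add_single_of_notMem {J : Finset (Fin s)} {j : Fin s} (hj : j ∉ J)
    (z x : Fin s → ℝ) (t : ℝ) :
    J.piecewise z (x + t • Pi.single j 1) = J.piecewise z x + t • Pi.single j 1 := by
  ext i
  by_cases hi : i ∈ J
  · have : i ≠ j := fun h => hj (h ▸ hi)
    simp [hi, this]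
  · simp [hi]

theorem piecewise_add_single_of_mem {J : Finset (Fin s)} {j : Fin s} (hj : j ∈ J)
    (z x : Fin s → ℝ) (t : ℝ) :
    J.piecewise z (x + t • Pi.single j 1) = J.piecewise z x := by
  ext i
  by_cases hi : i ∈ J
  · simp [hi]
  · have : i ≠ j := fun h => hi (h ▸ hj)
    simp [hi, this]

variable {φ : ℝ → ℝ} {q : ℝ}

theorem ae_integrable_piecewise (hφ : IsAdmissibleDensity φ) (J : Finset (Fin s))
    {f : (Fin s → ℝ) → ℝ} (hf : Integrable f (wMeasurePi φ (Fin s))) :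
    ∀ᵐ x, Integrable (fun z => f (J.piecewise z x)) (wMeasurePi φ (Fin s)) := by
  have := isProbabilityMeasure_wMeasurePi hφ (Fin s)
  rw [← ae_wMeasurePi hφ]
  exact ((measurePreserving_piecewise hφ J).integrable_comp_of_integrable hf).prod_right_ae

theorem integrable_avgOut_norm (hφ : IsAdmissibleDensity φ) (J : Finset (Fin s))
    {f : (Fin s → ℝ) → ℝ} (hf : Integrable f (wMeasurePi φ (Fin s))) :
    Integrable (fun x => ∫ z, ‖f (J.piecewise z x)‖ ∂wMeasurePi φ (Fin s))
      (wMeasurePi φ (Fin s)) := by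
  have := isProbabilityMeasure_wMeasurePi hφ (Fin s)
  exact ((measurePreserving_piecewise hφ J).integrable_comp_of_integrable hf.norm).integral_prod_left

/-- For j ∉ J, moving along e_j commutes with replacing the coordinates in J, so the line identity
can be averaged over z and the two integrals exchanged. -/
theorem hasLineDeriv_avgOut (hφ : IsAdmissibleDensity φ) {J : Finset (Fin s)} {j : Fin s}
    (hj : j ∉ J) {f g : (Fin s → ℝ) → ℝ} (hgm : Measurable g)
    (hf : Integrable f (wMeasurePi φ (Fin s))) (hg : Integrable g (wMeasurePi φ (Fin s)))
    (hfg : HasLineDeriv j f g) : HasLineDeriv j (avgOut φ J f) (avgOut φ J g) := by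
  have := isProbabilityMeasure_wMeasurePi hφ (Fin s)
  intro h
  set e : Fin s → ℝ := Pi.single j 1 with he
  have A2 := ae_integrable_piecewise hφ J hf
  have A2' : ∀ᵐ x, Integrable (fun z => f (J.piecewise z (x + h • e))) (wMeasurePi φ (Fin s)) :=
    (measurePreserving_add_right volume (h • e)).quasiMeasurePreserving.ae A2
  have A3 := ae_ae_shift e (ae_integrable_piecewise hφ J hg)
  have A4 := ae_integrableOn_line
    (locallyIntegrable_of_integrable_wMeasurePi hφ (integrable_avgOut_norm hφ J hg)) e h
  filter_upwards [ae_ae_piecewise hφ J (hfg h), A2, A2', A3, A4] with x h1 h2 h3 h4 h5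
  -- Fubini needs integrable slices for almost every t, and integrability in t of their norms along
  -- this line.
  have hprod : Integrable (fun p : ℝ × (Fin s → ℝ) => g (J.piecewise p.2 (x + p.1 • e)))
      ((volume.restrict (uIoc 0 h)).prod (wMeasurePi φ (Fin s))) := by
    have hm : Measurable fun p : ℝ × (Fin s → ℝ) => g (J.piecewise p.2 (x + p.1 • e)) := by
      have hmm : Measurable fun p : ℝ × (Fin s → ℝ) => (x + p.1 • e, p.2) := by fun_prop
      exact hgm.comp ((measurable_piecewise J).comp hmm)
    rw [integrable_prod_iff hm.aestronglyMeasurable]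
    exact ⟨ae_restrict_of_ae h4, h5.mono_set uIoc_subset_uIcc⟩
  simp only [avgOut]
  rw [← integral_sub h3 h2, intervalIntegral_integral_swap hprod]
  refine integral_congr_ae ?_
  filter_upwards [h1] with z hz
  simp only [e, piecewise_add_single_of_notMem hj]
  exact hz

/-- After averaging over vᶜ the function no longer depends on those coordinates, so every derivative
involving a direction outside v is zero. -/
theorem IsDerivFamily.avgOut_compl (hφ : IsAdmissibleDensity φ) (hq : 1 < q)
    {F : Finset (Fin s) → (Fin s → ℝ) → ℝ} (hF : IsDerivFamily φ q F) (v : Finset (Fin s)) :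
    IsDerivFamily φ q fun u => if u ⊆ v then avgOut φ vᶜ (F u) else fun _ => 0 := by
  refine ⟨fun u => ?_, fun u => ?_, fun u j hj => ?_⟩
  · split_ifs
    exacts [measurable_avgOut hφ _ (hF.measurable u), measurable_const]
  · split_ifs
    exacts [memLp_avgOut hφ hq _ (hF.measurable u) (hF.memLp u), MemLp.zero]
  · by_cases hu : u ⊆ v
    · by_cases hjv : j ∈ v
      · rw [if_pos hu, if_pos (Finset.insert_subset hjv hu)]
        exact hasLineDeriv_avgOut hφ (by simpa using hjv) (hF.measurable _)
          (integrable_of_memLp_wMeasurePi hφ hq (hF.memLp _))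
          (integrable_of_memLp_wMeasurePi hφ hq (hF.memLp _)) (hF.lineDeriv u j hj)
      · rw [if_pos hu, if_neg fun h => hjv (h (Finset.mem_insert_self _ _))]
        intro h
        refine ae_of_all _ fun x => ?_
        simp only [avgOut, piecewise_add_single_of_mem (Finset.mem_compl.2 hjv), sub_self,
          intervalIntegral.integral_zero]
    · rw [if_neg hu, if_neg fun h => hu ((Finset.subset_insert _ _).trans h)]
      exact hasLineDeriv_zero j

theorem IsDerivFamily.sub_sum (hφ : IsAdmissibleDensity φ) (hq : 1 < q) {ι : Type*}
    {F : Finset (Fin s) → (Fin s → ℝ) → ℝ} (hF : IsDerivFamily φ q F) {S : Finset ι}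
    {H : ι → Finset (Fin s) → (Fin s → ℝ) → ℝ} (hH : ∀ i ∈ S, IsDerivFamily φ q (H i)) :
    IsDerivFamily φ q fun u x => F u x - ∑ i ∈ S, H i u x := by
  have hS : ∀ u, MemLp (fun x => ∑ i ∈ S, H i u x) (ENNReal.ofReal q) (wMeasurePi φ (Fin s)) :=
    fun u => memLp_finsetSum S fun i hi => (hH i hi).memLp u
  refine ⟨fun u => ?_, fun u => (hF.memLp u).sub (hS u), fun u j hj => ?_⟩
  · exact (hF.measurable u).sub (Finset.measurable_fun_sum S fun i hi => (hH i hi).measurable u)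
  · exact (hF.lineDeriv u j hj).sub (HasLineDeriv.sum (fun i hi => (hH i hi).lineDeriv u j hj)
      fun i hi => locallyIntegrable_of_memLp_wMeasurePi hφ hq ((hH i hi).memLp _))
      (locallyIntegrable_of_memLp_wMeasurePi hφ hq (hF.memLp _))
      (locallyIntegrable_of_memLp_wMeasurePi hφ hq (hS _))

end Lines

/-! ### ANOVA terms and their mixed derivatives -/

section Anova

variable {s : ℕ} {φ : ℝ → ℝ} {q : ℝ}

theorem anovaTerm_eq (φ : ℝ → ℝ) (f : (Fin s → ℝ) → ℝ) (v : Finset (Fin s)) (x : Fin s → ℝ) :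
    anovaTerm φ f v x = integrateOut φ vᶜ f x - ∑ w ∈ v.ssubsets, anovaTerm φ f w x := by
  rw [anovaTerm]
  congr 1
  exact Finset.sum_attach v.ssubsets fun w => anovaTerm φ f w x

theorem integrateOut_ae_eq_avgOut (hφ : IsAdmissibleDensity φ) {f g : (Fin s → ℝ) → ℝ}
    (hg : Measurable g) (h : g =ᵐ[volume] f) (J : Finset (Fin s)) :
    integrateOut φ J f =ᵐ[volume] avgOut φ J g := by
  rw [← integrateOut_eq_avgOut hφ J hg]
  exact integrateOut_congr_ae hφ J h.symm

/-- The ANOVA term `f_v` has a family of mixed derivatives; the top one is `P_{vᶜ} ∂^v f`. -/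
theorem exists_isDerivFamily_anovaTerm (hφ : IsAdmissibleDensity φ) (hq : 1 < q)
    {F : Finset (Fin s) → (Fin s → ℝ) → ℝ} (hF : IsDerivFamily φ q F) {f : (Fin s → ℝ) → ℝ}
    (hf : F ∅ =ᵐ[volume] f) (v : Finset (Fin s)) :
    ∃ H : Finset (Fin s) → (Fin s → ℝ) → ℝ, IsDerivFamily φ q H ∧
      H ∅ =ᵐ[volume] anovaTerm φ f v ∧ (∀ u, ¬u ⊆ v → H u = fun _ => 0) ∧
      H v = avgOut φ vᶜ (F v) := by
  induction v using Finset.strongInduction with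
  | H v ih =>
    choose! H hH hH0 hHu hHv using ih
    refine ⟨fun u x => (if u ⊆ v then avgOut φ vᶜ (F u) else fun _ => 0) x -
      ∑ w ∈ v.ssubsets, H w u x, ?_, ?_, fun u hu => ?_, ?_⟩
    · exact (hF.avgOut_compl hφ hq v).sub_sum hφ hq fun w hw => hH w (Finset.mem_ssubsets.1 hw)
    · have h1 : ∀ᵐ x, ∀ w ∈ v.ssubsets, H w ∅ x = anovaTerm φ f w x :=
        (Finset.eventually_all _).2 fun w hw => hH0 w (Finset.mem_ssubsets.1 hw)
      filter_upwards [h1, integrateOut_ae_eq_avgOut hφ (hF.measurable ∅) hf vᶜ] with x h1 h2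
      rw [anovaTerm_eq, h2, if_pos (Finset.empty_subset v), Finset.sum_congr rfl h1]
    · ext x
      beta_reduce
      rw [if_neg hu, Finset.sum_eq_zero, sub_zero]
      intro w hw
      rw [hHu w (Finset.mem_ssubsets.1 hw) u fun h => hu (h.trans (Finset.mem_ssubsets.1 hw).1)]
    -- The lower terms do not affect the derivative ∂^v: each depends on a set w that does not
    -- contain v, so its member at v is zero.
    · ext x
      beta_reduce
      rw [if_pos (Finset.Subset.refl v), Finset.sum_eq_zero, sub_zero]
      intro w hw
      rw [hHu w (Finset.mem_ssubsets.1 hw) v (Finset.mem_ssubsets.1 hw).2]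

theorem integral_rpow_weakMixedDeriv_le {f g : (Fin s → ℝ) → ℝ} (hφ : IsAdmissibleDensity φ)
    (hq : 1 < q) {v : Finset (Fin s)} (hg : IsWeakMixedDeriv v f g) :
    (∫ x, |g x| ^ q ∂wMeasurePi φ (Fin s)) ^ (1 / q) ≤ wMixNorm φ q f := by
  have hex : ∃ g, IsWeakMixedDeriv v f g := ⟨g, hg⟩
  have hwd : IsWeakMixedDeriv v f (weakMixedDeriv v f) := by
    rw [weakMixedDeriv, dif_pos hex]; exact hex.choose_spec
  have hae : g =ᵐ[wMeasurePi φ (Fin s)] weakMixedDeriv v f :=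
    (wMeasurePi_absolutelyContinuous hφ s).ae_eq (hg.ae_eq hwd)
  have heq : ∫ x, |g x| ^ q ∂wMeasurePi φ (Fin s) =
      ∫ x, |weakMixedDeriv v f x| ^ q ∂wMeasurePi φ (Fin s) := by
    refine integral_congr_ae ?_
    filter_upwards [hae] with x hx
    rw [hx]
  have hnn : ∀ v : Finset (Fin s), 0 ≤ ∫ x, |weakMixedDeriv v f x| ^ q ∂wMeasurePi φ (Fin s) :=
    fun v => integral_nonneg fun x => Real.rpow_nonneg (abs_nonneg _) _
  rw [heq, wMixNorm]
  refine Real.rpow_le_rpow (hnn v) ?_ (by positivity)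
  exact Finset.single_le_sum (f := fun v : Finset (Fin s) =>
    ∫ x, |weakMixedDeriv v f x| ^ q ∂wMeasurePi φ (Fin s)) (fun v _ => hnn v) (Finset.mem_univ v)

end Anova


/-! ### The one-dimensional representation by an anchor kernel -/

section Representation

variable {s : ℕ} {φ : ℝ → ℝ} {q q' : ℝ}

/-- Oriented endpoints are moved into the integrand, which gives joint measurability in the
endpoints and prepares Fubini. -/
theorem intervalIntegral_eq_integral_step (γ : ℝ → ℝ) (a b : ℝ) :
    ∫ t in a..b, γ t =
      ∫ t, γ t * ((if a < t then 1 else 0) - (if b < t then 1 else 0)) := by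
  have key : ∀ c d : ℝ, c ≤ d → ∫ t in c..d, γ t =
      ∫ t, γ t * ((if c < t then 1 else 0) - (if d < t then 1 else 0)) := by
    intro c d hcd
    rw [intervalIntegral.integral_of_le hcd, ← integral_indicator measurableSet_Ioc]
    refine integral_congr_ae (ae_of_all _ fun t => ?_)
    simp only [indicator, mem_Ioc]
    by_cases h1 : c < t <;> by_cases h2 : d < t
    · simp [h1, h2]
    · simp [h1, h2, not_lt.1 h2]
    · exact absurd (hcd.trans_lt h2) h1
    · simp [h1, h2]
  rcases le_total a b with h | h
  · exact key a b h
  · rw [intervalIntegral.integral_symm, key b a h, ← integral_neg]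
    refine integral_congr_ae (ae_of_all _ fun t => ?_)
    ring

theorem measurable_step : Measurable fun q : ℝ × ℝ => if q.1 < q.2 then (1 : ℝ) else 0 :=
  Measurable.ite (measurableSet_lt measurable_fst measurable_snd) measurable_const measurable_const

theorem add_sub_smul_single (x : Fin s → ℝ) (j : Fin s) (y : ℝ) :
    x + (y - x j) • Pi.single j (1 : ℝ) = Function.update x j y := by
  ext i
  by_cases h : i = j
  · subst h; simp
  · simp [h]

/-- On almost every line in direction `j`, the fundamental theorem of calculus holds. -/
theorem HasLineDeriv.ae_ae {j : Fin s} {f g : (Fin s → ℝ) → ℝ} (h : HasLineDeriv j f g)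
    (hf : Measurable f) (hg : Measurable g) :
    ∀ᵐ x, ∀ᵐ y : ℝ, f (Function.update x j y) - f x =
      ∫ t in x j..y, g (Function.update x j t) := by
  set e : Fin s → ℝ := Pi.single j 1 with he
  have hmeas : MeasurableSet {p : ℝ × (Fin s → ℝ) |
      f (p.2 + p.1 • e) - f p.2 = ∫ t in (0 : ℝ)..p.1, g (p.2 + t • e)} := by
    simp only [intervalIntegral_eq_integral_step]
    have hadd : Measurable fun p : ℝ × (Fin s → ℝ) => p.2 + p.1 • e := by fun_prop
    refine measurableSet_eq_fun ((hf.comp hadd).sub (hf.comp measurable_snd)) ?_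
    refine (StronglyMeasurable.integral_prod_right (f := fun (p : ℝ × (Fin s → ℝ)) (t : ℝ) =>
      g (p.2 + t • e) * ((if (0 : ℝ) < t then 1 else 0) - (if p.1 < t then 1 else 0)))
      (Measurable.stronglyMeasurable ?_)).measurable
    have h1 : Measurable fun p : (ℝ × (Fin s → ℝ)) × ℝ => g (p.1.2 + p.2 • e) :=
      hg.comp (by fun_prop)
    have h2 : Measurable fun p : (ℝ × (Fin s → ℝ)) × ℝ => if (0 : ℝ) < p.2 then (1 : ℝ) else 0 :=
      measurable_step.comp (measurable_const.prodMk measurable_snd)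
    have h3 : Measurable fun p : (ℝ × (Fin s → ℝ)) × ℝ => if p.1.1 < p.2 then (1 : ℝ) else 0 :=
      measurable_step.comp ((measurable_fst.comp measurable_fst).prodMk measurable_snd)
    exact h1.mul (h2.sub h3)
  -- The hypothesis holds for every increment and almost every x. Exchanging the quantifiers
  -- requires the measurability just shown.
  have h1 := (Measure.ae_ae_comm (μ := volume) (ν := volume) hmeas).1 (ae_of_all _ h)
  filter_upwards [h1] with x hx
  have h2 := (measurePreserving_sub_right volume (x j)).quasiMeasurePreserving.ae hx
  filter_upwards [h2] with y hy
  rw [add_sub_smul_single] at hy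
  rw [hy, ← sub_self (x j), ← intervalIntegral.integral_comp_sub_right]
  simp only [add_sub_smul_single]

/-- The kernel `r(a, z) = (Φ(z) - 1[a < z]) / φ(z)`. -/
def anchorKernel (φ : ℝ → ℝ) (a z : ℝ) : ℝ := (cdf φ z - if a < z then 1 else 0) / φ z

theorem measurable_anchorKernel (hφ : IsAdmissibleDensity φ) :
    Measurable fun q : ℝ × ℝ => anchorKernel φ q.1 q.2 :=
  (((measurable_cdf hφ).comp measurable_snd).sub measurable_step).div
    (hφ.measurable.comp measurable_snd)

/-- The numerator is Φ(z) for z ≤ a and −(1 − Φ(z)) for z > a. If this is not the smaller tail at z,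
the opposite tail is still at least `tailMin φ a`, by monotonicity. -/
theorem abs_anchorKernel_le (hφ : IsAdmissibleDensity φ) (a z : ℝ) :
    |anchorKernel φ a z| ≤ (tailMin φ a)⁻¹ * (tailMin φ z / φ z) := by
  have hz := hφ.pos z
  have ha := tailMin_pos hφ a
  have m := (strictMono_cdf hφ).monotone
  rw [anchorKernel, abs_div, abs_of_pos hz, ← mul_div_assoc]
  refine div_le_div_of_nonneg_right ?_ hz.le
  rw [inv_mul_eq_div, le_div_iff₀ ha]
  have h0 := cdf_pos hφ z
  have h1 := cdf_lt_one hφ z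
  split_ifs with h
  · rw [abs_of_neg (by linarith), neg_sub]
    refine le_min ?_ ?_
    · have := m h.le
      have h2 : tailMin φ a ≤ cdf φ z := (min_le_left _ _).trans this
      nlinarith [tailMin_le_half (φ := φ) a]
    · nlinarith [tailMin_le_half (φ := φ) a]
  · rw [sub_zero, abs_of_pos h0]
    refine le_min ?_ ?_
    · nlinarith [tailMin_le_half (φ := φ) a]
    · have := m (not_lt.1 h)
      have h2 : tailMin φ a ≤ 1 - cdf φ z := (min_le_right _ _).trans (by linarith)
      nlinarith [tailMin_le_half (φ := φ) a]

theorem memLp_anchorKernel (hφ : IsAdmissibleDensity φ) (hq : q.HolderConjugate q') (a : ℝ) :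
    MemLp (anchorKernel φ a) (ENNReal.ofReal q') (wMeasure φ) := by
  -- The exponent 1 is admissible because 1/q < 1.
  have h := (memLp_tailMin_rpow_div hφ hq (a := 1)
    ((div_lt_one hq.pos).2 hq.lt)).const_mul (tailMin φ a)⁻¹
  refine h.mono ((measurable_anchorKernel hφ).comp measurable_prodMk_left).aestronglyMeasurable
    (ae_of_all _ fun z => ?_)
  simp only [Real.rpow_one]
  exact (abs_anchorKernel_le hφ a z).trans (le_abs_self _)

theorem integrable_wMeasure_iff (hφ : IsAdmissibleDensity φ) {h : ℝ → ℝ} :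
    Integrable h (wMeasure φ) ↔ Integrable fun z => φ z * h z := by
  rw [wMeasure, integrable_withDensity_iff_integrable_smul' hφ.measurable.ennreal_ofReal
    (ae_of_all _ fun _ => ENNReal.ofReal_lt_top)]
  simp only [ENNReal.toReal_ofReal (hφ.pos _).le, smul_eq_mul]

theorem integral_wMeasure (hφ : IsAdmissibleDensity φ) (h : ℝ → ℝ) :
    ∫ z, h z ∂wMeasure φ = ∫ z, φ z * h z := by
  rw [wMeasure, integral_withDensity_eq_integral_toReal_smul hφ.measurable.ennreal_ofReal
    (ae_of_all _ fun _ => ENNReal.ofReal_lt_top)]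
  simp only [ENNReal.toReal_ofReal (hφ.pos _).le, smul_eq_mul]

theorem integral_step_wMeasure (hφ : IsAdmissibleDensity φ) (z : ℝ) :
    ∫ y, (if y < z then (1 : ℝ) else 0) ∂wMeasure φ = cdf φ z := by
  have : (fun y => if y < z then (1 : ℝ) else 0) = (Iio z).indicator 1 := by
    ext y; simp [indicator]
  rw [this, integral_indicator_one measurableSet_Iio, Measure.real,
    measure_congr (Iio_ae_eq_Iic' ?_), wMeasure_apply_Iic hφ, ENNReal.toReal_ofReal (cdf_pos hφ z).le]
  exact withDensity_absolutelyContinuous _ _ (by simp)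

theorem integrable_step_wMeasure (hφ : IsAdmissibleDensity φ) (z : ℝ) :
    Integrable (fun y => if y < z then (1 : ℝ) else 0) (wMeasure φ) := by
  have := isProbabilityMeasure_wMeasure hφ
  refine Integrable.of_bound
    (measurable_step.comp (measurable_id.prodMk measurable_const)).aestronglyMeasurable 1
    (ae_of_all _ fun y => ?_)
  change ‖if y < z then (1 : ℝ) else 0‖ ≤ 1
  split_ifs <;> simp

/-- One-dimensional representation: `F(x₀) = ∫ F φ + ∫ F'(z) r(x₀, z) φ(z) dz`. -/
theorem eq_integral_add_integral_anchorKernel (hφ : IsAdmissibleDensity φ) {F γ : ℝ → ℝ} {x₀ : ℝ}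
    (hγm : Measurable γ) (hF : Integrable F (wMeasure φ))
    (hγ : Integrable (fun z => γ z * anchorKernel φ x₀ z) (wMeasure φ))
    (h : ∀ᵐ y, F y - F x₀ = ∫ t in x₀..y, γ t) :
    F x₀ = ∫ y, F y ∂wMeasure φ + ∫ z, γ z * anchorKernel φ x₀ z ∂wMeasure φ := by
  have := isProbabilityMeasure_wMeasure hφ
  have hac : wMeasure φ ≪ volume := withDensity_absolutelyContinuous _ _
  have h1 : ∫ y, F y ∂wMeasure φ - F x₀ = ∫ y, F y - F x₀ ∂wMeasure φ := by
    rw [integral_sub hF (integrable_const _)]; simp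
  have hφk : ∀ z, φ z * (γ z * anchorKernel φ x₀ z) =
      -(γ z * ((if x₀ < z then 1 else 0) - cdf φ z)) := by
    intro z; have := (hφ.pos z).ne'; rw [anchorKernel]; field_simp; ring
  have hk : Integrable fun z => γ z * ((if x₀ < z then 1 else 0) - cdf φ z) := by
    have := (integrable_wMeasure_iff hφ).1 hγ
    simp only [hφk] at this
    simpa using this.neg
  have hstep : ∀ z, ∫ y, (if x₀ < z then (1 : ℝ) else 0) - (if y < z then 1 else 0) ∂wMeasure φ =
      (if x₀ < z then 1 else 0) - cdf φ z := by
    intro z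
    rw [integral_sub (integrable_const _) (integrable_step_wMeasure hφ z),
      integral_step_wMeasure hφ]
    simp
  -- For fixed z the difference of steps has constant sign in y, so absolute value and average over
  -- y commute. Absolute integrability for Fubini then reduces to the integrability already assumed.
  have hstepn : ∀ z, ∫ y, ‖γ z * ((if x₀ < z then (1 : ℝ) else 0) - (if y < z then 1 else 0))‖
      ∂wMeasure φ = ‖γ z * ((if x₀ < z then 1 else 0) - cdf φ z)‖ := by
    intro z
    simp only [norm_mul, integral_const_mul]
    congr 1
    rw [← hstep z]
    by_cases hz : x₀ < z
    · simp only [hz, if_true]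
      have h0 : ∀ y, 0 ≤ (1 : ℝ) - (if y < z then 1 else 0) := fun y => by split_ifs <;> simp
      have hI := integral_nonneg_of_ae (μ := wMeasure φ) (ae_of_all _ h0)
      simp only [Real.norm_eq_abs, abs_of_nonneg (h0 _), abs_of_nonneg hI]
    · simp only [hz, if_false]
      have h0 : ∀ y, (0 : ℝ) - (if y < z then 1 else 0) ≤ 0 := fun y => by split_ifs <;> simp
      have hI := integral_nonpos (μ := wMeasure φ) h0
      simp only [Real.norm_eq_abs, abs_of_nonpos (h0 _), abs_of_nonpos hI, integral_neg]
  have hmeas : Measurable fun p : ℝ × ℝ =>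
      γ p.2 * ((if x₀ < p.2 then (1 : ℝ) else 0) - (if p.1 < p.2 then 1 else 0)) := by
    have m1 : Measurable fun p : ℝ × ℝ => if x₀ < p.2 then (1 : ℝ) else 0 :=
      measurable_step.comp (measurable_const.prodMk measurable_snd)
    have m2 : Measurable fun p : ℝ × ℝ => if p.1 < p.2 then (1 : ℝ) else 0 := measurable_step
    exact (hγm.comp measurable_snd).mul (m1.sub m2)
  have hint : Integrable (fun p : ℝ × ℝ =>
      γ p.2 * ((if x₀ < p.2 then (1 : ℝ) else 0) - (if p.1 < p.2 then 1 else 0)))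
      ((wMeasure φ).prod volume) := by
    rw [integrable_prod_iff' hmeas.aestronglyMeasurable]
    refine ⟨ae_of_all _ fun z => ?_, ?_⟩
    · have i1 : Integrable (fun _ : ℝ => if x₀ < z then (1 : ℝ) else 0) (wMeasure φ) :=
        integrable_const _
      exact (i1.sub (integrable_step_wMeasure hφ z)).const_mul (γ z)
    · simp only [hstepn]
      exact hk.norm
  have h2 : ∫ y, F y - F x₀ ∂wMeasure φ = ∫ y, (∫ t,
      γ t * ((if x₀ < t then 1 else 0) - (if y < t then 1 else 0))) ∂wMeasure φ := by
    refine integral_congr_ae (hac.ae_le ?_)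
    filter_upwards [h] with y hy
    rw [hy, intervalIntegral_eq_integral_step]
  rw [integral_integral_swap hint] at h2
  simp only [integral_const_mul, hstep] at h2
  rw [integral_wMeasure hφ (fun z => γ z * anchorKernel φ x₀ z)]
  simp only [hφk, integral_neg]
  linarith

theorem MemLp.ae_prod_mk {α β : Type*} [MeasurableSpace α] [MeasurableSpace β] {μ : Measure α}
    {ν : Measure β} [SFinite μ] [SFinite ν] {f : α × β → ℝ} {p : ℝ} (hp : 0 < p)
    (hf : MemLp f (ENNReal.ofReal p) (μ.prod ν)) :
    ∀ᵐ x ∂μ, MemLp (fun y => f (x, y)) (ENNReal.ofReal p) ν := by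
  have hp' : ENNReal.ofReal p ≠ 0 := by simpa using hp
  have h1 := (integrable_norm_rpow_iff hf.aestronglyMeasurable hp' ENNReal.ofReal_ne_top).2 hf
  filter_upwards [h1.prod_right_ae, hf.aestronglyMeasurable.prodMk_left] with x hx hxm
  exact (integrable_norm_rpow_iff hxm hp' ENNReal.ofReal_ne_top).1 hx

theorem memLp_fintype_prod {ι : Type*} [Fintype ι] {α : ι → Type*} [∀ i, MeasurableSpace (α i)]
    {μ : ∀ i, Measure (α i)} [∀ i, SigmaFinite (μ i)] {p : ℝ} (hp : 0 < p) {h : ∀ i, α i → ℝ}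
    (hh : ∀ i, MemLp (h i) (ENNReal.ofReal p) (μ i)) :
    MemLp (fun z : ∀ i, α i => ∏ i, h i (z i)) (ENNReal.ofReal p) (Measure.pi μ) := by
  have hp' : ENNReal.ofReal p ≠ 0 := by simpa using hp
  have hm : AEStronglyMeasurable (fun z : ∀ i, α i => ∏ i, h i (z i)) (Measure.pi μ) :=
    Finset.aestronglyMeasurable_fun_prod _ fun i _ =>
      (hh i).aestronglyMeasurable.comp_quasiMeasurePreserving (Measure.quasiMeasurePreserving_eval _ i)
  refine (integrable_norm_rpow_iff hm hp' ENNReal.ofReal_ne_top).1 ?_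
  have h2 := Integrable.fintype_prod_dep fun i => (integrable_norm_rpow_iff (hh i).aestronglyMeasurable
    hp' ENNReal.ofReal_ne_top).2 (hh i)
  refine h2.congr (ae_of_all _ fun z => ?_)
  simp only [norm_prod]
  exact Real.finsetProd_rpow _ _ (fun i _ => norm_nonneg (h i (z i))) _

end Representation


/-! ### Iterating the representation over all coordinates -/

section Decomposition

variable {s : ℕ} {φ : ℝ → ℝ} {q q' : ℝ}

/-- The product `∏_{i ∈ v} r(x_i, z_i)`. -/
def anchorProd (φ : ℝ → ℝ) (v : Finset (Fin s)) (x z : Fin s → ℝ) : ℝ :=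
  ∏ i ∈ v, anchorKernel φ (x i) (z i)

theorem memLp_anchorProd (hφ : IsAdmissibleDensity φ) (hq : q.HolderConjugate q')
    (v : Finset (Fin s)) (x : Fin s → ℝ) :
    MemLp (anchorProd φ v x) (ENNReal.ofReal q') (wMeasurePi φ (Fin s)) := by
  have := isProbabilityMeasure_wMeasure hφ
  have h := memLp_fintype_prod (μ := fun _ : Fin s => wMeasure φ) hq.symm.pos
    (h := fun i z => if i ∈ v then anchorKernel φ (x i) z else 1) fun i => by
      by_cases hi : i ∈ v
      · simpa only [hi, if_true] using memLp_anchorKernel hφ hq (x i)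
      · simpa only [hi, if_false] using memLp_const 1
  refine (memLp_congr_ae (ae_of_all _ fun z => ?_)).1 h
  simp only [anchorProd, Finset.prod_ite_mem, Finset.univ_inter]

theorem integrable_mul_anchorProd (hφ : IsAdmissibleDensity φ) (hq : q.HolderConjugate q')
    {g : (Fin s → ℝ) → ℝ} (hg : MemLp g (ENNReal.ofReal q) (wMeasurePi φ (Fin s)))
    (v : Finset (Fin s)) (x : Fin s → ℝ) :
    Integrable (fun z => g z * anchorProd φ v x z) (wMeasurePi φ (Fin s)) := by
  have : ENNReal.HolderConjugate (ENNReal.ofReal q) (ENNReal.ofReal q') :=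
    hq.ennrealOfReal
  exact hg.integrable_mul (memLp_anchorProd hφ hq v x)

theorem ae_memLp_piecewise (hφ : IsAdmissibleDensity φ) (hq : 0 < q)
    {g : (Fin s → ℝ) → ℝ} (hg : MemLp g (ENNReal.ofReal q) (wMeasurePi φ (Fin s)))
    (J : Finset (Fin s)) :
    ∀ᵐ x, MemLp (fun z => g (J.piecewise z x)) (ENNReal.ofReal q) (wMeasurePi φ (Fin s)) := by
  have := isProbabilityMeasure_wMeasurePi hφ (Fin s)
  rw [← ae_wMeasurePi hφ]
  exact MemLp.ae_prod_mk hq (hg.comp_measurePreserving (measurePreserving_piecewise hφ J))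

theorem ae_memLp_update (hφ : IsAdmissibleDensity φ) (hq : 0 < q)
    {g : (Fin s → ℝ) → ℝ} (hg : MemLp g (ENNReal.ofReal q) (wMeasurePi φ (Fin s)))
    (j : Fin s) :
    ∀ᵐ x, MemLp (fun y => g (Function.update x j y)) (ENNReal.ofReal q) (wMeasure φ) := by
  have := isProbabilityMeasure_wMeasurePi hφ (Fin s)
  have := isProbabilityMeasure_wMeasure hφ
  rw [← ae_wMeasurePi hφ]
  exact MemLp.ae_prod_mk hq (hg.comp_measurePreserving (measurePreserving_update hφ j))

theorem HasLineDeriv.ae_eq_integral (hφ : IsAdmissibleDensity φ) (hq : q.HolderConjugate q')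
    {j : Fin s} {f g : (Fin s → ℝ) → ℝ} (h : HasLineDeriv j f g)
    (hf : Measurable f) (hg : Measurable g)
    (hfL : MemLp f (ENNReal.ofReal q) (wMeasurePi φ (Fin s)))
    (hgL : MemLp g (ENNReal.ofReal q) (wMeasurePi φ (Fin s))) :
    ∀ᵐ x, f x = ∫ y, f (Function.update x j y) ∂wMeasure φ +
      ∫ y, g (Function.update x j y) * anchorKernel φ (x j) y ∂wMeasure φ := by
  have := isProbabilityMeasure_wMeasure hφ
  have hconj : ENNReal.HolderConjugate (ENNReal.ofReal q) (ENNReal.ofReal q') :=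
    hq.ennrealOfReal
  filter_upwards [h.ae_ae hf hg, ae_memLp_update hφ hq.pos hfL j, ae_memLp_update hφ hq.pos hgL j]
    with x h1 h2 h3
  have h4 := eq_integral_add_integral_anchorKernel hφ
    (F := fun y => f (Function.update x j y)) (γ := fun y => g (Function.update x j y)) (x₀ := x j)
    (hg.comp ((measurable_update_pair j).comp measurable_prodMk_left))
    (h2.integrable (by simpa using hq.lt.le))
    (h3.integrable_mul (memLp_anchorKernel hφ hq (x j)))
    (by simpa only [Function.update_eq_self] using h1)
  simpa only [Function.update_eq_self] using h4

theorem piecewise_insert_update (J : Finset (Fin s)) (j : Fin s) (z x : Fin s → ℝ) (y : ℝ) :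
    Function.update (J.piecewise z x) j y =
      (insert j J).piecewise (Function.update z j y) x := by
  ext i
  by_cases h : i = j
  · subst h; simp
  · by_cases hi : i ∈ J <;> simp [h, hi]

theorem integral_update (hφ : IsAdmissibleDensity φ) (j : Fin s) {A : (Fin s → ℝ) → ℝ}
    (hA : Integrable A (wMeasurePi φ (Fin s))) :
    Integrable (fun z => ∫ y, A (Function.update z j y) ∂wMeasure φ) (wMeasurePi φ (Fin s)) ∧
      ∫ z, (∫ y, A (Function.update z j y) ∂wMeasure φ) ∂wMeasurePi φ (Fin s) =
        ∫ z, A z ∂wMeasurePi φ (Fin s) := by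
  have := isProbabilityMeasure_wMeasurePi hφ (Fin s)
  have := isProbabilityMeasure_wMeasure hφ
  have hMP := measurePreserving_update hφ j
  have hI := hMP.integrable_comp_of_integrable hA
  refine ⟨hI.integral_prod_left, ?_⟩
  refine (integral_prod _ hI).symm.trans ?_
  simp only [Function.comp]
  conv_rhs => rw [← hMP.map_eq]
  rw [integral_map hMP.measurable.aemeasurable
    (by rw [hMP.map_eq]; exact hA.aestronglyMeasurable)]

/-- The coordinates in `J` are integrated out against `∏_{i ∈ v} r(x_i, z_i)`. -/
def anchorOut (φ : ℝ → ℝ) (J v : Finset (Fin s)) (g : (Fin s → ℝ) → ℝ) (x : Fin s → ℝ) : ℝ :=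
  ∫ z, g (J.piecewise z x) * anchorProd φ v x z ∂wMeasurePi φ (Fin s)

/-- The one-dimensional representation in coordinate j, used under the integral: the mean keeps v,
and the kernel term adds j to v and replaces f by its j-derivative. -/
theorem anchorOut_insert (hφ : IsAdmissibleDensity φ) (hq : q.HolderConjugate q')
    {j : Fin s} {f g : (Fin s → ℝ) → ℝ} (h : HasLineDeriv j f g)
    (hf : Measurable f) (hg : Measurable g)
    (hfL : MemLp f (ENNReal.ofReal q) (wMeasurePi φ (Fin s)))
    (hgL : MemLp g (ENNReal.ofReal q) (wMeasurePi φ (Fin s)))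
    {J v : Finset (Fin s)} (hj : j ∉ J) (hv : v ⊆ J) :
    ∀ᵐ x, anchorOut φ J v f x =
      anchorOut φ (insert j J) v f x + anchorOut φ (insert j J) (insert j v) g x := by
  have hjv : j ∉ v := fun h => hj (hv h)
  filter_upwards [ae_ae_piecewise hφ J (h.ae_eq_integral hφ hq hf hg hfL hgL),
    ae_memLp_piecewise hφ hq.pos hfL (insert j J), ae_memLp_piecewise hφ hq.pos hgL (insert j J)]
    with x h1 h2 h3
  obtain ⟨iA, eA⟩ := integral_update hφ j (integrable_mul_anchorProd hφ hq h2 v x)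
  obtain ⟨iB, eB⟩ := integral_update hφ j (integrable_mul_anchorProd hφ hq h3 (insert j v) x)
  simp only [anchorOut]
  rw [← eA, ← eB, ← integral_add iA iB]
  refine integral_congr_ae ?_
  filter_upwards [h1] with z hz
  have e0 : J.piecewise z x j = x j := by simp [hj]
  have e1 : ∀ y, anchorProd φ v x (Function.update z j y) = anchorProd φ v x z := fun y =>
    Finset.prod_congr rfl fun i hi => by
      rw [Function.update_of_ne fun h : i = j => hjv (h ▸ hi)]
  have e2 : ∀ y, anchorProd φ (insert j v) x (Function.update z j y) =
      anchorKernel φ (x j) y * anchorProd φ v x z := fun y => by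
    rw [anchorProd, Finset.prod_insert hjv, ← anchorProd, e1, Function.update_self]
  rw [hz, e0]
  simp only [piecewise_insert_update, e1, e2, ← mul_assoc]
  rw [integral_mul_const, integral_mul_const]
  ring

/-- Treating one more coordinate j splits each v ⊆ J into v and v ∪ {j}, which together run through
the subsets of J ∪ {j}. -/
theorem ae_eq_sum_anchorOut (hφ : IsAdmissibleDensity φ) (hq : q.HolderConjugate q')
    {F : Finset (Fin s) → (Fin s → ℝ) → ℝ} (hF : IsDerivFamily φ q F) (J : Finset (Fin s)) :
    ∀ᵐ x, F ∅ x = ∑ v ∈ J.powerset, anchorOut φ J v (F v) x := by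
  induction J using Finset.induction_on with
  | empty =>
    have := isProbabilityMeasure_wMeasurePi hφ (Fin s)
    refine ae_of_all _ fun x => ?_
    simp [anchorOut, anchorProd]
  | insert j J hj ih =>
    have h1 : ∀ᵐ x, ∀ v ∈ J.powerset, anchorOut φ J v (F v) x =
        anchorOut φ (insert j J) v (F v) x +
          anchorOut φ (insert j J) (insert j v) (F (insert j v)) x := by
      refine (Finset.eventually_all _).2 fun v hv => ?_
      have hvJ := Finset.mem_powerset.1 hv
      exact anchorOut_insert hφ hq (hF.lineDeriv v j fun h => hj (hvJ h)) (hF.measurable _)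
        (hF.measurable _) (hF.memLp _) (hF.memLp _) hj hvJ
    filter_upwards [ih, h1] with x h2 h3
    rw [h2, Finset.sum_powerset_insert hj, Finset.sum_congr rfl h3, Finset.sum_add_distrib]

/-- The kernel involves only the coordinates in v, so the others can be averaged first. For g = ∂^v
f this leaves P_{vᶜ} ∂^v f, the top derivative of the ANOVA term f_v. -/
theorem anchorOut_univ (hφ : IsAdmissibleDensity φ) (hq : q.HolderConjugate q')
    {g : (Fin s → ℝ) → ℝ}
    (hgL : MemLp g (ENNReal.ofReal q) (wMeasurePi φ (Fin s))) (v : Finset (Fin s))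
    (x : Fin s → ℝ) :
    anchorOut φ Finset.univ v g x =
      ∫ z, avgOut φ vᶜ g z * anchorProd φ v x z ∂wMeasurePi φ (Fin s) := by
  have := isProbabilityMeasure_wMeasurePi hφ (Fin s)
  have hMP := measurePreserving_piecewise hφ (vᶜ : Finset (Fin s))
  have hA := integrable_mul_anchorProd hφ hq hgL v x
  have hI := hMP.integrable_comp_of_integrable hA
  simp only [anchorOut, Finset.piecewise_univ]
  conv_lhs => rw [← hMP.map_eq]
  rw [integral_map hMP.measurable.aemeasurable
    (by rw [hMP.map_eq]; exact hA.aestronglyMeasurable)]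
  refine (integral_prod _ hI).trans ?_
  refine integral_congr_ae (ae_of_all _ fun z => ?_)
  have e1 : ∀ y, anchorProd φ v x ((vᶜ : Finset (Fin s)).piecewise y z) = anchorProd φ v x z :=
    fun y => Finset.prod_congr rfl fun i hi => by
      rw [Finset.piecewise_eq_of_notMem _ _ _ (by simpa using hi)]
  simp only [e1, avgOut, Function.comp]
  rw [integral_mul_const]

/-- The representation of a function by the integrated mixed derivatives of its ANOVA terms. -/
theorem MemWMix.exists_representation (hφ : IsAdmissibleDensity φ) (hq : q.HolderConjugate q')
    {f : (Fin s → ℝ) → ℝ} (hf : MemWMix φ q f) :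
    (∀ v, MemWMix φ q (anovaTerm φ f v)) ∧
      ∃ G : Finset (Fin s) → (Fin s → ℝ) → ℝ, (∀ v, Measurable (G v)) ∧
        (∀ v, MemLp (G v) (ENNReal.ofReal q) (wMeasurePi φ (Fin s))) ∧
        (∀ v, (∫ x, |G v x| ^ q ∂wMeasurePi φ (Fin s)) ^ (1 / q) ≤
          wMixNorm φ q (anovaTerm φ f v)) ∧
        ∀ᵐ x ∂wMeasurePi φ (Fin s), f x =
          ∑ v, ∫ z, G v z * anchorProd φ v x z ∂wMeasurePi φ (Fin s) := by
  obtain ⟨F, hF, hFf⟩ := hf.exists_isDerivFamily hφ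
  choose H hH hH0 _ hHv using exists_isDerivFamily_anovaTerm hφ hq.lt hF hFf
  refine ⟨fun v => (hH v).memWMix hφ hq.lt (hH0 v), fun v => avgOut φ vᶜ (F v),
    fun v => measurable_avgOut hφ _ (hF.measurable v),
    fun v => memLp_avgOut hφ hq.lt _ (hF.measurable v) (hF.memLp v), fun v => ?_, ?_⟩
  · have h1 := ((hH v).isWeakMixedDeriv hφ hq.lt v).congr_left (hH0 v)
    rw [hHv v] at h1
    exact integral_rpow_weakMixedDeriv_le hφ hq.lt h1
  · rw [ae_wMeasurePi hφ]
    filter_upwards [hFf, ae_eq_sum_anchorOut hφ hq hF Finset.univ] with x h1 h2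
    rw [← h1, h2, Finset.powerset_univ]
    exact Finset.sum_congr rfl fun v _ => anchorOut_univ hφ hq (hF.memLp v) v x

end Decomposition


/-! ### Transport of the representation to the unit cube -/

section WeightedRepresentation

variable {s : ℕ} {φ : ℝ → ℝ} {p q q' : ℝ} {θ : Fin s → ℝ}

/-- The uniform distribution on the unit cube. -/
def cubeMeasure (s : ℕ) : Measure (Fin s → ℝ) := Measure.pi fun _ => volume.restrict (Ioo (0 : ℝ) 1)

theorem restrict_unitCube (s : ℕ) :
    (volume : Measure (Fin s → ℝ)).restrict (unitCube s) = cubeMeasure s :=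
  Measure.restrict_pi_pi (fun _ => volume) fun _ => Ioo 0 1

theorem isProbabilityMeasure_restrict_Ioo :
    IsProbabilityMeasure ((volume : Measure ℝ).restrict (Ioo 0 1)) := ⟨by simp⟩

theorem isProbabilityMeasure_cubeMeasure (s : ℕ) : IsProbabilityMeasure (cubeMeasure s) := by
  have := isProbabilityMeasure_restrict_Ioo
  rw [cubeMeasure]; infer_instance

theorem ae_mem_unitCube (s : ℕ) : ∀ᵐ u ∂cubeMeasure s, ∀ j, u j ∈ Ioo (0 : ℝ) 1 := by
  rw [← restrict_unitCube]
  have hm : MeasurableSet (unitCube s) := MeasurableSet.univ_pi fun _ => measurableSet_Ioo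
  filter_upwards [ae_restrict_mem hm] with u hu j
  exact hu j (mem_univ j)

/-- The coordinatewise transport maps ∏ w(u_j) du to ∏ φ(x_j) dx, and positivity of the weights
makes the uniform measure absolutely continuous with respect to the former. -/
theorem ae_cubeMeasure_transport (hφ : IsAdmissibleDensity φ) (hp : 1 ≤ p)
    (hθ : ∀ j, 0 < θ j ∧ θ j ≤ 1 / 2) {P : (Fin s → ℝ) → Prop}
    (h : ∀ᵐ x ∂wMeasurePi φ (Fin s), P x) :
    ∀ᵐ u ∂cubeMeasure s, P fun j => transport φ p (θ j) (u j) := by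
  have hW : ∀ j, IsProbabilityMeasure (weightMeasure p (θ j)) :=
    fun j => ⟨weightMeasure_univ hp (hθ j).1 (hθ j).2⟩
  have hT : ∀ j, AEMeasurable (transport φ p (θ j)) (weightMeasure p (θ j)) := fun j =>
    (aemeasurable_transport hφ hp (hθ j).1 (hθ j).2).mono_ac (withDensity_absolutelyContinuous _ _)
  have hT' : AEMeasurable (fun u : Fin s → ℝ => fun j => transport φ p (θ j) (u j))
      (Measure.pi fun j => weightMeasure p (θ j)) :=
    aemeasurable_pi_iff.2 fun j =>
      (hT j).comp_quasiMeasurePreserving (Measure.quasiMeasurePreserving_eval _ j)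
  have hmap : (Measure.pi fun j => weightMeasure p (θ j)).map
      (fun u : Fin s → ℝ => fun j => transport φ p (θ j) (u j)) = wMeasurePi φ (Fin s) := by
    have : ∀ j, SigmaFinite ((weightMeasure p (θ j)).map (transport φ p (θ j))) := fun j =>
      have := Measure.isProbabilityMeasure_map (hT j); inferInstance
    rw [Measure.pi_map_pi hT, wMeasurePi]
    congr 1
    funext j
    exact map_transport_weightMeasure hφ hp (hθ j).1 (hθ j).2
  have hac : cubeMeasure s ≪ Measure.pi fun j => weightMeasure p (θ j) := by
    simp only [weightMeasure]
    rw [pi_withDensity_ofReal (fun _ => volume.restrict (Ioo (0 : ℝ) 1))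
      (fun j => integrableOn_weight hp (hθ j).1 (hθ j).2) fun j => ?_]
    · refine withDensity_absolutelyContinuous' (Measurable.aemeasurable ?_) ?_
      · exact (Finset.measurable_fun_prod _ fun j _ =>
          (measurable_weight p (θ j)).comp (measurable_pi_apply j)).ennreal_ofReal
      · filter_upwards [ae_mem_unitCube s] with u hu
        simpa using Finset.prod_pos fun j _ => weight_pos hp (hθ j).1 (hθ j).2 (hu j)
    · filter_upwards [ae_restrict_mem measurableSet_Ioo] with u hu
      exact (weight_pos hp (hθ j).1 (hθ j).2 hu).le
  rw [← hmap] at h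
  exact hac.ae_le (ae_of_ae_map hT' h)

/-- The `j`-th factor of the kernel representing `f^w`. -/
def coordKernel (φ : ℝ → ℝ) (p : ℝ) (θ : Fin s → ℝ) (v : Finset (Fin s)) (j : Fin s)
    (z u : ℝ) : ℝ :=
  if j ∈ v then (φ z)⁻¹ * weightKernel p (θ j) (cdf φ z) u else weight p (θ j) u

/-- The kernel representing the part of `f^w` that comes from the ANOVA term `f_v`. -/
def prodKernel (φ : ℝ → ℝ) (p : ℝ) (θ : Fin s → ℝ) (v : Finset (Fin s)) (z u : Fin s → ℝ) : ℝ :=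
  ∏ j, coordKernel φ p θ v j (z j) (u j)

theorem cdf_mem_Ioo (hφ : IsAdmissibleDensity φ) (z : ℝ) : cdf φ z ∈ Ioo (0 : ℝ) 1 :=
  ⟨cdf_pos hφ z, cdf_lt_one hφ z⟩

theorem measurable_coordKernel (hφ : IsAdmissibleDensity φ) (hp : 1 ≤ p)
    (hθ : ∀ j, 0 < θ j ∧ θ j ≤ 1 / 2) (v : Finset (Fin s)) (j : Fin s) :
    Measurable fun q : ℝ × ℝ => coordKernel φ p θ v j q.1 q.2 := by
  unfold coordKernel
  split_ifs
  · refine (hφ.measurable.comp measurable_fst).inv.mul ?_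
    exact (measurable_weightKernel hp (hθ j).1 (hθ j).2).comp
      (((measurable_cdf hφ).comp measurable_fst).prodMk measurable_snd)
  · exact (measurable_weight p (θ j)).comp measurable_snd

theorem measurable_prodKernel (hφ : IsAdmissibleDensity φ) (hp : 1 ≤ p)
    (hθ : ∀ j, 0 < θ j ∧ θ j ≤ 1 / 2) (v : Finset (Fin s)) :
    Measurable fun q : (Fin s → ℝ) × (Fin s → ℝ) => prodKernel φ p θ v q.1 q.2 := by
  refine Finset.measurable_fun_prod _ fun j _ => ?_
  have h : Measurable fun q : (Fin s → ℝ) × (Fin s → ℝ) => (q.1 j, q.2 j) := by fun_prop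
  exact (measurable_coordKernel hφ hp hθ v j).comp h

/-- T(u) < z is equivalent to W(u) < Φ(z), so in u the kernel depends on z only through the level t
= Φ(z) and the prefactor 1/φ(z). -/
theorem weight_mul_anchorKernel (hφ : IsAdmissibleDensity φ) (hp : 1 ≤ p) {θ : ℝ} (h0 : 0 < θ)
    (h1 : θ ≤ 1 / 2) {u : ℝ} (hu : u ∈ Ioo (0 : ℝ) 1) (z : ℝ) :
    weight p θ u * anchorKernel φ (transport φ p θ u) z =
      (φ z)⁻¹ * weightKernel p θ (cdf φ z) u := by
  have : transport φ p θ u < z ↔ weightCdf p θ u < cdf φ z := by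
    rw [← cdf_transport hφ hp h0 h1 hu, (strictMono_cdf hφ).lt_iff_lt]
  simp only [anchorKernel, weightKernel, clamp_eq hu, this]
  ring

theorem ae_weightedIntegrand_eq (hφ : IsAdmissibleDensity φ) (hp : 1 ≤ p)
    (hθ : ∀ j, 0 < θ j ∧ θ j ≤ 1 / 2) {f : (Fin s → ℝ) → ℝ}
    {G : Finset (Fin s) → (Fin s → ℝ) → ℝ}
    (h : ∀ᵐ x ∂wMeasurePi φ (Fin s), f x =
      ∑ v, ∫ z, G v z * anchorProd φ v x z ∂wMeasurePi φ (Fin s)) :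
    ∀ᵐ u ∂cubeMeasure s, weightedIntegrand φ p θ f u =
      ∑ v, ∫ z, G v z * prodKernel φ p θ v z u ∂wMeasurePi φ (Fin s) := by
  filter_upwards [ae_cubeMeasure_transport hφ hp hθ h, ae_mem_unitCube s] with u h1 hu
  rw [weightedIntegrand, h1, Finset.mul_sum]
  refine Finset.sum_congr rfl fun v _ => ?_
  rw [← integral_const_mul]
  refine integral_congr_ae (ae_of_all _ fun z => ?_)
  have e : prodKernel φ p θ v z u = (∏ j, weight p (θ j) (u j)) *
      anchorProd φ v (fun j => transport φ p (θ j) (u j)) z := by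
    rw [prodKernel, anchorProd, ← Finset.univ_inter v, ← Finset.prod_ite_mem,
      ← Finset.prod_mul_distrib]
    refine Finset.prod_congr rfl fun j _ => ?_
    rw [Finset.univ_inter, coordKernel]
    split_ifs
    · rw [weight_mul_anchorKernel hφ hp (hθ j).1 (hθ j).2 (hu j)]
    · rw [mul_one]
  simp only [e]
  ring

end WeightedRepresentation

/-! ### Minkowski's integral inequality for squares -/

section Minkowski

open scoped ENNReal

/-- Write the square as a double integral over (z, z'), exchange with u, and apply Cauchy–Schwarz in
u for each pair. -/
theorem lintegral_sq_lintegral_le {Z U : Type*} [MeasurableSpace Z] [MeasurableSpace U]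
    {μ : Measure Z} {ν : Measure U} [SFinite μ] [SFinite ν] {K : Z → U → ℝ≥0∞}
    (hK : Measurable fun q : Z × U => K q.1 q.2) {D : Z → ℝ≥0∞} (hD : Measurable D)
    (h : ∀ z, ∫⁻ u, K z u ^ 2 ∂ν ≤ D z ^ 2) :
    ∫⁻ u, (∫⁻ z, K z u ∂μ) ^ 2 ∂ν ≤ (∫⁻ z, D z ∂μ) ^ 2 := by
  have hKu : ∀ u, Measurable fun z => K z u := fun u => hK.comp measurable_prodMk_right
  have hKz : ∀ z, Measurable fun u => K z u := fun z => hK.comp measurable_prodMk_left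
  have hsqrt : ∀ z, (∫⁻ u, K z u ^ (2 : ℝ) ∂ν) ^ (1 / 2 : ℝ) ≤ D z := fun z => by
    simp only [ENNReal.rpow_two]
    refine (ENNReal.rpow_le_rpow (h z) (by norm_num)).trans (le_of_eq ?_)
    rw [← ENNReal.rpow_two, ← ENNReal.rpow_mul]; norm_num
  have hCS : ∀ z z', ∫⁻ u, K z u * K z' u ∂ν ≤ D z * D z' := fun z z' =>
    (ENNReal.lintegral_mul_le_Lp_mul_Lq ν Real.HolderConjugate.two_two (hKz z).aemeasurable
      (hKz z').aemeasurable).trans (mul_le_mul' (hsqrt z) (hsqrt z'))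
  have e1 : ∀ u, (∫⁻ z, K z u ∂μ) ^ 2 = ∫⁻ z, ∫⁻ z', K z u * K z' u ∂μ ∂μ := fun u => by
    simp only [lintegral_const_mul _ (hKu u)]
    rw [lintegral_mul_const _ (hKu u), sq]
  have hm3 : Measurable fun q : (U × Z) × Z => K q.1.2 q.1.1 * K q.2 q.1.1 := by
    have a : Measurable fun q : (U × Z) × Z => (q.1.2, q.1.1) := by fun_prop
    have b : Measurable fun q : (U × Z) × Z => (q.2, q.1.1) := by fun_prop
    exact (hK.comp a).mul (hK.comp b)
  have hm2 : Measurable fun q : U × Z => ∫⁻ z', K q.2 q.1 * K z' q.1 ∂μ := hm3.lintegral_prod_right'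
  simp only [e1]
  rw [lintegral_lintegral_swap hm2.aemeasurable]
  calc ∫⁻ z, ∫⁻ u, ∫⁻ z', K z u * K z' u ∂μ ∂ν ∂μ
      ≤ ∫⁻ z, ∫⁻ z', D z * D z' ∂μ ∂μ := by
        refine lintegral_mono fun z => ?_
        have hm : Measurable fun q : U × Z => K z q.1 * K q.2 q.1 :=
          ((hKz z).comp measurable_fst).mul (hK.comp measurable_swap)
        rw [lintegral_lintegral_swap hm.aemeasurable]
        exact lintegral_mono fun z' => hCS z z'
    _ = (∫⁻ z, D z ∂μ) ^ 2 := by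
        simp only [lintegral_const_mul _ hD]
        rw [lintegral_mul_const _ hD, sq]

/-- Duality with the vector itself: for x_i = ∫ A_i and X = ∑ x_i², Cauchy–Schwarz under the
integral gives X ≤ √X ∫ B, and √X cancels. -/
theorem sum_sq_integral_le {Z ι : Type*} [MeasurableSpace Z] {μ : Measure Z} (S : Finset ι)
    {A : ι → Z → ℝ} (hA : ∀ i ∈ S, Integrable (A i) μ) {B : Z → ℝ} (hB : Integrable B μ)
    (hB0 : ∀ z, 0 ≤ B z) (h : ∀ z, ∑ i ∈ S, A i z ^ 2 ≤ B z ^ 2) :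
    ∑ i ∈ S, (∫ z, A i z ∂μ) ^ 2 ≤ (∫ z, B z ∂μ) ^ 2 := by
  set x : ι → ℝ := fun i => ∫ z, A i z ∂μ
  set X := ∑ i ∈ S, x i ^ 2 with hX
  have hX0 : 0 ≤ X := Finset.sum_nonneg fun _ _ => sq_nonneg _
  have hI0 : 0 ≤ ∫ z, B z ∂μ := integral_nonneg hB0
  have h1 : X ≤ √X * ∫ z, B z ∂μ := by
    calc X = ∫ z, ∑ i ∈ S, x i * A i z ∂μ := by
          rw [integral_finsetSum _ fun i hi => (hA i hi).const_mul _]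
          simp only [integral_const_mul, hX, sq, x]
      _ ≤ ∫ z, √X * B z ∂μ := by
          refine integral_mono (integrable_finsetSum _ fun i hi => (hA i hi).const_mul _)
            (hB.const_mul _) fun z => ?_
          refine (Real.sum_mul_le_sqrt_mul_sqrt S x fun i => A i z).trans ?_
          exact mul_le_mul_of_nonneg_left
            ((Real.sqrt_le_sqrt (h z)).trans_eq (Real.sqrt_sq (hB0 z))) (Real.sqrt_nonneg _)
      _ = √X * ∫ z, B z ∂μ := integral_const_mul _ _
  rcases hX0.eq_or_lt with h0 | h0
  · rw [← h0]; positivity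
  · have hs := Real.sqrt_pos.2 h0
    have h2 : √X * √X ≤ √X * ∫ z, B z ∂μ := by rwa [Real.mul_self_sqrt hX0]
    have h3 := le_of_mul_le_mul_left h2 hs
    calc X = √X ^ 2 := (Real.sq_sqrt hX0).symm
      _ ≤ _ := pow_le_pow_left₀ hs.le h3 2

end Minkowski

/-! ### Hölder bounds for products of tail factors -/

section TailProduct

variable {s : ℕ} {φ : ℝ → ℝ} {q q' a : ℝ}

/-- The product `∏_{j ∈ v} min(Φ(z_j), 1 - Φ(z_j))^a / φ(z_j)`. -/
def tailProd (φ : ℝ → ℝ) (a : ℝ) (v : Finset (Fin s)) (z : Fin s → ℝ) : ℝ :=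
  ∏ j ∈ v, tailMin φ (z j) ^ a / φ (z j)

theorem tailProd_nonneg (hφ : IsAdmissibleDensity φ) (a : ℝ) (v : Finset (Fin s))
    (z : Fin s → ℝ) : 0 ≤ tailProd φ a v z :=
  Finset.prod_nonneg fun _ _ =>
    div_nonneg (Real.rpow_nonneg (tailMin_pos hφ _).le _) (hφ.pos _).le

theorem measurable_tailProd (hφ : IsAdmissibleDensity φ) (a : ℝ) (v : Finset (Fin s)) :
    Measurable (tailProd φ a v) := by
  refine Finset.measurable_fun_prod _ fun j _ => ?_
  have h : Measurable fun z => tailMin φ z ^ a / φ z :=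
    ((continuous_tailMin hφ).measurable.pow_const a).div hφ.measurable
  exact h.comp (measurable_pi_apply j)

theorem tailProd_eq (φ : ℝ → ℝ) (a : ℝ) (v : Finset (Fin s)) (z : Fin s → ℝ) :
    tailProd φ a v z = ∏ j, if j ∈ v then tailMin φ (z j) ^ a / φ (z j) else 1 := by
  rw [tailProd, Finset.prod_ite_mem, Finset.univ_inter]

theorem memLp_tailProd (hφ : IsAdmissibleDensity φ) (hq : q.HolderConjugate q') (ha : 1 / q < a)
    (v : Finset (Fin s)) :
    MemLp (tailProd φ a v) (ENNReal.ofReal q') (wMeasurePi φ (Fin s)) := by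
  have := isProbabilityMeasure_wMeasure hφ
  have h := memLp_fintype_prod (μ := fun _ : Fin s => wMeasure φ) hq.symm.pos
    (h := fun j z => if j ∈ v then tailMin φ z ^ a / φ z else 1) fun j => by
      by_cases hj : j ∈ v
      · simpa only [hj, if_true] using memLp_tailMin_rpow_div hφ hq ha
      · simpa only [hj, if_false] using memLp_const 1
  exact (memLp_congr_ae (ae_of_all _ fun z => (tailProd_eq φ a v z).symm)).1 h

theorem integral_tailProd_rpow (hφ : IsAdmissibleDensity φ) (v : Finset (Fin s)) :
    ∫ z, tailProd φ a v z ^ q' ∂wMeasurePi φ (Fin s) =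
      (∫ z, (tailMin φ z ^ a / φ z) ^ q' ∂wMeasure φ) ^ v.card := by
  have := isProbabilityMeasure_wMeasure hφ
  have e : ∀ z : Fin s → ℝ, tailProd φ a v z ^ q' =
      ∏ j, if j ∈ v then (tailMin φ (z j) ^ a / φ (z j)) ^ q' else 1 := fun z => by
    rw [tailProd, ← Real.finsetProd_rpow _ _ fun j _ =>
      div_nonneg (Real.rpow_nonneg (tailMin_pos hφ _).le _) (hφ.pos _).le,
      Finset.prod_ite_mem, Finset.univ_inter]
  simp only [e]
  rw [wMeasurePi, integral_fintype_prod_eq_prod (𝕜 := ℝ)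
    (fun (j : Fin s) (z : ℝ) => if j ∈ v then (tailMin φ z ^ a / φ z) ^ q' else 1),
    ← Finset.prod_const, ← Finset.prod_subset (Finset.subset_univ v)]
  · exact Finset.prod_congr rfl fun j hj => by simp only [hj, if_true]
  · intro j _ hj
    simp [hj]

theorem integrable_abs_mul_tailProd (hφ : IsAdmissibleDensity φ) (hq : q.HolderConjugate q')
    (ha : 1 / q < a) {g : (Fin s → ℝ) → ℝ}
    (hg : MemLp g (ENNReal.ofReal q) (wMeasurePi φ (Fin s))) (v : Finset (Fin s)) :
    Integrable (fun z => |g z| * tailProd φ a v z) (wMeasurePi φ (Fin s)) := by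
  have : ENNReal.HolderConjugate (ENNReal.ofReal q) (ENNReal.ofReal q') := hq.ennrealOfReal
  exact hg.norm.integrable_mul (memLp_tailProd hφ hq ha v)

/-- Hölder's inequality. The L^{q'} norm of the product is the |v|-th power of a one-dimensional
norm, hence a cost exponential in |v| and independent of s. -/
theorem integral_abs_mul_tailProd_le (hφ : IsAdmissibleDensity φ) (hq : q.HolderConjugate q')
    (ha : 1 / q < a) {g : (Fin s → ℝ) → ℝ}
    (hg : MemLp g (ENNReal.ofReal q) (wMeasurePi φ (Fin s))) (v : Finset (Fin s)) :
    ∫ z, |g z| * tailProd φ a v z ∂wMeasurePi φ (Fin s) ≤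
      (∫ z, |g z| ^ q ∂wMeasurePi φ (Fin s)) ^ (1 / q) *
        ((∫ z, (tailMin φ z ^ a / φ z) ^ q' ∂wMeasure φ) ^ (1 / q')) ^ v.card := by
  refine (integral_mul_le_Lp_mul_Lq_of_nonneg hq (ae_of_all _ fun z => abs_nonneg (g z))
    (ae_of_all _ fun z => tailProd_nonneg hφ a v z) hg.norm (memLp_tailProd hφ hq ha v)).trans
    (le_of_eq ?_)
  have h0 : 0 ≤ ∫ z, (tailMin φ z ^ a / φ z) ^ q' ∂wMeasure φ := integral_nonneg fun z =>
    Real.rpow_nonneg (div_nonneg (Real.rpow_nonneg (tailMin_pos hφ _).le _) (hφ.pos _).le) _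
  rw [integral_tailProd_rpow hφ, ← Real.rpow_natCast, ← Real.rpow_mul h0, ← Real.rpow_natCast,
    ← Real.rpow_mul h0, mul_comm (v.card : ℝ)]

end TailProduct


/-! ### Square integrability of f^w -/

section SquareIntegrable

open scoped ENNReal

variable {s : ℕ} {φ : ℝ → ℝ} {p q q' : ℝ} {θ : Fin s → ℝ}

theorem memLp_coordKernel (hφ : IsAdmissibleDensity φ) (hp : 1 ≤ p)
    (hθ : ∀ j, 0 < θ j ∧ θ j ≤ 1 / 2) (v : Finset (Fin s)) (j : Fin s) (z : ℝ) (r : ℝ≥0∞) :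
    MemLp (coordKernel φ p θ v j z) r (volume.restrict (Ioo 0 1)) := by
  have := isProbabilityMeasure_restrict_Ioo
  refine MemLp.of_bound
    ((measurable_coordKernel hφ hp hθ v j).comp measurable_prodMk_left).aestronglyMeasurable
    (max ((φ z)⁻¹ * 2) 2) ?_
  filter_upwards [ae_restrict_mem measurableSet_Ioo] with u hu
  rw [coordKernel, Real.norm_eq_abs]
  split_ifs
  · rw [abs_mul, abs_of_pos (inv_pos.2 (hφ.pos z))]
    exact (mul_le_mul_of_nonneg_left (abs_weightKernel_le hp (hθ j).1 (hθ j).2 (cdf_mem_Ioo hφ z) hu)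
      (inv_pos.2 (hφ.pos z)).le).trans (le_max_left _ _)
  · exact (abs_weight_le hp (hθ j).1 (hθ j).2 (Ioo_subset_Icc_self hu)).trans (le_max_right _ _)

/-- The constant may depend on θ here, because only finiteness of the L² norm is wanted. -/
theorem exists_integral_coordKernel_sq_le (hφ : IsAdmissibleDensity φ) (hp : 1 ≤ p)
    (hθ : ∀ j, 0 < θ j ∧ θ j ≤ 1 / 2) {κ : ℝ} (hκ0 : 0 < κ) (hκ1 : κ < 1) (v : Finset (Fin s))
    (j : Fin s) :
    ∃ B : ℝ, 0 ≤ B ∧ ∀ z, ∫ u in Ioo (0 : ℝ) 1, coordKernel φ p θ v j z u ^ 2 ≤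
      (B * if j ∈ v then tailMin φ z ^ ((1 + κ) / 2) / φ z else 1) ^ 2 := by
  by_cases hj : j ∈ v
  · obtain ⟨C, hC, h⟩ := exists_integral_weightKernel_sq_le hp hκ0 hκ1
    have hB : 0 ≤ C * θ j ^ (-κ) := mul_nonneg hC.le (Real.rpow_nonneg (hθ j).1.le _)
    refine ⟨√(C * θ j ^ (-κ)), Real.sqrt_nonneg _, fun z => ?_⟩
    have h1 := h (θ j) (hθ j).1 (hθ j).2 (cdf φ z) (cdf_mem_Ioo hφ z)
    have e : tailMin φ z ^ (κ + 1) = (tailMin φ z ^ ((1 + κ) / 2)) ^ 2 := by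
      rw [← Real.rpow_natCast, ← Real.rpow_mul (tailMin_pos hφ z).le]; congr 1; push_cast; ring
    rw [← tailMin, e] at h1
    simp only [coordKernel, hj, if_true, mul_pow, integral_const_mul, div_pow, Real.sq_sqrt hB]
    calc _ ≤ (φ z)⁻¹ ^ 2 * (C * θ j ^ (-κ) * (tailMin φ z ^ ((1 + κ) / 2)) ^ 2) :=
          mul_le_mul_of_nonneg_left h1 (sq_nonneg _)
      _ = _ := by rw [inv_pow]; ring
  · refine ⟨2, by norm_num, fun z => ?_⟩
    have := isProbabilityMeasure_restrict_Ioo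
    have h2 := (memLp_coordKernel hφ hp hθ v j z 2).integrable_sq
    simp only [hj, if_false, mul_one]
    calc _ ≤ ∫ u in Ioo (0 : ℝ) 1, (2 : ℝ) ^ 2 := by
          refine integral_mono_ae h2 (integrable_const _) ?_
          filter_upwards [ae_restrict_mem measurableSet_Ioo] with u hu
          simp only [coordKernel, hj, if_false]
          rw [← sq_abs]
          exact pow_le_pow_left₀ (abs_nonneg _)
            (abs_weight_le hp (hθ j).1 (hθ j).2 (Ioo_subset_Icc_self hu)) 2
      _ = 2 ^ 2 := by simp

theorem exists_lintegral_prodKernel_sq_le (hφ : IsAdmissibleDensity φ) (hp : 1 ≤ p)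
    (hθ : ∀ j, 0 < θ j ∧ θ j ≤ 1 / 2) {κ : ℝ} (hκ0 : 0 < κ) (hκ1 : κ < 1) (v : Finset (Fin s)) :
    ∃ B : ℝ, 0 ≤ B ∧ ∀ z, ∫⁻ u, ‖prodKernel φ p θ v z u‖ₑ ^ 2 ∂cubeMeasure s ≤
      ‖B * tailProd φ ((1 + κ) / 2) v z‖ₑ ^ 2 := by
  have := isProbabilityMeasure_restrict_Ioo
  choose B hB h using exists_integral_coordKernel_sq_le hφ hp hθ hκ0 hκ1 v
  refine ⟨∏ j, B j, Finset.prod_nonneg fun j _ => hB j, fun z => ?_⟩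
  have hI : Integrable (fun u : Fin s → ℝ => ∏ j, coordKernel φ p θ v j (z j) (u j) ^ 2)
      (cubeMeasure s) := Integrable.fintype_prod_dep (𝕜 := ℝ)
        (f := fun j u => coordKernel φ p θ v j (z j) u ^ 2)
        fun j => (memLp_coordKernel hφ hp hθ v j (z j) 2).integrable_sq
  have e : ∀ x : ℝ, ‖x‖ₑ ^ 2 = ENNReal.ofReal (x ^ 2) := fun x => by
    rw [← sq_abs, ENNReal.ofReal_pow (abs_nonneg x), ← Real.enorm_eq_ofReal_abs]
  simp only [e]
  rw [← ofReal_integral_eq_lintegral_ofReal]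
  · refine ENNReal.ofReal_le_ofReal ?_
    simp only [prodKernel, ← Finset.prod_pow]
    rw [cubeMeasure, integral_fintype_prod_eq_prod (𝕜 := ℝ)
      (fun (j : Fin s) (u : ℝ) => coordKernel φ p θ v j (z j) u ^ 2), tailProd_eq,
      ← Finset.prod_mul_distrib, ← Finset.prod_pow]
    exact Finset.prod_le_prod (fun j _ => integral_nonneg fun u => sq_nonneg _)
      fun j _ => h j (z j)
  · simpa only [prodKernel, Finset.prod_pow] using hI
  · exact ae_of_all _ fun u => sq_nonneg _

/-- Any κ between 1/q and 1 works, since then (1 + κ)/2 > κ. The last condition puts the tail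
product in L^{q'}. -/
theorem exists_kappa (hq : 1 < q) : ∃ κ : ℝ, 0 < κ ∧ κ < 1 ∧ 1 / q < (1 + κ) / 2 := by
  have hq1 : 1 / q < 1 := (div_lt_one (by linarith)).2 hq
  obtain ⟨κ, h1, h2⟩ := exists_between hq1
  have : 0 < 1 / q := by positivity
  exact ⟨κ, by linarith, h2, by linarith⟩

theorem lintegral_sq_kernel_lt_top (hφ : IsAdmissibleDensity φ) (hp : 1 ≤ p)
    (hq : q.HolderConjugate q') (hθ : ∀ j, 0 < θ j ∧ θ j ≤ 1 / 2) {g : (Fin s → ℝ) → ℝ}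
    (hgm : Measurable g) (hg : MemLp g (ENNReal.ofReal q) (wMeasurePi φ (Fin s)))
    (v : Finset (Fin s)) :
    ∫⁻ u, (∫⁻ z, ‖g z * prodKernel φ p θ v z u‖ₑ ∂wMeasurePi φ (Fin s)) ^ 2 ∂cubeMeasure s < ∞ := by
  have := isProbabilityMeasure_wMeasurePi hφ (Fin s)
  have := isProbabilityMeasure_cubeMeasure s
  obtain ⟨κ, hκ0, hκ1, hκ⟩ := exists_kappa hq.lt
  obtain ⟨B, hB, h⟩ := exists_lintegral_prodKernel_sq_le hφ hp hθ hκ0 hκ1 v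
  have hK := measurable_prodKernel hφ hp hθ v
  refine (lintegral_sq_lintegral_le
    (D := fun z => ‖g z‖ₑ * ‖B * tailProd φ ((1 + κ) / 2) v z‖ₑ) ?_ ?_ fun z => ?_).trans_lt ?_
  · exact ((hgm.comp measurable_fst).mul hK).enorm
  · exact hgm.enorm.mul ((measurable_tailProd hφ _ v).const_mul B).enorm
  · simp only [enorm_mul, mul_pow]
    have hKz : Measurable fun u => prodKernel φ p θ v z u := hK.comp measurable_prodMk_left
    rw [lintegral_const_mul _ (hKz.enorm.pow_const 2)]
    refine mul_le_mul_right ?_ _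
    rw [← mul_pow, ← enorm_mul]
    exact h z
  · refine ENNReal.pow_lt_top ?_
    have hI := ((integrable_abs_mul_tailProd hφ hq hκ hg v).const_mul B).2
    rw [hasFiniteIntegral_iff_enorm] at hI
    refine (lintegral_mono fun z => le_of_eq ?_).trans_lt hI
    have e : ‖|g z|‖ₑ = ‖g z‖ₑ := by rw [← Real.norm_eq_abs, enorm_norm]
    simp only [enorm_mul, e]
    ring

theorem integrable_kernel (hφ : IsAdmissibleDensity φ) (hp : 1 ≤ p)
    (hq : q.HolderConjugate q') (hθ : ∀ j, 0 < θ j ∧ θ j ≤ 1 / 2) {g : (Fin s → ℝ) → ℝ}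
    (hgm : Measurable g) (hg : MemLp g (ENNReal.ofReal q) (wMeasurePi φ (Fin s)))
    (v : Finset (Fin s)) :
    Integrable (fun r : (Fin s → ℝ) × (Fin s → ℝ) => g r.2 * prodKernel φ p θ v r.2 r.1)
      ((cubeMeasure s).prod (wMeasurePi φ (Fin s))) := by
  have := isProbabilityMeasure_wMeasurePi hφ (Fin s)
  have := isProbabilityMeasure_cubeMeasure s
  have hm : Measurable fun r : (Fin s → ℝ) × (Fin s → ℝ) => g r.2 * prodKernel φ p θ v r.2 r.1 :=
    (hgm.comp measurable_snd).mul ((measurable_prodKernel hφ hp hθ v).comp measurable_swap)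
  refine ⟨hm.aestronglyMeasurable, ?_⟩
  rw [hasFiniteIntegral_iff_enorm, lintegral_prod _ hm.enorm.aemeasurable]
  -- On a probability space this turns the finite second moment in u into absolute integrability,
  -- which justifies Fubini for the Walsh coefficients.
  have hx : ∀ x : ℝ≥0∞, x ≤ 1 + x ^ 2 := fun x => by
    rcases le_total x 1 with h | h
    · exact h.trans le_self_add
    · refine le_trans ?_ le_add_self
      rw [sq]
      exact le_mul_of_one_le_left zero_le h
  refine (lintegral_mono fun u => hx _).trans_lt ?_
  rw [lintegral_add_left measurable_const]
  refine ENNReal.add_lt_top.2 ⟨by simp, lintegral_sq_kernel_lt_top hφ hp hq hθ hgm hg v⟩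

theorem memLp_integral_kernel (hφ : IsAdmissibleDensity φ) (hp : 1 ≤ p)
    (hq : q.HolderConjugate q') (hθ : ∀ j, 0 < θ j ∧ θ j ≤ 1 / 2) {g : (Fin s → ℝ) → ℝ}
    (hgm : Measurable g) (hg : MemLp g (ENNReal.ofReal q) (wMeasurePi φ (Fin s)))
    (v : Finset (Fin s)) :
    MemLp (fun u => ∫ z, g z * prodKernel φ p θ v z u ∂wMeasurePi φ (Fin s)) 2
      (cubeMeasure s) := by
  have := isProbabilityMeasure_wMeasurePi hφ (Fin s)
  have hm : Measurable fun r : (Fin s → ℝ) × (Fin s → ℝ) => g r.2 * prodKernel φ p θ v r.2 r.1 :=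
    (hgm.comp measurable_snd).mul ((measurable_prodKernel hφ hp hθ v).comp measurable_swap)
  refine ⟨(StronglyMeasurable.integral_prod_right'
    hm.stronglyMeasurable).aestronglyMeasurable, ?_⟩
  rw [eLpNorm_lt_top_iff_lintegral_rpow_enorm_lt_top two_ne_zero ENNReal.ofNat_ne_top]
  refine lt_of_le_of_lt (lintegral_mono fun u => ?_)
    (lintegral_sq_kernel_lt_top hφ hp hq hθ hgm hg v)
  rw [ENNReal.toReal_ofNat, ENNReal.rpow_two]
  gcongr
  exact enorm_integral_le_lintegral_enorm _

end SquareIntegrable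


/-! ### Walsh coefficients of f^w and reduction to one variable -/

section Coefficients

variable {s : ℕ} {φ : ℝ → ℝ} {p q q' α : ℝ} {θ : Fin s → ℝ} {b : ℕ}

/-- The frequency block `L_ℓ` as a finite set. -/
def blockFinset (b : ℕ) (ℓ : Fin s → ℕ) : Finset (Fin s → ℕ) :=
  Fintype.piFinset fun j => (Finset.range (b ^ ℓ j)).filter fun k => digitLength b k = ℓ j

theorem coe_blockFinset (hb : 2 ≤ b) (ℓ : Fin s → ℕ) :
    (blockFinset b ℓ : Set (Fin s → ℕ)) = walshBlock b ℓ := by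
  ext k
  simp only [blockFinset, Finset.mem_coe, Fintype.mem_piFinset, Finset.mem_filter,
    Finset.mem_range, walshBlock, mem_ofPred_eq]
  refine forall_congr' fun j => ⟨fun h => h.2, fun h => ⟨?_, h⟩⟩
  exact (digitLength_le_iff hb _ _).1 h.le

theorem varianceComponent_eq (hb : 2 ≤ b) (g : (Fin s → ℝ) → ℝ) (ℓ : Fin s → ℕ) :
    varianceComponent b g ℓ = ∑ k ∈ blockFinset b ℓ, ‖walshCoeff b g k‖ ^ 2 := by
  rw [varianceComponent, ← coe_blockFinset hb]
  exact Finset.tsum_subtype' (blockFinset b ℓ) fun k => ‖walshCoeff b g k‖ ^ 2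

theorem eq_zero_of_mem_blockFinset {ℓ k : Fin s → ℕ} (hk : k ∈ blockFinset b ℓ) {j : Fin s}
    (hj : ℓ j = 0) : k j = 0 := by
  have := Fintype.mem_piFinset.1 hk j
  rw [hj] at this
  simpa using (Finset.mem_filter.1 this).1

theorem measurable_walshPi (b : ℕ) (k : Fin s → ℕ) : Measurable (walshPi b k) :=
  Finset.measurable_fun_prod _ fun j _ => (measurable_walsh b (k j)).comp (measurable_pi_apply j)

theorem norm_walshPi (b : ℕ) (k : Fin s → ℕ) (u : Fin s → ℝ) : ‖walshPi b k u‖ = 1 := by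
  simp [walshPi, norm_prod, norm_walsh]

theorem integral_kernel_mul_conj_walshPi (hφ : IsAdmissibleDensity φ) (hp : 1 ≤ p)
    (hq : q.HolderConjugate q') (hθ : ∀ j, 0 < θ j ∧ θ j ≤ 1 / 2) {g : (Fin s → ℝ) → ℝ}
    (hgm : Measurable g) (hg : MemLp g (ENNReal.ofReal q) (wMeasurePi φ (Fin s)))
    (v : Finset (Fin s)) (k : Fin s → ℕ) :
    ∫ u, ((∫ z, g z * prodKernel φ p θ v z u ∂wMeasurePi φ (Fin s) : ℝ) : ℂ) *
        starRingEnd ℂ (walshPi b k u) ∂cubeMeasure s =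
      ∫ z, (g z : ℂ) * ∏ j, walshCoeffOne b (coordKernel φ p θ v j (z j)) (k j)
        ∂wMeasurePi φ (Fin s) := by
  have := isProbabilityMeasure_wMeasurePi hφ (Fin s)
  have := isProbabilityMeasure_cubeMeasure s
  have hI : Integrable (Function.uncurry fun u z : Fin s → ℝ =>
      ((g z * prodKernel φ p θ v z u : ℝ) : ℂ) * starRingEnd ℂ (walshPi b k u))
      ((cubeMeasure s).prod (wMeasurePi φ (Fin s))) := by
    refine (integrable_kernel hφ hp hq hθ hgm hg v).ofReal.mul_bdd (c := 1) ?_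
      (ae_of_all _ fun r => ?_)
    · exact (Complex.continuous_conj.measurable.comp
        ((measurable_walshPi b k).comp measurable_fst)).aestronglyMeasurable
    · rw [RCLike.norm_conj, norm_walshPi]
  simp only [← integral_complex_ofReal, ← integral_mul_const]
  refine (integral_integral_swap hI).trans (integral_congr_ae (ae_of_all _ fun z => ?_))
  have e : ∀ u : Fin s → ℝ, ((g z * prodKernel φ p θ v z u : ℝ) : ℂ) *
      starRingEnd ℂ (walshPi b k u) = (g z : ℂ) * ∏ j,
        ((coordKernel φ p θ v j (z j) (u j) : ℂ) * starRingEnd ℂ (walsh b (k j) (u j))) := by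
    intro u
    rw [Finset.prod_mul_distrib, walshPi, map_prod, prodKernel]
    push_cast
    ring
  simp only [e, integral_const_mul]
  rw [cubeMeasure, integral_fintype_prod_eq_prod (𝕜 := ℂ) (fun (j : Fin s) (u : ℝ) =>
    (coordKernel φ p θ v j (z j) u : ℂ) * starRingEnd ℂ (walsh b (k j) u))]
  rfl

theorem walshCoeff_weightedIntegrand (hφ : IsAdmissibleDensity φ) (hp : 1 ≤ p)
    (hq : q.HolderConjugate q') (hθ : ∀ j, 0 < θ j ∧ θ j ≤ 1 / 2) {f : (Fin s → ℝ) → ℝ}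
    {G : Finset (Fin s) → (Fin s → ℝ) → ℝ} (hGm : ∀ v, Measurable (G v))
    (hG : ∀ v, MemLp (G v) (ENNReal.ofReal q) (wMeasurePi φ (Fin s)))
    (h : ∀ᵐ u ∂cubeMeasure s, weightedIntegrand φ p θ f u =
      ∑ v, ∫ z, G v z * prodKernel φ p θ v z u ∂wMeasurePi φ (Fin s)) (k : Fin s → ℕ) :
    walshCoeff b (weightedIntegrand φ p θ f) k =
      ∑ v, ∫ z, (G v z : ℂ) * ∏ j, walshCoeffOne b (coordKernel φ p θ v j (z j)) (k j)
        ∂wMeasurePi φ (Fin s) := by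
  have := isProbabilityMeasure_cubeMeasure s
  rw [walshCoeff, restrict_unitCube]
  simp only [← integral_kernel_mul_conj_walshPi hφ hp hq hθ (hGm _) (hG _)]
  rw [← integral_finsetSum]
  · refine integral_congr_ae ?_
    filter_upwards [h] with u hu
    rw [hu]
    push_cast
    rw [Finset.sum_mul]
  · intro v _
    refine ((memLp_integral_kernel hφ hp hq hθ (hGm v) (hG v) v).integrable
      (by norm_num)).ofReal.mul_bdd (c := 1) ?_ (ae_of_all _ fun u => ?_)
    · exact (Complex.continuous_conj.measurable.comp (measurable_walshPi b k)).aestronglyMeasurable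
    · rw [RCLike.norm_conj, norm_walshPi]

theorem walshCoeffOne_coordKernel_zero (hφ : IsAdmissibleDensity φ) (hp : 1 ≤ p)
    (hθ : ∀ j, 0 < θ j ∧ θ j ≤ 1 / 2) {v : Finset (Fin s)} {j : Fin s} (hj : j ∈ v) (z : ℝ) :
    walshCoeffOne b (coordKernel φ p θ v j z) 0 = 0 := by
  have e : coordKernel φ p θ v j z =
      fun u => (φ z)⁻¹ * weightKernel p (θ j) (cdf φ z) u := by
    ext u; simp only [coordKernel, hj, if_true]
  rw [e, walshCoeffOne_const_mul, walshCoeffOne]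
  simp only [walsh_zero, map_one, mul_one]
  rw [integral_complex_ofReal, integral_weightKernel hp (hθ j).1 (hθ j).2 (cdf_mem_Ioo hφ z)]
  simp

theorem blockEnergy_weight_zero_le (b : ℕ) (hp : 1 ≤ p) {θ : ℝ} (h0 : 0 < θ) (h1 : θ ≤ 1 / 2) :
    blockEnergy b (weight p θ) 0 ≤ 1 := by
  have e : walshCoeffOne b (weight p θ) 0 = 1 := by
    rw [walshCoeffOne]
    simp only [walsh_zero, map_one, mul_one]
    rw [integral_complex_ofReal, setIntegral_weight hp h0 h1]
    simp
  simp [blockEnergy, e, digitLength, Finset.filter_singleton]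

theorem measurable_walshCoeffOne_coordKernel (hφ : IsAdmissibleDensity φ) (hp : 1 ≤ p)
    (hθ : ∀ j, 0 < θ j ∧ θ j ≤ 1 / 2) (v : Finset (Fin s)) (j : Fin s) (k : ℕ) :
    Measurable fun z => walshCoeffOne b (coordKernel φ p θ v j z) k := by
  have hm : Measurable fun r : ℝ × ℝ => (coordKernel φ p θ v j r.1 r.2 : ℂ) *
      starRingEnd ℂ (walsh b k r.2) :=
    (Complex.measurable_ofReal.comp (measurable_coordKernel hφ hp hθ v j)).mul
      (Complex.continuous_conj.measurable.comp ((measurable_walsh b k).comp measurable_snd))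
  exact (StronglyMeasurable.integral_prod_right' hm.stronglyMeasurable).measurable

/-- For fixed z, the sum over k factors into one-dimensional block energies because L_ℓ is a product
of blocks. Minkowski in ℓ²(L_ℓ) then moves the z-integral outside the square root of that sum. -/
theorem sum_norm_sq_integral_le (hφ : IsAdmissibleDensity φ) (hp : 1 ≤ p)
    (hq : q.HolderConjugate q') (hθ : ∀ j, 0 < θ j ∧ θ j ≤ 1 / 2) {a : ℝ} (ha : 1 / q < a)
    {g : (Fin s → ℝ) → ℝ} (hgm : Measurable g)
    (hg : MemLp g (ENNReal.ofReal q) (wMeasurePi φ (Fin s))) {v : Finset (Fin s)}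
    {ℓ : Fin s → ℕ} {c : Fin s → ℝ} (hc : ∀ j, 0 ≤ c j)
    (h : ∀ j z, blockEnergy b (coordKernel φ p θ v j z) (ℓ j) ≤
      c j * (if j ∈ v then tailMin φ z ^ a / φ z else 1) ^ 2) :
    ∑ k ∈ blockFinset b ℓ, ‖∫ z, (g z : ℂ) *
        ∏ j, walshCoeffOne b (coordKernel φ p θ v j (z j)) (k j) ∂wMeasurePi φ (Fin s)‖ ^ 2 ≤
      (∏ j, c j) * (∫ z, |g z| * tailProd φ a v z ∂wMeasurePi φ (Fin s)) ^ 2 := by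
  set A : (Fin s → ℕ) → (Fin s → ℝ) → ℝ := fun k z => ‖(g z : ℂ) *
    ∏ j, walshCoeffOne b (coordKernel φ p θ v j (z j)) (k j)‖ with hA
  have hc0 : 0 ≤ ∏ j, c j := Finset.prod_nonneg fun j _ => hc j
  set B : (Fin s → ℝ) → ℝ := fun z => √(∏ j, c j) * (|g z| * tailProd φ a v z) with hB
  have hBi : Integrable B (wMeasurePi φ (Fin s)) :=
    (integrable_abs_mul_tailProd hφ hq ha hg v).const_mul _
  have hB0 : ∀ z, 0 ≤ B z := fun z => mul_nonneg (Real.sqrt_nonneg _)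
    (mul_nonneg (abs_nonneg _) (tailProd_nonneg hφ a v z))
  have hAB : ∀ z, ∑ k ∈ blockFinset b ℓ, A k z ^ 2 ≤ B z ^ 2 := by
    intro z
    have e1 : ∑ k ∈ blockFinset b ℓ, A k z ^ 2 =
        g z ^ 2 * ∏ j, blockEnergy b (coordKernel φ p θ v j (z j)) (ℓ j) := by
      simp only [hA, blockEnergy, Finset.prod_univ_sum, Finset.mul_sum, norm_mul, norm_prod,
        Complex.norm_real, Real.norm_eq_abs, mul_pow, sq_abs, Finset.prod_pow]
      rfl
    have e2 : B z ^ 2 = g z ^ 2 *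
        ∏ j, c j * (if j ∈ v then tailMin φ (z j) ^ a / φ (z j) else 1) ^ 2 := by
      rw [Finset.prod_mul_distrib, Finset.prod_pow, ← tailProd_eq, hB]
      simp only [mul_pow, Real.sq_sqrt hc0, sq_abs]
      ring
    rw [e1, e2]
    exact mul_le_mul_of_nonneg_left (Finset.prod_le_prod (fun j _ => blockEnergy_nonneg _ _ _)
      fun j _ => h j (z j)) (sq_nonneg _)
  have hAi : ∀ k ∈ blockFinset b ℓ, Integrable (A k) (wMeasurePi φ (Fin s)) := by
    intro k hk
    have hm : Measurable (A k) := by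
      refine ((Complex.measurable_ofReal.comp hgm).mul
        (Finset.measurable_fun_prod _ fun j _ => ?_)).norm
      exact (measurable_walshCoeffOne_coordKernel hφ hp hθ v j (k j)).comp (measurable_pi_apply j)
    refine hBi.mono' hm.aestronglyMeasurable (ae_of_all _ fun z => ?_)
    rw [Real.norm_of_nonneg (norm_nonneg _)]
    refine le_of_sq_le_sq ?_ (hB0 z)
    exact (Finset.single_le_sum (f := fun k => A k z ^ 2) (fun _ _ => sq_nonneg _) hk).trans (hAB z)
  calc _ ≤ ∑ k ∈ blockFinset b ℓ, (∫ z, A k z ∂wMeasurePi φ (Fin s)) ^ 2 :=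
        Finset.sum_le_sum fun k _ =>
          pow_le_pow_left₀ (norm_nonneg _) (norm_integral_le_integral_norm _) 2
    _ ≤ (∫ z, B z ∂wMeasurePi φ (Fin s)) ^ 2 := sum_sq_integral_le _ hAi hBi hB0 hAB
    _ = _ := by rw [hB, integral_const_mul, mul_pow, Real.sq_sqrt hc0]

theorem mem_supp {ℓ : Fin s → ℕ} {j : Fin s} : j ∈ supp ℓ ↔ ℓ j ≠ 0 := by simp [supp]

/-- If v contains some j outside s(ℓ), then k_j = 0 and the mean-zero factor of coordinate j kills
the term. Cauchy–Schwarz over the 2^{|s(ℓ)|} remaining subsets costs that many. -/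
theorem varianceComponent_le_sum (hφ : IsAdmissibleDensity φ) (hb : 2 ≤ b) (hp : 1 ≤ p)
    (hθ : ∀ j, 0 < θ j ∧ θ j ≤ 1 / 2) {g : (Fin s → ℝ) → ℝ}
    {G : Finset (Fin s) → (Fin s → ℝ) → ℝ}
    (h : ∀ k, walshCoeff b g k =
      ∑ v, ∫ z, (G v z : ℂ) * ∏ j, walshCoeffOne b (coordKernel φ p θ v j (z j)) (k j)
        ∂wMeasurePi φ (Fin s)) (ℓ : Fin s → ℕ) :
    varianceComponent b g ℓ ≤ 2 ^ (supp ℓ).card * ∑ v ∈ (supp ℓ).powerset,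
      ∑ k ∈ blockFinset b ℓ, ‖∫ z, (G v z : ℂ) *
        ∏ j, walshCoeffOne b (coordKernel φ p θ v j (z j)) (k j) ∂wMeasurePi φ (Fin s)‖ ^ 2 := by
  rw [varianceComponent_eq hb, Finset.sum_comm, Finset.mul_sum]
  refine Finset.sum_le_sum fun k hk => ?_
  rw [h, ← Finset.sum_subset (Finset.subset_univ (supp ℓ).powerset)]
  · refine (pow_le_pow_left₀ (norm_nonneg _) (norm_sum_le _ _) 2).trans
      (sq_sum_le_card_mul_sum_sq.trans (le_of_eq ?_))
    rw [Finset.card_powerset]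
    push_cast
    rfl
  · intro v _ hv
    obtain ⟨j, hjv, hj⟩ := Finset.not_subset.1 fun h => hv (Finset.mem_powerset.2 h)
    have hk0 := eq_zero_of_mem_blockFinset hk (not_not.1 fun h => hj (mem_supp.2 h))
    have e : ∀ z : Fin s → ℝ,
        ∏ i, walshCoeffOne b (coordKernel φ p θ v i (z i)) (k i) = 0 := fun z => by
      refine Finset.prod_eq_zero (Finset.mem_univ j) ?_
      rw [hk0, walshCoeffOne_coordKernel_zero hφ hp hθ hjv]
    simp [e]

end Coefficients

/-! ### Choice of exponents and the bound for each coordinate -/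

section Estimate

variable {φ : ℝ → ℝ} {p q α ε : ℝ} {b : ℕ}

/-- The kernel estimate needs 0 < γ < 1 + α, and Hölder needs γ > 2/q + α − 1. These are compatible
because q > 1. The part 2α/q of ν enters only through its positivity. -/
theorem exists_gamma (hq : 1 < q) (hα0 : 0 < α) (hε : 0 < ε) :
    ∃ γ : ℝ, 0 < γ ∧ γ < 1 + α ∧ γ ≤ nuExp α q + ε ∧ 1 / q < (γ + 1 - α) / 2 := by
  have hq0 : 0 < q := by linarith
  have hq1 : 1 / q < 1 := (div_lt_one hq0).2 hq
  have h2q : 2 / q = 2 * (1 / q) := by ring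
  have hν1 : 2 * α / q ≤ nuExp α q := le_max_left _ _
  have hν2 : 2 / q + α - 1 ≤ nuExp α q := le_max_right _ _
  have hν0 : 0 < 2 * α / q := by positivity
  have : max 0 (2 / q + α - 1) < min (nuExp α q + ε) (1 + α) := by
    refine max_lt (lt_min ?_ ?_) (lt_min ?_ ?_) <;> linarith
  obtain ⟨γ, h1, h2⟩ := exists_between this
  obtain ⟨h3, h4⟩ := max_lt_iff.1 h1
  obtain ⟨h5, h6⟩ := lt_min_iff.1 h2
  exact ⟨γ, h3, h6, h5.le, by linarith⟩

/-- The bound for the energy of one coordinate factor. -/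
def coordBound {s : ℕ} (b : ℕ) (α η C : ℝ) (θ : Fin s → ℝ) (ℓ : Fin s → ℕ) (v : Finset (Fin s))
    (j : Fin s) : ℝ :=
  (if j ∈ supp ℓ then C else 1) * (b : ℝ) ^ (-α * (ℓ j : ℝ)) *
    (if j ∈ v then θ j ^ η else 1) * if j ∈ supp ℓ \ v then θ j ^ (1 - α) else 1

theorem coordBound_nonneg {s : ℕ} {η C : ℝ} (hC : 0 < C) {θ : Fin s → ℝ} (hθ : ∀ j, 0 < θ j)
    (ℓ : Fin s → ℕ) (v : Finset (Fin s)) (j : Fin s) : 0 ≤ coordBound b α η C θ ℓ v j := by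
  have := hθ j
  rw [coordBound]
  split_ifs <;> positivity

theorem prod_coordBound {s : ℕ} (hb : 2 ≤ b) (α η C : ℝ) (θ : Fin s → ℝ) (ℓ : Fin s → ℕ)
    (v : Finset (Fin s)) :
    ∏ j, coordBound b α η C θ ℓ v j = C ^ (supp ℓ).card * (b : ℝ) ^ (-α * ∑ j, (ℓ j : ℝ)) *
      (∏ j ∈ v, θ j ^ η) * ∏ j ∈ supp ℓ \ v, θ j ^ (1 - α) := by
  have hb0 : (0 : ℝ) < b := by positivity
  simp only [coordBound, Finset.prod_mul_distrib, Finset.prod_ite_mem, Finset.univ_inter,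
    Finset.prod_const]
  rw [Finset.mul_sum, Real.rpow_sum_of_pos hb0]

/-- Three kinds of coordinates: j ∈ v uses the kernel estimate, j ∈ s(ℓ) \ v the weight estimate,
and outside s(ℓ) only k = 0 occurs, with coefficient 1. Passing from −γ to η is a weakening because
θ_j ≤ 1. -/
theorem exists_blockEnergy_coordKernel_le (hφ : IsAdmissibleDensity φ) (hb : 2 ≤ b) (hp : 1 ≤ p)
    (hα0 : 0 < α) (hα1 : α < 1) {γ η : ℝ} (hγ0 : 0 < γ) (hγ1 : γ < 1 + α) (hη : η ≤ -γ) :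
    ∃ C : ℝ, 0 < C ∧ ∀ (s : ℕ) (θ : Fin s → ℝ), (∀ j, 0 < θ j ∧ θ j ≤ 1 / 2) →
      ∀ (ℓ : Fin s → ℕ) (v : Finset (Fin s)), v ⊆ supp ℓ → ∀ (j : Fin s) (z : ℝ),
        blockEnergy b (coordKernel φ p θ v j z) (ℓ j) ≤ coordBound b α η C θ ℓ v j *
          (if j ∈ v then tailMin φ z ^ ((γ + 1 - α) / 2) / φ z else 1) ^ 2 := by
  have hb0 : (0 : ℝ) < b := by positivity
  obtain ⟨C₁, hC₁, h₁⟩ := exists_blockEnergy_weight_le hb hp hα0 hα1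
  obtain ⟨C₂, hC₂, h₂⟩ := exists_blockEnergy_weightKernel_le hb hp hα0 hα1 hγ0 hγ1
  refine ⟨max C₁ C₂, lt_max_of_lt_left hC₁, fun s θ hθ ℓ v hv j z => ?_⟩
  have hθj := (hθ j).1
  have hbl : 0 < (b : ℝ) ^ (-α * (ℓ j : ℝ)) := Real.rpow_pos_of_pos hb0 _
  by_cases hjv : j ∈ v
  · have hjs := hv hjv
    have e : coordKernel φ p θ v j z =
        fun u => (φ z)⁻¹ * weightKernel p (θ j) (cdf φ z) u := by
      ext u; simp only [coordKernel, hjv, if_true]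
    have et : tailMin φ z ^ (γ + 1 - α) = (tailMin φ z ^ ((γ + 1 - α) / 2)) ^ 2 := by
      rw [← Real.rpow_natCast, ← Real.rpow_mul (tailMin_pos hφ z).le]; congr 1; push_cast; ring
    have h3 := h₂ (θ j) hθj (hθ j).2 (cdf φ z) (cdf_mem_Ioo hφ z) (ℓ j) (mem_supp.1 hjs)
    rw [← tailMin, et] at h3
    have h4 : C₂ * (b : ℝ) ^ (-α * (ℓ j : ℝ)) * θ j ^ (-γ) ≤
        max C₁ C₂ * (b : ℝ) ^ (-α * (ℓ j : ℝ)) * θ j ^ η := by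
      gcongr ?_ * _ * ?_
      · exact le_max_right _ _
      · exact Real.rpow_le_rpow_of_exponent_ge hθj (by linarith [(hθ j).2]) hη
    have h5 := h3.trans (mul_le_mul_of_nonneg_right h4 (sq_nonneg _))
    rw [e, blockEnergy_const_mul]
    simp only [coordBound, hjv, hjs, if_true, Finset.mem_sdiff, not_true, and_false, if_false,
      mul_one, div_pow]
    calc _ ≤ (φ z)⁻¹ ^ 2 * _ := mul_le_mul_of_nonneg_left h5 (sq_nonneg _)
      _ = _ := by rw [inv_pow]; ring
  · have e : coordKernel φ p θ v j z = weight p (θ j) := by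
      ext u; simp only [coordKernel, hjv, if_false]
    rw [e]
    by_cases hjs : j ∈ supp ℓ
    · simp only [coordBound, hjv, hjs, if_true, if_false, Finset.mem_sdiff, not_false_iff, and_self,
        mul_one, one_pow]
      refine (h₁ (θ j) hθj (hθ j).2 (ℓ j) (mem_supp.1 hjs)).trans ?_
      gcongr
      exact le_max_left _ _
    · have h0 : ℓ j = 0 := not_not.1 fun h => hjs (mem_supp.2 h)
      simp only [coordBound, hjv, hjs, if_false, Finset.mem_sdiff, false_and, h0, Nat.cast_zero,
        mul_zero, Real.rpow_zero, mul_one, one_pow]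
      exact blockEnergy_weight_zero_le b hp hθj (hθ j).2

end Estimate

end BDIS

end

open BDIS MeasureTheory

theorem mainTheorem6 (φ : ℝ → ℝ) (hφ : BDIS.IsAdmissibleDensity φ) (b : ℕ) (hb : 2 ≤ b)
    (α ε p q : ℝ) (hα0 : 0 < α) (hα1 : α < 1) (hε : 0 < ε) (hp : 1 ≤ p) (hq : 1 < q) :
    ∃ C : ℝ, 0 < C ∧
      ∀ (s : ℕ) (f : (Fin s → ℝ) → ℝ), BDIS.MemWMix φ q f →
      ∀ θ : Fin s → ℝ, (∀ j, 0 < θ j ∧ θ j ≤ 1 / 2) →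
        (∀ v : Finset (Fin s), BDIS.MemWMix φ q (BDIS.anovaTerm φ f v)) ∧
        MeasureTheory.MemLp (BDIS.weightedIntegrand φ p θ f) 2
          (MeasureTheory.volume.restrict (BDIS.unitCube s)) ∧
        ∀ ℓ : Fin s → ℕ, ℓ ≠ 0 →
          BDIS.varianceComponent b (BDIS.weightedIntegrand φ p θ f) ℓ ≤
            C ^ (BDIS.supp ℓ).card * (b : ℝ) ^ (-α * ∑ j, (ℓ j : ℝ)) *
              ∑ v ∈ (BDIS.supp ℓ).powerset,
                BDIS.wMixNorm φ q (BDIS.anovaTerm φ f v) ^ 2 *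
                  (∏ j ∈ v, θ j ^ (-BDIS.nuExp α q - ε)) *
                  ∏ j ∈ BDIS.supp ℓ \ v, θ j ^ (1 - α) := by
  open BDIS MeasureTheory in
  have hqq := Real.HolderConjugate.conjExponent hq
  set q' := q.conjExponent
  obtain ⟨γ, hγ0, hγ1, hγν, hγq⟩ := exists_gamma hq hα0 hε
  have hη : -nuExp α q - ε ≤ -γ := by linarith
  obtain ⟨C₀, hC₀, hE⟩ := exists_blockEnergy_coordKernel_le hφ hb hp hα0 hα1 hγ0 hγ1 hη
  set K := (∫ z, (tailMin φ z ^ ((γ + 1 - α) / 2) / φ z) ^ q' ∂wMeasure φ) ^ (1 / q')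
  have hM : 1 ≤ max 1 (K ^ 2) := le_max_left _ _
  -- The 2 counts subsets of s(ℓ), C₀ comes from the coordinate energies, and K from Hölder. The
  -- maximum with 1 permits raising K^{2|v|} to the exponent |s(ℓ)| ≥ |v| even when K < 1.
  refine ⟨2 * C₀ * max 1 (K ^ 2), by positivity, fun s f hf θ hθ => ?_⟩
  obtain ⟨hanova, G, hGm, hG, hGn, hrep⟩ := hf.exists_representation hφ hqq
  have hfw := ae_weightedIntegrand_eq hφ hp hθ hrep
  refine ⟨hanova, ?_, fun ℓ _ => ?_⟩
  · rw [restrict_unitCube]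
    exact (memLp_finsetSum Finset.univ fun v _ =>
      memLp_integral_kernel hφ hp hqq hθ (hGm v) (hG v) v).ae_eq (by
        filter_upwards [hfw] with u hu using hu.symm)
  · have hb0 : (0 : ℝ) < b := by positivity
    refine (varianceComponent_le_sum hφ hb hp hθ
      (walshCoeff_weightedIntegrand hφ hp hqq hθ hGm hG hfw) ℓ).trans ?_
    rw [Finset.mul_sum (supp ℓ).powerset, Finset.mul_sum (supp ℓ).powerset]
    refine Finset.sum_le_sum fun v hv => ?_
    have hvS := Finset.mem_powerset.1 hv
    have h1 := sum_norm_sq_integral_le hφ hp hqq hθ hγq (hGm v) (hG v)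
      (fun j => coordBound_nonneg hC₀ (fun j => (hθ j).1) ℓ v j) (hE s θ hθ ℓ v hvS)
    rw [prod_coordBound hb] at h1
    set Θ₁ := ∏ j ∈ v, θ j ^ (-nuExp α q - ε)
    set Θ₂ := ∏ j ∈ supp ℓ \ v, θ j ^ (1 - α)
    set N := wMixNorm φ q (anovaTerm φ f v)
    set S := (supp ℓ).card
    set β := (b : ℝ) ^ (-α * ∑ j, (ℓ j : ℝ))
    have hΘ₁ : 0 ≤ Θ₁ := Finset.prod_nonneg fun j _ => Real.rpow_nonneg (hθ j).1.le _
    have hΘ₂ : 0 ≤ Θ₂ := Finset.prod_nonneg fun j _ => Real.rpow_nonneg (hθ j).1.le _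
    have hβ : 0 ≤ β := Real.rpow_nonneg hb0.le _
    have hK0 : 0 ≤ K := Real.rpow_nonneg (integral_nonneg fun z => Real.rpow_nonneg
      (div_nonneg (Real.rpow_nonneg (tailMin_pos hφ _).le _) (hφ.pos _).le) _) _
    have h2 : ∫ z, |G v z| * tailProd φ ((γ + 1 - α) / 2) v z ∂wMeasurePi φ (Fin s) ≤
        N * K ^ v.card :=
      (integral_abs_mul_tailProd_le hφ hqq hγq (hG v) v).trans
        (mul_le_mul_of_nonneg_right (hGn v) (pow_nonneg hK0 _))
    have h3 : (∫ z, |G v z| * tailProd φ ((γ + 1 - α) / 2) v z ∂wMeasurePi φ (Fin s)) ^ 2 ≤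
        N ^ 2 * max 1 (K ^ 2) ^ S := by
      refine (pow_le_pow_left₀ (integral_nonneg fun z =>
        mul_nonneg (abs_nonneg _) (tailProd_nonneg hφ _ v z)) h2 2).trans ?_
      rw [mul_pow, ← pow_mul, mul_comm v.card, pow_mul]
      refine mul_le_mul_of_nonneg_left ?_ (sq_nonneg _)
      exact (pow_le_pow_left₀ (sq_nonneg _) (le_max_right _ _) _).trans
        (pow_le_pow_right₀ hM (Finset.card_le_card hvS))
    calc _ ≤ 2 ^ S * (C₀ ^ S * β * Θ₁ * Θ₂ * (N ^ 2 * max 1 (K ^ 2) ^ S)) := by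
          refine mul_le_mul_of_nonneg_left (h1.trans ?_) (by positivity)
          exact mul_le_mul_of_nonneg_left h3 (by positivity)
      _ = _ := by rw [mul_pow, mul_pow]; ring
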